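/- Let $d\ge 1$, let $\lambda$ be Lebesgue measure on $\mathbb{R}^d$, and let $U,V:\mathbb{R}^d\to\mathbb{R}$, $W:\mathbb{R}^d\times\mathbb{R}^d\to\mathbb{R}$ be measurable functions such that $\mu=\lambda_U:=e^{-U(x)}\lambda(dx)$ and $\eta=\lambda_V:=e^{-V(y)}\lambda(dy)$ are probability measures and $K_W(x,dy):=e^{-W(x,y)}\lambda(dy)$ is a Markov transition. Put $W^\flat(y,x)=W(x,y)$ and $P(d(x,y))=\mu(dx)K_W(x,dy)$. $\Pi(\nu,\nu')$ is the set of couplings of $\nu,\nu'$; $\mathcal{H}(\nu|\nu')$ is the relative entropy; $\mathcal{D}_2$ is the $2$-Wasserstein distance; $\mathcal{J}(\nu|\nu')=\int \|\nabla f\|^2/f\,d\nu'$ with $f=d\nu/d\nu'$ is the relative Fisher information ($\nabla$ in the weak sense, $\infty$ if $\nu\not\ll\nu'$ or $f$ is not weakly differentiable); $\|\cdot\|_2$ is the Euclidean norm or the spectral norm; matrix inequalities are in the Löwner order. *Sinkhorn bridges.* Define $V_0=0$, $U_{2n}=U_{2n+1}=U+\log K_W(e^{-V_{2n}})$, $V_{2n+1}=V_{2n+2}=V+\log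 K_{W^\flat}(e^{-U_{2n+1}})$, and $W_{2n}(x,y)=U_{2n}(x)-U(x)+W(x,y)+V_{2n}(y)$, $W^\flat_{2n+1}(y,x)=U_{2n+1}(x)+W(x,y)+V_{2n+1}(y)-V(y)$. Let $\mathcal{K}_{2n}=K_{W_{2n}}$, $\mathcal{K}_{2n+1}=K_{W^\flat_{2n+1}}$, $\mathcal{P}_{2n}(d(x,y))=\mu(dx)\mathcal{K}_{2n}(x,dy)$, $\mathcal{P}_{2n+1}(d(x,y))=\eta(dy)\mathcal{K}_{2n+1}(y,dx)$, $\pi_{2n}=\mu\mathcal{K}_{2n}$, $\pi_{2n+1}=\eta\mathcal{K}_{2n+1}$. Then $(\mathcal{P}_n)$ is the Sinkhorn sequence: $\mathcal{P}_0=P$, $\mathcal{P}_{2n+1}$ minimizes $\mathcal{H}(\cdot|\mathcal{P}_{2n})$ over the measures with second marginal $\eta$, and $\mathcal{P}_{2n+2}$ minimizes $\mathcal{H}(\cdot|\mathcal{P}_{2n+1})$ over the measures with first marginal $\mu$. *Conditions.* A measure $\nu$ satisfies $\mathbb{T}_2(\rho)$, $\rho>0$, if $\frac12\mathcal{D}_2(\nu',\nu)^2\le\rho\,\mathcal{H}(\nu'|\nu)$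 for all probability measures $\nu'$, and $LS(\rho)$ if $\mathcal{H}(\nu'|\nu)\le\frac{\rho}{2}\mathcal{J}(\nu'|\nu)$ for all probability measures $\nu'$. For $\kappa,\rho>0$, a Markov transition $\mathcal{K}$ satisfies $A_0(\mathcal{K})$ with $(\kappa,\rho)$ if (i) for all probability measures $\nu,\nu'$, $\inf_{R\in\Pi(\nu,\nu')}\int\mathcal{H}(\delta_{x_1}\mathcal{K}|\delta_{x_2}\mathcal{K})\,R(d(x_1,x_2))\le\frac{\rho}{2}\inf_{R\in\Pi(\nu,\nu')}\int\mathcal{J}(\delta_{x_1}\mathcal{K}|\delta_{x_2}\mathcal{K})\,R(d(x_1,x_2))$, and (ii) $\mathcal{J}(\delta_{x_1}\mathcal{K}|\delta_{x_2}\mathcal{K})\le\kappa^2\|x_1-x_2\|_2^2$ for all $x_1,x_2$. Let $\varepsilon_\kappa(\rho_1,\rho_2)=\kappa^2\rho_1\rho_2$. - $A_U(\mathcal{S})$: for every $n\ge1$, $A_0(\mathcal{K}_{2n})$ holds for some $(\kappa_{2n},\rho_{2n})$, and $\lambda_U$ satisfies $\mathbb{T}_2(\|u_+\|_2)$ for some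 positive definite $u_+$. Set $\varepsilon_{2n}=\varepsilon_{\kappa_{2n}}(\rho_{2n},\|u_+\|_2)$. - $A_V(\mathcal{S})$: for every $n\ge1$, $A_0(\mathcal{K}_{2n-1})$ holds for some $(\kappa_{2n-1},\rho_{2n-1})$, and $\lambda_V$ satisfies $\mathbb{T}_2(\|v_+\|_2)$ for some positive definite $v_+$. Set $\varepsilon_{2n-1}=\varepsilon_{\kappa_{2n-1}}(\rho_{2n-1},\|v_+\|_2)$. - $(\mathcal{W})$ with $\kappa>0$ and positive definite $\widehat u,\widehat v$: $\|\nabla_2W(x_1,y)-\nabla_2W(x_2,y)\|_2\le\kappa\|x_1-x_2\|_2$, the same for $W^\flat$, and $\nabla_1^2W(x,y_1)-\nabla_1^2W(x,y_2)\le\widehat u^{-1}$, $\nabla_1^2W^\flat(y,x_1)-\nabla_1^2W^\flat(y,x_2)\le\widehat v^{-1}$, for all arguments. - $C_V^-(U)$ with $u_+,v_+$ positive definite, $\overline u_+$ positive semi-definite, $\delta\ge0$: $\nabla^2U(x)\ge u_+^{-1}1_{\|x\|_2\ge\delta}-\overline u_+1_{\|x\|_2<\delta}$ for all $x$, and $\lambda_V$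 satisfies $\mathbb{T}_2(\|v_+\|_2)$. $C_U^-(V)$ is the same with the roles of $U,V$ exchanged: $\nabla^2V(y)\ge v_+^{-1}1_{\|y\|_2\ge\delta}-\overline v_+1_{\|y\|_2<\delta}$, and $\lambda_U$ satisfies $\mathbb{T}_2(\|u_+\|_2)$. **Theorem.** In statement 1, and in the entropy inequalities of statements 2 and 3, assume that some coupling in $\Pi(\mu,\eta)$ has finite entropy relative to $P$, and let $P_{\mu,\eta}$ be the Schrödinger bridge, i.e. a minimizer of $\mathcal{H}(\cdot|P)$ over $\Pi(\mu,\eta)$. 1. If $A_U(\mathcal{S})$ holds, then for all $n\ge1$ $$\mathcal{H}(P_{\mu,\eta}|\mathcal{P}_{2n})\le(1+\varepsilon_{2n}^{-1})^{-1}\,\mathcal{H}(P_{\mu,\eta}|\mathcal{P}_{2(n-1)}).$$ If $A_V(\mathcal{S})$ holds, then for all $n\ge1$ $$\mathcal{H}(P_{\mu,\eta}|\mathcal{P}_{2n+1})\le(1+\varepsilon_{2n+1}^{-1})^{-1}\,\mathcal{H}(P_{\mu,\eta}|\mathcal{P}_{2n-1}).$$ There is moreover a function $\rho(\cdot,\cdot,\cdot)$,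 depending only on $d$ and positive for every positive definite first, positive semi-definite second and non-negative third argument, such that the following holds whenever $U,V,W$ are twice continuously differentiable. 2. If $(\mathcal{W})$ and $C_U^-(V)$ hold with $\kappa>0$ and $0<v_+<\widehat v$, put $\widetilde v^{-1}=v_+^{-1}-\widehat v^{-1}$ and $\widetilde\rho_v=\rho(\widetilde v,\overline v_++\widehat v^{-1},\delta)$. Then for all $n\geq 1$ and $x$ the measure $\mathcal{K}_{2n}(x,\cdot)$ satisfies $LS(\widetilde\rho_v)$; $A_U(\mathcal{S})$ holds with $\kappa_{2n}=\kappa$, $\rho_{2n}=\widetilde\rho_v$ and $u_+$; and with $\varepsilon_{2n}=\varepsilon_\kappa(\widetilde\rho_v,\|u_+\|_2)$, for all $n\ge1$, $\mathcal{H}(\eta|\pi_{2n})\le\mathcal{H}(P_{\mu,\eta}|\mathcal{P}_{2n})\le\varepsilon_{2n}\,\mathcal{H}(\pi_{2n-1}|\mu)$, and the first inequality of 1 holds. 3. If $(\mathcal{W})$ and $C_V^-(U)$ hold with $\kappa>0$ and $0<u_+<\widehat u$, put $\widetilde u^{-1}=u_+^{-1}-\widehat u^{-1}$ and $\widetilde\rho_u=\rho(\widetilde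 u,\overline u_++\widehat u^{-1},\delta)$. Then for all $n\geq 1$ and $y$ the measure $\mathcal{K}_{2n-1}(y,\cdot)$ satisfies $LS(\widetilde\rho_u)$; $A_V(\mathcal{S})$ holds with $\kappa_{2n-1}=\kappa$, $\rho_{2n-1}=\widetilde\rho_u$ and $v_+$; and with $\varepsilon_{2n+1}=\varepsilon_\kappa(\widetilde\rho_u,\|v_+\|_2)$, $\mathcal{H}(\mu|\pi_{2n+1})\le\mathcal{H}(P_{\mu,\eta}|\mathcal{P}_{2n+1})\le\varepsilon_{2n+1}\,\mathcal{H}(\pi_{2n}|\eta)$ for all $n\ge0$, and the second inequality of 1 holds for all $n\ge 1$. -/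

import Mathlib

open MeasureTheory ProbabilityTheory InformationTheory
open scoped ENNReal ContDiff

noncomputable section

namespace SinkhornBridge

/-- The state space `ℝ^d` with its Euclidean norm. -/
abbrev Eucl (d : ℕ) : Type := EuclideanSpace ℝ (Fin d)

variable {d : ℕ}

/-! ### Linear algebra and differential operators -/

/-- The spectral norm of a matrix (operator norm for the Euclidean norm). -/
def specNorm (A : Matrix (Fin d) (Fin d) ℝ) : ℝ :=
  ‖Matrix.toEuclideanCLM (n := Fin d) (𝕜 := ℝ) A‖

/-- The Hessian matrix of `f` at `x`. -/
def hess (f : Eucl d → ℝ) (x : Eucl d) : Matrix (Fin d) (Fin d) ℝ :=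
  Matrix.of fun i j =>
    fderiv ℝ (fderiv ℝ f) x (EuclideanSpace.single i 1) (EuclideanSpace.single j 1)

/-- `G` is a weak gradient of `f` on `ℝ^d`: `∫ f ∇φ = - ∫ φ G` for all test functions `φ`. -/
def HasWeakGradient (f : Eucl d → ℝ) (G : Eucl d → Eucl d) : Prop :=
  LocallyIntegrable f volume ∧ LocallyIntegrable G volume ∧
    ∀ φ : Eucl d → ℝ, ContDiff ℝ ∞ φ → HasCompactSupport φ →
      ∫ x, f x • gradient φ x = - ∫ x, φ x • G x

/-! ### Couplings, transport costs, Fisher information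

The relative entropy `H(ν | μ)` is Mathlib's `klDiv ν μ`. -/

/-- `Q` is a coupling of `μ` (first marginal) and `η` (second marginal). -/
def IsCoupling (Q : Measure (Eucl d × Eucl d)) (μ η : Measure (Eucl d)) : Prop :=
  Q.fst = μ ∧ Q.snd = η

/-- Kantorovich transport cost between `ν` and `μ` for the cost function `c`. -/
def transportCost (c : Eucl d → Eucl d → ℝ≥0∞) (ν μ : Measure (Eucl d)) : ℝ≥0∞ :=
  ⨅ (Q : Measure (Eucl d × Eucl d)) (_ : IsCoupling Q ν μ), ∫⁻ p, c p.1 p.2 ∂Q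

/-- The squared `2`-Wasserstein distance. -/
def wasserstein2Sq (ν μ : Measure (Eucl d)) : ℝ≥0∞ :=
  transportCost (fun x y => ENNReal.ofReal (‖x - y‖ ^ 2)) ν μ

/-- Relative Fisher information `∫ ‖∇f‖² / f dμ` with `f = dν/dμ`; it is `∞` when `ν` is not
absolutely continuous, or when the density is not weakly differentiable.  When `μ` has a positive
Lebesgue density, `f` and its weak gradient are unique almost everywhere, so that the infimum is
over at most one value. -/
def fisherInfo (ν μ : Measure (Eucl d)) : ℝ≥0∞ :=
  ⨅ (f : Eucl d → ℝ) (G : Eucl d → Eucl d)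
    (_ : ν ≪ μ ∧ (∀ x, 0 ≤ f x) ∧ ν.rnDeriv μ =ᵐ[μ] (fun x => ENNReal.ofReal (f x)) ∧
      HasWeakGradient f G),
    ∫⁻ x, ENNReal.ofReal (‖G x‖ ^ 2 / f x) ∂μ

/-! ### Functional inequalities -/

/-- Quadratic transportation cost inequality `T₂(ρ)` for a measure. -/
def TalagrandT2 (μ : Measure (Eucl d)) (ρ : ℝ) : Prop :=
  0 < ρ ∧ ∀ ν : Measure (Eucl d), IsProbabilityMeasure ν →
    (1 / 2 : ℝ≥0∞) * wasserstein2Sq ν μ ≤ ENNReal.ofReal ρ * klDiv ν μ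

/-- Log-Sobolev inequality `LS(ρ)` for a measure. -/
def LogSobolev (μ : Measure (Eucl d)) (ρ : ℝ) : Prop :=
  0 < ρ ∧ ∀ ν : Measure (Eucl d), IsProbabilityMeasure ν →
    klDiv ν μ ≤ ENNReal.ofReal (ρ / 2) * fisherInfo ν μ

/-- Local log-Sobolev inequality `LS_loc(ρ)` for a transition. -/
def LocalLogSobolev (K : Kernel (Eucl d) (Eucl d)) (ρ : ℝ) : Prop :=
  0 < ρ ∧ ∀ ν μ : Measure (Eucl d), IsProbabilityMeasure ν → IsProbabilityMeasure μ →
    transportCost (fun x₁ x₂ => klDiv (K x₁) (K x₂)) ν μ ≤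
      ENNReal.ofReal (ρ / 2) * transportCost (fun x₁ x₂ => fisherInfo (K x₁) (K x₂)) ν μ

/-- Fisher-Lipschitz inequality `J₂(κ)` for a transition. -/
def FisherLipschitz (K : Kernel (Eucl d) (Eucl d)) (κ : ℝ) : Prop :=
  0 < κ ∧ ∀ x₁ x₂ : Eucl d,
    fisherInfo (K x₁) (K x₂) ≤ ENNReal.ofReal (κ ^ 2 * ‖x₁ - x₂‖ ^ 2)

/-- Condition `A₀(K)` with parameters `(κ, ρ)`, for a Markov transition `K`. -/
def CondA0 (K : Kernel (Eucl d) (Eucl d)) (κ ρ : ℝ) : Prop :=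
  IsMarkovKernel K ∧ LocalLogSobolev K ρ ∧ FisherLipschitz K κ

/-- `ε_κ(ρ₁, ρ₂) = κ² ρ₁ ρ₂`. -/
def epsRate (κ ρ₁ ρ₂ : ℝ) : ℝ := κ ^ 2 * ρ₁ * ρ₂

/-! ### Gibbs measures, Schrödinger bridges, Sinkhorn bridges -/

/-- The measure `λ_U(dx) = exp(-U(x)) dx`. -/
def gibbs (U : Eucl d → ℝ) : Measure (Eucl d) :=
  volume.withDensity fun x => ENNReal.ofReal (Real.exp (-U x))

/-- The integral operator `K_W(x,dy) = exp(-W(x,y)) dy`. -/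
def gibbsKernel (W : Eucl d → Eucl d → ℝ) : Kernel (Eucl d) (Eucl d) :=
  Kernel.withDensity (Kernel.const (Eucl d) volume) fun x y => ENNReal.ofReal (Real.exp (-W x y))

/-- The function `K_W(f)(x) = ∫ exp(-W(x,y)) f(y) dy`. -/
def gibbsOp (W : Eucl d → Eucl d → ℝ) (f : Eucl d → ℝ) (x : Eucl d) : ℝ :=
  ∫ y, Real.exp (-W x y) * f y

/-- `W^♭(y,x) = W(x,y)`. -/
def flat (W : Eucl d → Eucl d → ℝ) : Eucl d → Eucl d → ℝ := fun y x => W x y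

/-- `Q` minimizes `H(· | P)` over a set `S` of measures. -/
def IsEntropicProjection (P : Measure (Eucl d × Eucl d)) (S : Set (Measure (Eucl d × Eucl d)))
    (Q : Measure (Eucl d × Eucl d)) : Prop :=
  Q ∈ S ∧ ∀ R ∈ S, klDiv Q P ≤ klDiv R P

/-- `Q` is a Schrödinger bridge from `μ` to `η` with reference measure `P`. -/
def IsSchrodingerBridge (P : Measure (Eucl d × Eucl d)) (μ η : Measure (Eucl d))
    (Q : Measure (Eucl d × Eucl d)) : Prop :=
  IsEntropicProjection P {R | IsCoupling R μ η} Q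

/-- `(P_n)` is the sequence of Sinkhorn's alternating entropic projections started at `P`. -/
def IsSinkhornSequence (P : Measure (Eucl d × Eucl d)) (μ η : Measure (Eucl d))
    (Pn : ℕ → Measure (Eucl d × Eucl d)) : Prop :=
  Pn 0 = P ∧
    (∀ n, IsEntropicProjection (Pn (2 * n)) {R | R.snd = η} (Pn (2 * n + 1))) ∧
    ∀ n, IsEntropicProjection (Pn (2 * n + 1)) {R | R.fst = μ} (Pn (2 * n + 2))

/-- The pair `(U_n, V_n)` of Sinkhorn potentials:
`V_0 = 0`, `U_{2n} = U + log K_W(exp(-V_{2n})) = U_{2n+1}`,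
`V_{2n+1} = V + log K_{W^♭}(exp(-U_{2n+1})) = V_{2n+2}`. -/
def sinkhornPot (U V : Eucl d → ℝ) (W : Eucl d → Eucl d → ℝ) :
    ℕ → (Eucl d → ℝ) × (Eucl d → ℝ)
  | 0 => (fun x => U x + Real.log (gibbsOp W (fun _ => Real.exp (-0)) x), fun _ => 0)
  | n + 1 =>
    let p := sinkhornPot U V W n
    if Even n then
      (p.1, fun y => V y + Real.log (gibbsOp (flat W) (fun x => Real.exp (-p.1 x)) y))
    else
      (fun x => U x + Real.log (gibbsOp W (fun y => Real.exp (-p.2 y)) x), p.2)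

/-- The potential of the `n`-th Sinkhorn transition: `W_n(x,y)` for even `n`, with
`U(x) + W_n(x,y) = U_n(x) + W(x,y) + V_n(y)`, and `W_n^♭(y,x)` for odd `n`, with
`V(y) + W_n^♭(y,x) = U_n(x) + W(x,y) + V_n(y)`. -/
def sinkhornW (U V : Eucl d → ℝ) (W : Eucl d → Eucl d → ℝ) (n : ℕ) : Eucl d → Eucl d → ℝ :=
  let p := sinkhornPot U V W n
  if Even n then fun x y => p.1 x + W x y + p.2 y - U x
  else fun y x => p.1 x + W x y + p.2 y - V y

/-- The `n`-th Sinkhorn transition `K_n`: it moves `x` to `y` for even `n` and `y` to `x` for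
odd `n`. -/
def sinkhornKernel (U V : Eucl d → ℝ) (W : Eucl d → Eucl d → ℝ) (n : ℕ) :
    Kernel (Eucl d) (Eucl d) :=
  gibbsKernel (sinkhornW U V W n)

/-- The `n`-th Sinkhorn bridge: `P_n(d(x,y)) = μ(dx) K_n(x,dy)` for even `n` and
`P_n(d(x,y)) = η(dy) K_n(y,dx)` for odd `n`, with `(μ, η) = (λ_U, λ_V)`. -/
def sinkhornBridge (U V : Eucl d → ℝ) (W : Eucl d → Eucl d → ℝ) (n : ℕ) :
    Measure (Eucl d × Eucl d) :=
  if Even n then gibbs U ⊗ₘ sinkhornKernel U V W n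
  else (gibbs V ⊗ₘ sinkhornKernel U V W n).map Prod.swap

/-- The `n`-th Sinkhorn distribution: `π_n = μ K_n` for even `n`, `π_n = η K_n` for odd `n`. -/
def sinkhornPi (U V : Eucl d → ℝ) (W : Eucl d → Eucl d → ℝ) (n : ℕ) : Measure (Eucl d) :=
  if Even n then sinkhornKernel U V W n ∘ₘ gibbs U
  else sinkhornKernel U V W n ∘ₘ gibbs V

/-- The triple `(μ, η, K) = (λ_U, λ_V, K_W)` consists of two probability measures and a Markov
transition. -/
structure IsModel (U V : Eucl d → ℝ) (W : Eucl d → Eucl d → ℝ) : Prop where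
  prob_U : IsProbabilityMeasure (gibbs U)
  prob_V : IsProbabilityMeasure (gibbs V)
  markov_W : IsMarkovKernel (gibbsKernel W)

/-- The reference measure `P = μ × K = λ_U(dx) K_W(x,dy)`. -/
def refMeasure (U : Eucl d → ℝ) (W : Eucl d → Eucl d → ℝ) : Measure (Eucl d × Eucl d) :=
  gibbs U ⊗ₘ gibbsKernel W

/-- Some coupling of `μ = λ_U` and `η = λ_V` has finite entropy relative to the reference measure
(this is what makes the Schrödinger bridge exist). -/
def HasFiniteEntropyCoupling (U V : Eucl d → ℝ) (W : Eucl d → Eucl d → ℝ) : Prop :=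
  ∃ R : Measure (Eucl d × Eucl d),
    IsCoupling R (gibbs U) (gibbs V) ∧ klDiv R (refMeasure U W) ≠ ⊤

/-! ### Regularity conditions -/

/-- Condition `A_U(S)` with parameters `(κ_{2n}, ρ_{2n})_{n ≥ 1}` and `u₊`. -/
def CondAU (U V : Eucl d → ℝ) (W : Eucl d → Eucl d → ℝ) (κ ρ : ℕ → ℝ)
    (up : Matrix (Fin d) (Fin d) ℝ) : Prop :=
  (∀ n, 1 ≤ n → CondA0 (sinkhornKernel U V W (2 * n)) (κ (2 * n)) (ρ (2 * n))) ∧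
    up.PosDef ∧ TalagrandT2 (gibbs U) (specNorm up)

/-- Condition `A_V(S)` with parameters `(κ_{2n-1}, ρ_{2n-1})_{n ≥ 1}` and `v₊`. -/
def CondAV (U V : Eucl d → ℝ) (W : Eucl d → Eucl d → ℝ) (κ ρ : ℕ → ℝ)
    (vp : Matrix (Fin d) (Fin d) ℝ) : Prop :=
  (∀ n, 1 ≤ n → CondA0 (sinkhornKernel U V W (2 * n - 1)) (κ (2 * n - 1)) (ρ (2 * n - 1))) ∧
    vp.PosDef ∧ TalagrandT2 (gibbs V) (specNorm vp)

/-- `‖∇₂W(x₁,y) - ∇₂W(x₂,y)‖ ≤ κ ‖x₁ - x₂‖`. -/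
def GradLipschitz (W : Eucl d → Eucl d → ℝ) (κ : ℝ) : Prop :=
  ∀ x₁ x₂ y : Eucl d, ‖gradient (W x₁) y - gradient (W x₂) y‖ ≤ κ * ‖x₁ - x₂‖

/-- `∇₁²W(x,y₁) - ∇₁²W(x,y₂) ≤ A` in the Löwner order. -/
def HessOscBound (W : Eucl d → Eucl d → ℝ) (A : Matrix (Fin d) (Fin d) ℝ) : Prop :=
  ∀ x y₁ y₂ : Eucl d,
    (A - (hess (fun z => W z y₁) x - hess (fun z => W z y₂) x)).PosSemidef

/-- Condition `(𝒲)` on the reference potential, with parameters `κ`, `û`, `v̂`. -/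
def CondW (W : Eucl d → Eucl d → ℝ) (κ : ℝ) (uh vh : Matrix (Fin d) (Fin d) ℝ) : Prop :=
  GradLipschitz W κ ∧ GradLipschitz (flat W) κ ∧ uh.PosDef ∧ vh.PosDef ∧
    HessOscBound W uh⁻¹ ∧ HessOscBound (flat W) vh⁻¹

/-- Condition `C_V^-(U)` with parameters `(u₊, ū₊, δ)` and `v₊`: the Hessian bound
`∇²U(x) ≥ u₊⁻¹ 1_{‖x‖ ≥ δ} - ū₊ 1_{‖x‖ < δ}` holds and `λ_V` satisfies `T₂(‖v₊‖)`.
Condition `C_U^-(V)` is obtained by exchanging `U` and `V`. -/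
def CondCMinus (U V : Eucl d → ℝ) (up ubar : Matrix (Fin d) (Fin d) ℝ) (δ : ℝ)
    (vp : Matrix (Fin d) (Fin d) ℝ) : Prop :=
  up.PosDef ∧ ubar.PosSemidef ∧ 0 ≤ δ ∧ vp.PosDef ∧
    (∀ x, δ ≤ ‖x‖ → (hess U x - up⁻¹).PosSemidef) ∧
    (∀ x, ‖x‖ < δ → (hess U x + ubar).PosSemidef) ∧
    TalagrandT2 (gibbs V) (specNorm vp)

end SinkhornBridge

end

/-!
The rate comes from two facts about one full Sinkhorn step, both consequences of the form
`exp (-(u x + W x y + v y)) dx dy` of every bridge (`bridge W u v`), only one of the two potentials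
being updated at a time.

* *Pythagorean identity* (`klDiv_bridge_newPot_fst`): updating a potential to match a marginal
  decreases the entropy of any measure with that marginal by exactly the entropy of the marginals.
  This shows that the updates are entropic projections, that the Schrödinger bridge `Q` minimizes
  the entropy relative to *every* Sinkhorn bridge among the couplings, and that
  `H(Q | P_{2n}) + H(π_{2n-1} | μ) ≤ H(Q | P_{2n-2})`.
* *Gluing* (`klDiv_le_epsRate_mul`): `P_{2n-1}` and `P_{2n}` are disintegrated by the same
  transition `K`, started from `π_{2n-1}` and from `μ`. Mixing `K` over a coupling of `π_{2n-1}` and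
  `μ` gives a coupling of `μ` and `η` whose entropy relative to `P_{2n}` is at most the mean of
  `H(K x₁ | K x₂)`. The local log-Sobolev, Fisher-Lipschitz and quadratic transport inequalities
  bound its infimum, hence `H(Q | P_{2n})`, by `ε H(π_{2n-1} | μ)`.

For the explicit constants, the Sinkhorn potentials are logarithms of integrals of log-convex
functions, so by Hölder's inequality they lose no more convexity than the oscillation bound on the
Hessian of `W` allows (`convexOn_add_log_gibbsOp`). This also shows that their defining integrals,
finite almost everywhere, are finite everywhere, since a convex set of full measure is the whole
space. The potential of each transition is then strongly convex up to an explicit bounded function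
(`exists_bounded_convexifier`), and the transition satisfies a log-Sobolev inequality with a
constant depending only on the bounds (`exists_isLogSobolevBound`).

The log-Sobolev inequality itself (`logSobolev_gibbs`) is derived from the Prékopa–Leindler
inequality applied to infinitesimally perturbed exponents, followed by the bounded perturbation
argument of Holley and Stroock. It is first obtained for smooth densities that are constant outside
a compact set and then extended to all weakly differentiable ones by cutoff and mollification. The
extension may lose a universal factor. It rests on the vanishing of a weak gradient on the zero set
(`ae_gradient_eq_zero_of_eq_zero`) and on the joint convexity of `‖v‖² / t`
(`ofReal_norm_mollify_sq_le`).
-/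


noncomputable section

namespace SinkhornBridge

variable {d : ℕ}

/-! ### Relative entropy and disintegrations -/

section Entropy

variable {α β : Type*} [MeasurableSpace α] [MeasurableSpace β]

lemma klDiv_map_measurableEquiv (e : α ≃ᵐ β) (μ ν : Measure α) [IsFiniteMeasure μ]
    [IsFiniteMeasure ν] : klDiv (μ.map e) (ν.map e) = klDiv μ ν := by
  refine le_antisymm (klDiv_map_le μ ν e.measurable) ?_
  have h := klDiv_map_le (μ.map e) (ν.map e) e.symm.measurable
  rwa [Measure.map_map e.symm.measurable e.measurable,
    Measure.map_map e.symm.measurable e.measurable, e.symm_comp_self, Measure.map_id,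
    Measure.map_id] at h

lemma klDiv_fst_le (μ ν : Measure (α × β)) [IsFiniteMeasure μ] [IsFiniteMeasure ν] :
    klDiv μ.fst ν.fst ≤ klDiv μ ν := klDiv_map_le μ ν measurable_fst

lemma klDiv_snd_le (μ ν : Measure (α × β)) [IsFiniteMeasure μ] [IsFiniteMeasure ν] :
    klDiv μ.snd ν.snd ≤ klDiv μ ν := klDiv_map_le μ ν measurable_snd

lemma klDiv_swap (μ ν : Measure (α × β)) [IsFiniteMeasure μ] [IsFiniteMeasure ν] :
    klDiv (μ.map Prod.swap) (ν.map Prod.swap) = klDiv μ ν :=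
  klDiv_map_measurableEquiv MeasurableEquiv.prodComm μ ν

lemma klDiv_withDensity (ν : Measure α) [IsFiniteMeasure ν] {f : α → ℝ≥0∞} (hf : Measurable f)
    [IsFiniteMeasure (ν.withDensity f)] :
    klDiv (ν.withDensity f) ν = ∫⁻ x, ENNReal.ofReal (klFun (f x).toReal) ∂ν := by
  rw [klDiv_eq_lintegral_klFun_of_ac (withDensity_absolutelyContinuous ν f)]
  refine lintegral_congr_ae ?_
  filter_upwards [Measure.rnDeriv_withDensity ν hf] with x hx
  rw [hx]

lemma withDensity_compProd_left (μ : Measure α) [SFinite μ] (κ : Kernel α β) [IsSFiniteKernel κ]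
    {r : α → ℝ≥0∞} (hr : Measurable r) [SFinite (μ.withDensity r)] :
    (μ.withDensity r) ⊗ₘ κ = (μ ⊗ₘ κ).withDensity (fun p => r p.1) := by
  ext s hs
  rw [Measure.compProd_apply hs, withDensity_apply _ hs,
    ← lintegral_indicator hs, Measure.lintegral_compProd (by fun_prop (disch := exact hs)),
    lintegral_withDensity_eq_lintegral_mul _ hr (Kernel.measurable_kernel_prodMk_left hs)]
  refine lintegral_congr fun x => ?_
  have : ∀ y, s.indicator (fun p : α × β => r p.1) (x, y)
      = r x * (Prod.mk x ⁻¹' s).indicator 1 y := by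
    intro y; by_cases h : (x, y) ∈ s <;> simp [h, Set.indicator]
  simp_rw [this]
  rw [lintegral_const_mul _ (by
    exact measurable_one.indicator (measurable_prodMk_left hs)),
    lintegral_indicator_one (measurable_prodMk_left hs)]
  rfl

/-- Pythagorean identity: reweighting `P` by a function of the first coordinate does not change the
conditional laws, so the chain rule splits the entropy of every measure sharing the new first
marginal. -/
lemma klDiv_eq_add_of_withDensity_fst [StandardBorelSpace β] [Nonempty β]
    (P R : Measure (α × β)) [IsFiniteMeasure P] [IsFiniteMeasure R]
    {r : α → ℝ≥0∞} (hr : Measurable r) [IsFiniteMeasure (P.withDensity fun p => r p.1)]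
    (hR : R.fst = (P.withDensity fun p => r p.1).fst) :
    klDiv R P = klDiv R (P.withDensity fun p => r p.1) + klDiv R.fst P.fst := by
  set P' := P.withDensity fun p => r p.1 with hP'
  have h0 : P.fst ⊗ₘ P.condKernel = P := P.disintegrate P.condKernel
  have h1 : (P.fst.withDensity r) ⊗ₘ P.condKernel = P' := by
    rw [withDensity_compProd_left _ _ hr, h0]
  have h2 : P'.fst = P.fst.withDensity r := by
    have : SFinite (P.fst.withDensity r) := inferInstance
    rw [← h1, Measure.fst_compProd]
  have h3 : R.fst ⊗ₘ R.condKernel = R := R.disintegrate R.condKernel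
  have h4 : R.fst ⊗ₘ P.condKernel = P' := by rw [hR, h2, h1]
  conv_lhs => rw [← h3, ← h0]
  rw [klDiv_compProd_eq_add, h3, h4, add_comm]

lemma map_swap_withDensity (μ : Measure (α × β)) {f : β × α → ℝ≥0∞} (hf : Measurable f) :
    (μ.map Prod.swap).withDensity f = (μ.withDensity fun p => f p.swap).map Prod.swap := by
  ext s hs
  rw [withDensity_apply _ hs, Measure.map_apply measurable_swap hs,
    withDensity_apply _ (measurable_swap hs), setLIntegral_map hs hf measurable_swap]

/-- Conditional relative entropy as an integral, for kernels with a jointly measurable density. -/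
lemma klDiv_compProd_withDensity (T : Measure α) [IsFiniteMeasure T] (κ η : Kernel α β)
    [IsMarkovKernel κ] [IsMarkovKernel η] {F : α → β → ℝ≥0∞}
    (hF : Measurable (Function.uncurry F)) (h : ∀ a, κ a = (η a).withDensity (F a)) :
    klDiv (T ⊗ₘ κ) (T ⊗ₘ η) = ∫⁻ a, klDiv (κ a) (η a) ∂T := by
  have hκ : κ = η.withDensity F := by
    ext1 a; rw [h a, Kernel.withDensity_apply η hF]
  have : IsMarkovKernel (η.withDensity F) := hκ ▸ inferInstance
  have h1 : T ⊗ₘ κ = (T ⊗ₘ η).withDensity (fun p => F p.1 p.2) := by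
    conv_lhs => rw [hκ]
    exact Measure.compProd_withDensity hF
  have : IsFiniteMeasure ((T ⊗ₘ η).withDensity (fun p => F p.1 p.2)) := by
    rw [← h1]; infer_instance
  rw [h1, klDiv_withDensity (f := fun p : α × β => F p.1 p.2) _ hF, Measure.lintegral_compProd (by fun_prop)]
  refine lintegral_congr fun a => ?_
  have : IsFiniteMeasure ((η a).withDensity (F a)) := by rw [← h a]; infer_instance
  rw [h a, klDiv_withDensity (f := F a) _ (hF.comp measurable_prodMk_left)]

/-- Convexity of the entropy in integrated form: transporting the initial law of a Markov
transition along `T` costs at most the average entropy between the transition laws. -/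
lemma exists_coupling_klDiv_le (T : Measure (α × α)) [IsProbabilityMeasure T] (K : Kernel α β)
    [IsMarkovKernel K] {F : α × α → β → ℝ≥0∞} (hF : Measurable (Function.uncurry F))
    (h : ∀ a, K a.1 = (K a.2).withDensity (F a)) :
    ∃ R : Measure (α × β), R.fst = T.snd ∧ R.snd = K ∘ₘ T.fst ∧
      klDiv R (T.snd ⊗ₘ K) ≤ ∫⁻ a, klDiv (K a.1) (K a.2) ∂T := by
  set κ := K.comap Prod.fst (measurable_fst (α := α) (β := α))
  set η := K.comap Prod.snd (measurable_snd (α := α) (β := α))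
  set g : (α × α) × β → α × β := fun p => (p.1.2, p.2)
  have hg : Measurable g := by fun_prop
  have e1 : (T ⊗ₘ η).map g = T.snd ⊗ₘ K := by
    ext s hs
    rw [Measure.map_apply hg hs, Measure.compProd_apply (hg hs), Measure.compProd_apply hs,
      Measure.snd, lintegral_map (Kernel.measurable_kernel_prodMk_left hs) measurable_snd]
    rfl
  have e2 : ((T ⊗ₘ κ).map g).fst = T.snd := by
    have : Prod.fst ∘ g = Prod.snd ∘ (Prod.fst : (α × α) × β → α × α) := rfl
    rw [Measure.fst, Measure.map_map measurable_fst hg, this,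
      ← Measure.map_map measurable_snd measurable_fst, ← Measure.fst, Measure.fst_compProd,
      Measure.snd]
  have e3 : ((T ⊗ₘ κ).map g).snd = K ∘ₘ T.fst := by
    have : Prod.snd ∘ g = (Prod.snd : (α × α) × β → β) := rfl
    rw [Measure.snd, Measure.map_map measurable_snd hg, this, ← Measure.snd]
    ext s hs
    rw [Measure.snd_apply hs, Measure.compProd_apply (measurable_snd hs),
      Measure.bind_apply hs K.aemeasurable, Measure.fst,
      lintegral_map (K.measurable_coe hs) measurable_fst]
    rfl
  refine ⟨(T ⊗ₘ κ).map g, e2, e3, ?_⟩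
  rw [← e1]
  exact (klDiv_map_le _ _ hg).trans (klDiv_compProd_withDensity T κ η hF h).le

end Entropy

/-! ### Measures with separable potentials -/

/-- The measure with Lebesgue density `exp (-(u x + W x y + v y))`; every Sinkhorn bridge has this
form. -/
def bridge (W : Eucl d → Eucl d → ℝ) (u v : Eucl d → ℝ) : Measure (Eucl d × Eucl d) :=
  (volume.prod volume).withDensity fun p =>
    ENNReal.ofReal (Real.exp (-(u p.1 + W p.1 p.2 + v p.2)))

/-- One Sinkhorn update of the first potential: `U + log K_W (exp (-v))`.  With this potential the
first marginal of the bridge becomes `gibbs U`. -/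
def newPot (U : Eucl d → ℝ) (W : Eucl d → Eucl d → ℝ) (v : Eucl d → ℝ) (x : Eucl d) : ℝ :=
  U x + Real.log (gibbsOp W (fun y => Real.exp (-v y)) x)

/-- The potential of the transition from `x` to `y` in the disintegration of `bridge W u v` along
`gibbs U`. -/
def transPot (U : Eucl d → ℝ) (W : Eucl d → Eucl d → ℝ) (u v : Eucl d → ℝ) :
    Eucl d → Eucl d → ℝ := fun x y => u x + W x y + v y - U x

section

variable {U V : Eucl d → ℝ} {W : Eucl d → Eucl d → ℝ} {u v u' v' : Eucl d → ℝ}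

lemma measurable_flat (hW : Measurable (Function.uncurry W)) :
    Measurable (Function.uncurry (flat W)) := hW.comp measurable_swap

lemma measurable_uncurry_apply (hW : Measurable (Function.uncurry W)) :
    Measurable fun p : Eucl d × Eucl d => W p.1 p.2 := hW

lemma measurable_gibbsOp (hW : Measurable (Function.uncurry W)) (hv : Measurable v) :
    Measurable (gibbsOp W v) := by
  have h : StronglyMeasurable (Function.uncurry fun x y => Real.exp (-W x y) * v y) := by
    have := measurable_uncurry_apply hW
    exact Measurable.stronglyMeasurable (by unfold Function.uncurry; fun_prop)
  exact h.integral_prod_right.measurable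

lemma measurable_newPot (hU : Measurable U) (hW : Measurable (Function.uncurry W))
    (hv : Measurable v) : Measurable (newPot U W v) :=
  hU.add (Real.measurable_log.comp (measurable_gibbsOp hW (by fun_prop)))

lemma measurable_transPot (hU : Measurable U) (hW : Measurable (Function.uncurry W))
    (hu : Measurable u) (hv : Measurable v) :
    Measurable (Function.uncurry (transPot U W u v)) := by
  have := measurable_uncurry_apply hW
  unfold transPot Function.uncurry; fun_prop

lemma bridge_swap (hW : Measurable (Function.uncurry W)) (hu : Measurable u) (hv : Measurable v) :
    (bridge W u v).map Prod.swap = bridge (flat W) v u := by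
  have h2 := measurable_uncurry_apply (measurable_flat hW)
  rw [bridge, bridge]
  conv_rhs => rw [← Measure.prod_swap, map_swap_withDensity _ (by fun_prop)]
  congr 2; ext p; congr 2
  simp only [flat, Prod.fst_swap, Prod.snd_swap]
  ring

lemma bridge_fst_eq (hW : Measurable (Function.uncurry W)) (hu : Measurable u)
    (hv : Measurable v) : (bridge (flat W) v u).fst = (bridge W u v).snd := by
  rw [← bridge_swap hW hu hv, Measure.fst_map_swap]

lemma bridge_snd_eq (hW : Measurable (Function.uncurry W)) (hu : Measurable u)
    (hv : Measurable v) : (bridge (flat W) v u).snd = (bridge W u v).fst := by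
  rw [← bridge_swap hW hu hv, Measure.snd_map_swap]

lemma isProbabilityMeasure_bridge_flat (hW : Measurable (Function.uncurry W)) (hu : Measurable u)
    (hv : Measurable v) [IsProbabilityMeasure (bridge W u v)] :
    IsProbabilityMeasure (bridge (flat W) v u) := by
  rw [← bridge_swap hW hu hv]
  exact Measure.isProbabilityMeasure_map measurable_swap.aemeasurable

lemma bridge_fst (hW : Measurable (Function.uncurry W)) (hu : Measurable u) (hv : Measurable v) :
    (bridge W u v).fst = volume.withDensity
      fun x => ∫⁻ y, ENNReal.ofReal (Real.exp (-(u x + W x y + v y))) := by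
  have := measurable_uncurry_apply hW
  ext s hs
  rw [Measure.fst_apply hs, bridge, withDensity_apply _ (measurable_fst hs),
    withDensity_apply _ hs, ← Set.prod_univ, setLIntegral_prod _ (by fun_prop)]
  simp

instance isSFiniteKernel_gibbsKernel (Φ : Eucl d → Eucl d → ℝ) : IsSFiniteKernel (gibbsKernel Φ) :=
  Kernel.IsSFiniteKernel.withDensity _ fun _ _ => ENNReal.ofReal_ne_top

lemma gibbsKernel_apply {Φ : Eucl d → Eucl d → ℝ} (hΦ : Measurable (Function.uncurry Φ))
    (x : Eucl d) : gibbsKernel Φ x = gibbs (Φ x) := by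
  have := measurable_uncurry_apply hΦ
  rw [gibbsKernel, Kernel.withDensity_apply _ (by unfold Function.uncurry; fun_prop)]
  rfl

lemma gibbs_compProd {Φ : Eucl d → Eucl d → ℝ} (hU : Measurable U)
    (hΦ : Measurable (Function.uncurry Φ)) [SFinite (gibbs U)] :
    gibbs U ⊗ₘ gibbsKernel Φ = (volume.prod volume).withDensity fun p =>
      ENNReal.ofReal (Real.exp (-(U p.1 + Φ p.1 p.2))) := by
  have h' := measurable_uncurry_apply hΦ
  have : IsSFiniteKernel (Kernel.withDensity (Kernel.const (Eucl d) volume)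
    fun x y => ENNReal.ofReal (Real.exp (-Φ x y))) := isSFiniteKernel_gibbsKernel Φ
  rw [gibbsKernel, Measure.compProd_withDensity (by unfold Function.uncurry; fun_prop),
    Measure.compProd_const, gibbs, prod_withDensity_left (by fun_prop),
    ← withDensity_mul _ (by fun_prop) (by fun_prop)]
  congr 1; ext p
  rw [Pi.mul_apply, ← ENNReal.ofReal_mul (Real.exp_pos _).le, ← Real.exp_add]
  congr 2; ring

lemma gibbs_compProd_transPot (hU : Measurable U) (hW : Measurable (Function.uncurry W))
    (hu : Measurable u) (hv : Measurable v) [SFinite (gibbs U)] :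
    gibbs U ⊗ₘ gibbsKernel (transPot U W u v) = bridge W u v := by
  rw [gibbs_compProd hU (measurable_transPot hU hW hu hv), bridge]
  congr 1; ext p; congr 2; simp only [transPot]; ring

lemma bridge_withDensity_fst (hW : Measurable (Function.uncurry W)) (hu : Measurable u)
    (hv : Measurable v) (hu' : Measurable u') :
    (bridge W u v).withDensity (fun p => ENNReal.ofReal (Real.exp (u p.1 - u' p.1)))
      = bridge W u' v := by
  have := measurable_uncurry_apply hW
  rw [bridge, bridge, ← withDensity_mul _ (by fun_prop) (by fun_prop)]
  congr 1; ext p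
  rw [Pi.mul_apply, ← ENNReal.ofReal_mul (Real.exp_pos _).le, ← Real.exp_add]
  congr 2; ring

/-- If the integral defining `gibbsOp` is finite at `x`, then normalising there with `newPot`
produces exactly the mass `exp (-U x)`. -/
lemma lintegral_exp_newPot {x : Eucl d} (hW : Measurable (Function.uncurry W)) (hv : Measurable v)
    (hx : ∫⁻ y, ENNReal.ofReal (Real.exp (-(W x y + v y))) ≠ ⊤) :
    ∫⁻ y, ENNReal.ofReal (Real.exp (-(newPot U W v x + W x y + v y)))
      = ENNReal.ofReal (Real.exp (-U x)) := by
  have hWx : Measurable (W x) := hW.comp measurable_prodMk_left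
  have hint : Integrable fun y => Real.exp (-(W x y + v y)) :=
    (lintegral_ofReal_ne_top_iff_integrable (by fun_prop)
      (.of_forall fun y => (Real.exp_pos _).le)).1 hx
  have hg : gibbsOp W (fun y => Real.exp (-v y)) x = ∫ y, Real.exp (-(W x y + v y)) := by
    simp only [gibbsOp, ← Real.exp_add]; congr 1; ext y; congr 1; ring
  have hpos : 0 < ∫ y, Real.exp (-(W x y + v y)) := integral_exp_pos hint
  have e : ∀ y, ENNReal.ofReal (Real.exp (-(newPot U W v x + W x y + v y)))
      = ENNReal.ofReal (Real.exp (-newPot U W v x)) *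
        ENNReal.ofReal (Real.exp (-(W x y + v y))) := by
    intro y
    rw [← ENNReal.ofReal_mul (Real.exp_pos _).le, ← Real.exp_add]; congr 2; ring
  simp_rw [e]
  rw [lintegral_const_mul _ (by fun_prop), ← ofReal_integral_eq_lintegral_ofReal hint
    (.of_forall fun y => (Real.exp_pos _).le), ← ENNReal.ofReal_mul (Real.exp_pos _).le, newPot, hg,
    neg_add, Real.exp_add, Real.exp_neg (Real.log _), Real.exp_log hpos]
  congr 1; field_simp

lemma ae_lintegral_exp_ne_top (hW : Measurable (Function.uncurry W)) (hu : Measurable u)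
    (hv : Measurable v) [IsFiniteMeasure (bridge W u v)] :
    ∀ᵐ x, ∫⁻ y, ENNReal.ofReal (Real.exp (-(W x y + v y))) ≠ ⊤ := by
  have hm := measurable_uncurry_apply hW
  have h1 : ∫⁻ x, ∫⁻ y, ENNReal.ofReal (Real.exp (-(u x + W x y + v y))) ≠ ⊤ := by
    have h := measure_ne_top (bridge W u v).fst Set.univ
    rwa [bridge_fst hW hu hv, withDensity_apply _ MeasurableSet.univ, setLIntegral_univ] at h
  have h2 : Measurable fun x => ∫⁻ y, ENNReal.ofReal (Real.exp (-(u x + W x y + v y))) :=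
    Measurable.lintegral_prod_right' (f := fun p : Eucl d × Eucl d =>
      ENNReal.ofReal (Real.exp (-(u p.1 + W p.1 p.2 + v p.2)))) (by fun_prop)
  filter_upwards [ae_lt_top h2 h1] with x hx
  have hWx : Measurable (W x) := hW.comp measurable_prodMk_left
  have e : ∀ y, ENNReal.ofReal (Real.exp (-(u x + W x y + v y)))
      = ENNReal.ofReal (Real.exp (-u x)) * ENNReal.ofReal (Real.exp (-(W x y + v y))) := by
    intro y
    rw [← ENNReal.ofReal_mul (Real.exp_pos _).le, ← Real.exp_add]; congr 2; ring
  simp_rw [e] at hx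
  rw [lintegral_const_mul _ (by fun_prop)] at hx
  intro htop
  rw [htop, ENNReal.mul_top (by simp [Real.exp_pos])] at hx
  exact lt_irrefl _ hx

/-- A Sinkhorn update restores the first marginal.  The integral in `newPot` may diverge, but only
on a null set, because the mass of the previous bridge is finite. -/
lemma bridge_newPot_fst (hU : Measurable U) (hW : Measurable (Function.uncurry W))
    (hu : Measurable u) (hv : Measurable v) [IsFiniteMeasure (bridge W u v)] :
    (bridge W (newPot U W v) v).fst = gibbs U := by
  rw [bridge_fst hW (measurable_newPot hU hW hv) hv, gibbs]
  refine withDensity_congr_ae ?_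
  filter_upwards [ae_lintegral_exp_ne_top hW hu hv] with x hx
  exact lintegral_exp_newPot hW hv hx

lemma isProbabilityMeasure_of_fst {α β : Type*} [MeasurableSpace α] [MeasurableSpace β]
    {P : Measure (α × β)} {μ : Measure α} [IsProbabilityMeasure μ] (h : P.fst = μ) :
    IsProbabilityMeasure P := ⟨by rw [← Measure.fst_univ, h, measure_univ]⟩

lemma isProbabilityMeasure_of_snd {α β : Type*} [MeasurableSpace α] [MeasurableSpace β]
    {P : Measure (α × β)} {μ : Measure β} [IsProbabilityMeasure μ] (h : P.snd = μ) :
    IsProbabilityMeasure P := ⟨by rw [← Measure.snd_univ, h, measure_univ]⟩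

lemma bridge_newPot_snd (hV : Measurable V) (hW : Measurable (Function.uncurry W))
    (hu : Measurable u) (hv : Measurable v) [IsProbabilityMeasure (bridge W u v)] :
    (bridge W u (newPot V (flat W) u)).snd = gibbs V := by
  have := isProbabilityMeasure_bridge_flat hW hu hv
  rw [← bridge_newPot_fst hV (measurable_flat hW) hv hu,
    bridge_fst_eq hW hu (measurable_newPot hV (measurable_flat hW) hu)]

/-- Pythagorean identity for a Sinkhorn update. -/
lemma klDiv_bridge_newPot_fst (hU : Measurable U) (hW : Measurable (Function.uncurry W))
    (hu : Measurable u) (hv : Measurable v) [IsProbabilityMeasure (gibbs U)]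
    [IsProbabilityMeasure (bridge W u v)] {R : Measure (Eucl d × Eucl d)} (hR : R.fst = gibbs U) :
    klDiv R (bridge W u v)
      = klDiv R (bridge W (newPot U W v) v) + klDiv (gibbs U) (bridge W u v).fst := by
  have h1 := bridge_newPot_fst hU hW hu hv
  have hm := measurable_newPot hU hW hv
  have := isProbabilityMeasure_of_fst h1
  have := isProbabilityMeasure_of_fst hR
  have e := bridge_withDensity_fst hW hu hv hm
  have hf : IsFiniteMeasure ((bridge W u v).withDensity
    fun p => ENNReal.ofReal (Real.exp (u p.1 - newPot U W v p.1))) := by rw [e]; infer_instance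
  have h := klDiv_eq_add_of_withDensity_fst (bridge W u v) R
    (r := fun x => ENNReal.ofReal (Real.exp (u x - newPot U W v x))) (by fun_prop)
    (by rw [e, h1, hR])
  rwa [e, hR] at h

lemma klDiv_bridge_newPot_snd (hV : Measurable V) (hW : Measurable (Function.uncurry W))
    (hu : Measurable u) (hv : Measurable v) [IsProbabilityMeasure (gibbs V)]
    [IsProbabilityMeasure (bridge W u v)] {R : Measure (Eucl d × Eucl d)} (hR : R.snd = gibbs V) :
    klDiv R (bridge W u v)
      = klDiv R (bridge W u (newPot V (flat W) u)) + klDiv (gibbs V) (bridge W u v).snd := by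
  have hm := measurable_newPot hV (measurable_flat hW) hu
  have := isProbabilityMeasure_bridge_flat hW hu hv
  have := isProbabilityMeasure_of_snd (bridge_newPot_snd hV hW hu hv)
  have := isProbabilityMeasure_of_snd hR
  have h := klDiv_bridge_newPot_fst hV (measurable_flat hW) hv hu (R := R.map Prod.swap)
    (by rw [Measure.fst_map_swap, hR])
  rwa [← bridge_swap hW hu hv, ← bridge_swap hW hu hm, klDiv_swap, klDiv_swap,
    Measure.fst_map_swap] at h

/-- The updated bridge is the entropic projection of the previous one onto the measures with the
prescribed marginal: by data processing no such measure beats the entropy of the marginals, and the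
update attains it. -/
lemma isEntropicProjection_newPot_fst (hU : Measurable U) (hW : Measurable (Function.uncurry W))
    (hu : Measurable u) (hv : Measurable v) [IsProbabilityMeasure (gibbs U)]
    [IsProbabilityMeasure (bridge W u v)] :
    IsEntropicProjection (bridge W u v) {R | R.fst = gibbs U} (bridge W (newPot U W v) v) := by
  have h1 := bridge_newPot_fst hU hW hu hv
  have := isProbabilityMeasure_of_fst h1
  refine ⟨h1, fun R hR => ?_⟩
  have := isProbabilityMeasure_of_fst hR
  rw [klDiv_bridge_newPot_fst hU hW hu hv h1, klDiv_self, zero_add, ← hR]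
  exact klDiv_fst_le _ _

lemma isEntropicProjection_newPot_snd (hV : Measurable V) (hW : Measurable (Function.uncurry W))
    (hu : Measurable u) (hv : Measurable v) [IsProbabilityMeasure (gibbs V)]
    [IsProbabilityMeasure (bridge W u v)] :
    IsEntropicProjection (bridge W u v) {R | R.snd = gibbs V}
      (bridge W u (newPot V (flat W) u)) := by
  have h1 := bridge_newPot_snd hV hW hu hv
  have := isProbabilityMeasure_of_snd h1
  refine ⟨h1, fun R hR => ?_⟩
  have := isProbabilityMeasure_of_snd hR
  rw [klDiv_bridge_newPot_snd hV hW hu hv h1, klDiv_self, zero_add, ← hR]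
  exact klDiv_snd_le _ _

/-- Two consecutive Sinkhorn updates decrease the entropy of a coupling by at least the entropy of
the intermediate marginal. -/
lemma klDiv_add_klDiv_fst_le (hU : Measurable U) (hV : Measurable V)
    (hW : Measurable (Function.uncurry W))
    (hu : Measurable u) (hv : Measurable v) [IsProbabilityMeasure (gibbs U)]
    [IsProbabilityMeasure (gibbs V)] [IsProbabilityMeasure (bridge W u v)]
    (h0 : (bridge W u v).fst = gibbs U) {Q : Measure (Eucl d × Eucl d)}
    (hQ : IsCoupling Q (gibbs U) (gibbs V)) (hv' : v' = newPot V (flat W) u) :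
    klDiv Q (bridge W (newPot U W v') v') + klDiv (bridge W u v').fst (gibbs U)
      ≤ klDiv Q (bridge W u v) := by
  have hm := measurable_newPot hV (measurable_flat hW) hu
  have h1 := bridge_newPot_snd hV hW hu hv
  rw [← hv'] at hm h1
  have := isProbabilityMeasure_of_snd h1
  rw [klDiv_bridge_newPot_snd hV hW hu hv hQ.2, ← hv', klDiv_bridge_newPot_fst hU hW hu hm hQ.1]
  refine add_le_add le_self_add ?_
  calc klDiv (bridge W u v').fst (gibbs U) ≤ klDiv (bridge W u v') (bridge W u v) := by
        rw [← h0]; exact klDiv_fst_le _ _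
    _ = klDiv (gibbs V) (bridge W u v).snd := by
        rw [klDiv_bridge_newPot_snd hV hW hu hv h1, ← hv', klDiv_self, zero_add]

/-- `bridge W u v` and its update share the transition from `x` to `y`. -/
lemma bridge_fst_compProd (hU : Measurable U) (hW : Measurable (Function.uncurry W))
    (hu : Measurable u) (hv : Measurable v) (hu' : Measurable u') [IsProbabilityMeasure (gibbs U)]
    [IsProbabilityMeasure (bridge W u v)] [IsMarkovKernel (gibbsKernel (transPot U W u' v))] :
    (bridge W u v).fst ⊗ₘ gibbsKernel (transPot U W u' v) = bridge W u v := by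
  set K := gibbsKernel (transPot U W u' v)
  have h : (gibbs U).withDensity (fun x => ENNReal.ofReal (Real.exp (u' x - u x))) ⊗ₘ K
      = bridge W u v := by
    rw [withDensity_compProd_left _ _ (by fun_prop), gibbs_compProd_transPot hU hW hu' hv,
      bridge_withDensity_fst hW hu' hv hu]
  have h2 : (bridge W u v).fst
      = (gibbs U).withDensity (fun x => ENNReal.ofReal (Real.exp (u' x - u x))) := by
    rw [← h, Measure.fst_compProd]
  rw [h2, h]

/-- Moving the initial law of the transition of the updated bridge
along a coupling of the two first marginals produces a competitor for `Q`, whose entropy is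
controlled through `A₀` and the transport inequality. -/
lemma klDiv_le_epsRate_mul (hU : Measurable U) (hW : Measurable (Function.uncurry W))
    (hu : Measurable u) (hv : Measurable v) (hu' : Measurable u')
    [IsProbabilityMeasure (gibbs U)] [IsProbabilityMeasure (bridge W u v)]
    (h1 : (bridge W u v).snd = gibbs V)
    {κ ρ c : ℝ} (hA : CondA0 (gibbsKernel (transPot U W u' v)) κ ρ) (hT : TalagrandT2 (gibbs U) c)
    {Q : Measure (Eucl d × Eucl d)}
    (hmin : ∀ R, IsCoupling R (gibbs U) (gibbs V) →
      klDiv Q (bridge W u' v) ≤ klDiv R (bridge W u' v)) :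
    klDiv Q (bridge W u' v) ≤
      ENNReal.ofReal (epsRate κ ρ c) * klDiv (bridge W u v).fst (gibbs U) := by
  set K := gibbsKernel (transPot U W u' v) with hK
  obtain ⟨hMarkov, ⟨hρ, hLS⟩, hκ, hJ⟩ := hA
  obtain ⟨hc, hT⟩ := hT
  set ν := (bridge W u v).fst with hν
  have hνK : K ∘ₘ ν = gibbs V := by
    rw [← h1, ← Measure.snd_compProd, hν, bridge_fst_compProd hU hW hu hv hu']
  have hΦ := measurable_transPot hU hW hu' hv
  have hΦ' := measurable_uncurry_apply hΦ
  have s1 : klDiv Q (bridge W u' v)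
      ≤ transportCost (fun x₁ x₂ => klDiv (K x₁) (K x₂)) ν (gibbs U) := by
    refine le_iInf₂ fun T hTc => ?_
    have : IsProbabilityMeasure T := isProbabilityMeasure_of_fst hTc.1
    have hdens : ∀ a : Eucl d × Eucl d, K a.1 = (K a.2).withDensity fun y =>
        ENNReal.ofReal (Real.exp (transPot U W u' v a.2 y - transPot U W u' v a.1 y)) := by
      intro a
      have m1 : ∀ x, Measurable (transPot U W u' v x) := fun x => hΦ.comp measurable_prodMk_left
      have m2 := m1 a.1
      have m3 := m1 a.2
      rw [hK, gibbsKernel_apply hΦ, gibbsKernel_apply hΦ, gibbs, gibbs,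
        ← withDensity_mul _ (by fun_prop) (by fun_prop)]
      congr 1; ext y
      rw [Pi.mul_apply, ← ENNReal.ofReal_mul (Real.exp_pos _).le, ← Real.exp_add]
      congr 2; ring
    have hmeas : Measurable (Function.uncurry fun (a : Eucl d × Eucl d) (y : Eucl d) =>
        ENNReal.ofReal (Real.exp (transPot U W u' v a.2 y - transPot U W u' v a.1 y))) := by
      have a1 : Measurable fun q : (Eucl d × Eucl d) × Eucl d => transPot U W u' v q.1.2 q.2 :=
        hΦ'.comp (f := fun q : (Eucl d × Eucl d) × Eucl d => (q.1.2, q.2)) (by fun_prop)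
      have a2 : Measurable fun q : (Eucl d × Eucl d) × Eucl d => transPot U W u' v q.1.1 q.2 :=
        hΦ'.comp (f := fun q : (Eucl d × Eucl d) × Eucl d => (q.1.1, q.2)) (by fun_prop)
      unfold Function.uncurry; fun_prop
    obtain ⟨R, hR1, hR2, hR3⟩ := exists_coupling_klDiv_le T K hmeas hdens
    rw [hTc.1, hνK] at hR2
    rw [hTc.2] at hR1 hR3
    rw [hK, gibbs_compProd_transPot hU hW hu' hv] at hR3
    exact (hmin R ⟨hR1, hR2⟩).trans hR3
  have s3 : transportCost (fun x₁ x₂ => fisherInfo (K x₁) (K x₂)) ν (gibbs U)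
      ≤ ENNReal.ofReal (κ ^ 2) * wasserstein2Sq ν (gibbs U) := by
    unfold wasserstein2Sq transportCost
    rw [ENNReal.mul_iInf_of_ne (by positivity) ENNReal.ofReal_ne_top]
    refine iInf_mono fun T => ?_
    rw [ENNReal.mul_iInf_of_ne (by positivity) ENNReal.ofReal_ne_top]
    refine iInf_mono fun hTc => ?_
    rw [← lintegral_const_mul _ (by fun_prop)]
    refine lintegral_mono fun p => (hJ p.1 p.2).trans_eq ?_
    rw [ENNReal.ofReal_mul (sq_nonneg κ)]
  have s4 : wasserstein2Sq ν (gibbs U) ≤ ENNReal.ofReal (2 * c) * klDiv ν (gibbs U) := by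
    have h := mul_le_mul_right (hT ν inferInstance) 2
    rw [← mul_assoc, ← mul_assoc] at h
    have e : (2 : ℝ≥0∞) * (1 / 2) = 1 := ENNReal.mul_div_cancel (by simp) (by simp)
    rw [e, one_mul] at h
    rwa [ENNReal.ofReal_mul (by norm_num), ENNReal.ofReal_ofNat]
  calc klDiv Q (bridge W u' v)
      ≤ ENNReal.ofReal (ρ / 2) * (ENNReal.ofReal (κ ^ 2) *
          (ENNReal.ofReal (2 * c) * klDiv ν (gibbs U))) :=
        s1.trans <| (hLS ν (gibbs U) inferInstance inferInstance).trans <| by gcongr; exact s3.trans (by gcongr)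
    _ = ENNReal.ofReal (epsRate κ ρ c) * klDiv ν (gibbs U) := by
        rw [← mul_assoc, ← mul_assoc, ← ENNReal.ofReal_mul (by positivity),
          ← ENNReal.ofReal_mul (by positivity)]
        congr 2; unfold epsRate; ring

end

/-- The elementary step from an additive decrease to a contraction rate. -/
lemma le_rate_mul_of_add_le {a b c : ℝ≥0∞} {ε : ℝ} (hε : 0 < ε) (h1 : a ≤ ENNReal.ofReal ε * b)
    (h2 : a + b ≤ c) : a ≤ ENNReal.ofReal ((1 + ε⁻¹)⁻¹) * c := by
  have e : (1 + ε⁻¹)⁻¹ = ε / (1 + ε) := by field_simp; ring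
  have hpos : 0 < 1 + ε := by linarith
  refine le_trans ?_ (mul_le_mul_right h2 _)
  rw [e, mul_add, div_eq_mul_inv, mul_comm ε, ENNReal.ofReal_mul (by positivity), mul_assoc,
    mul_assoc, ← mul_add, ENNReal.ofReal_inv_of_pos hpos, mul_comm, ← div_eq_mul_inv,
    ENNReal.le_div_iff_mul_le (by simp [hpos]) (by simp), ENNReal.ofReal_add one_pos.le hε.le,
    mul_add, ENNReal.ofReal_one, mul_one, add_comm, mul_comm a]
  gcongr

/-! ### The Sinkhorn sequence -/

section

variable {U V : Eucl d → ℝ} {W : Eucl d → Eucl d → ℝ}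

lemma sinkhornPot_odd (U V : Eucl d → ℝ) (W : Eucl d → Eucl d → ℝ) (n : ℕ) :
    sinkhornPot U V W (2 * n + 1) = ((sinkhornPot U V W (2 * n)).1,
      newPot V (flat W) (sinkhornPot U V W (2 * n)).1) := by
  rw [sinkhornPot]; simp only [even_two_mul, if_true]; rfl

lemma sinkhornPot_even (U V : Eucl d → ℝ) (W : Eucl d → Eucl d → ℝ) (n : ℕ) :
    sinkhornPot U V W (2 * n + 2) = (newPot U W (sinkhornPot U V W (2 * n + 1)).2,
      (sinkhornPot U V W (2 * n + 1)).2) := by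
  rw [sinkhornPot, if_neg (by simp)]; rfl

lemma measurable_sinkhornPot (hU : Measurable U) (hV : Measurable V)
    (hW : Measurable (Function.uncurry W)) (n : ℕ) :
    Measurable (sinkhornPot U V W n).1 ∧ Measurable (sinkhornPot U V W n).2 := by
  induction n with
  | zero => exact ⟨measurable_newPot hU hW measurable_const, measurable_const⟩
  | succ n ih =>
    rcases Nat.even_or_odd' n with ⟨k, rfl | rfl⟩
    · rw [sinkhornPot_odd]
      exact ⟨ih.1, measurable_newPot hV (measurable_flat hW) ih.1⟩
    · rw [sinkhornPot_even]
      exact ⟨measurable_newPot hU hW ih.2, ih.2⟩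

lemma sinkhornKernel_even (U V : Eucl d → ℝ) (W : Eucl d → Eucl d → ℝ) (n : ℕ) :
    sinkhornKernel U V W (2 * n) = gibbsKernel
      (transPot U W (sinkhornPot U V W (2 * n)).1 (sinkhornPot U V W (2 * n)).2) := by
  simp only [sinkhornKernel, sinkhornW, even_two_mul, if_true]; rfl

lemma sinkhornKernel_odd (U V : Eucl d → ℝ) (W : Eucl d → Eucl d → ℝ) (n : ℕ) :
    sinkhornKernel U V W (2 * n + 1) = gibbsKernel
      (transPot V (flat W) (sinkhornPot U V W (2 * n + 1)).2 (sinkhornPot U V W (2 * n + 1)).1) := by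
  have h : ¬ Even (2 * n + 1) := by simp
  simp only [sinkhornKernel, sinkhornW, if_neg h]
  congr 1; ext y x; simp only [transPot, flat]; ring

lemma sinkhornBridge_eq (hU : Measurable U) (hV : Measurable V)
    (hW : Measurable (Function.uncurry W)) (hM : IsModel U V W) (n : ℕ) :
    sinkhornBridge U V W n = bridge W (sinkhornPot U V W n).1 (sinkhornPot U V W n).2 := by
  have := hM.prob_U
  have := hM.prob_V
  obtain ⟨h1, h2⟩ := measurable_sinkhornPot hU hV hW n
  rcases Nat.even_or_odd' n with ⟨k, rfl | rfl⟩
  · rw [sinkhornBridge, if_pos (even_two_mul k), sinkhornKernel_even,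
      gibbs_compProd_transPot hU hW h1 h2]
  · rw [sinkhornBridge, if_neg (by simp), sinkhornKernel_odd,
      gibbs_compProd_transPot hV (measurable_flat hW) h2 h1, ← bridge_swap hW h1 h2,
      Measure.map_map measurable_swap measurable_swap]
    simp

lemma sinkhornKernel_zero (hW : Measurable (Function.uncurry W)) (hM : IsModel U V W) :
    sinkhornKernel U V W 0 = gibbsKernel W := by
  have h1 : ∀ x, gibbsOp W (fun _ => Real.exp (-0)) x = 1 := by
    intro x
    have := hM.markov_W.isProbabilityMeasure x
    have hWx : Measurable (W x) := hW.comp measurable_prodMk_left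
    have h : ∫⁻ y, ENNReal.ofReal (Real.exp (-W x y)) = 1 := by
      have h := measure_univ (μ := gibbsKernel W x)
      rwa [gibbsKernel_apply hW, gibbs, withDensity_apply _ .univ, setLIntegral_univ] at h
    simp only [gibbsOp, neg_zero, Real.exp_zero, mul_one]
    rw [integral_eq_lintegral_of_nonneg_ae (.of_forall fun y => (Real.exp_pos _).le)
      (by fun_prop), h, ENNReal.toReal_one]
  simp only [sinkhornKernel, sinkhornW, Even.zero, if_true, sinkhornPot]
  congr 1; ext x y; rw [h1]; simp

lemma sinkhornBridge_zero (hW : Measurable (Function.uncurry W)) (hM : IsModel U V W) :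
    sinkhornBridge U V W 0 = refMeasure U W := by
  rw [sinkhornBridge, if_pos Even.zero, sinkhornKernel_zero hW hM, refMeasure]

/-- Every bridge is a probability measure; the even ones have first marginal `gibbs U`, the odd ones
second marginal `gibbs V`. -/
lemma sinkhornBridge_marginals (hU : Measurable U) (hV : Measurable V)
    (hW : Measurable (Function.uncurry W)) (hM : IsModel U V W) (n : ℕ) :
    (sinkhornBridge U V W (2 * n)).fst = gibbs U ∧
      (sinkhornBridge U V W (2 * n + 1)).snd = gibbs V := by
  have := hM.prob_U
  have := hM.prob_V
  have := hM.markov_W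
  have step : ∀ n, (sinkhornBridge U V W (2 * n)).fst = gibbs U →
      (sinkhornBridge U V W (2 * n + 1)).snd = gibbs V := by
    intro n h
    obtain ⟨h1, h2⟩ := measurable_sinkhornPot hU hV hW (2 * n)
    have := isProbabilityMeasure_of_fst h
    rw [sinkhornBridge_eq hU hV hW hM] at this
    rw [sinkhornBridge_eq hU hV hW hM, sinkhornPot_odd, bridge_newPot_snd hV hW h1 h2]
  induction n with
  | zero =>
    have h0 : (sinkhornBridge U V W (2 * 0)).fst = gibbs U := by
      rw [mul_zero, sinkhornBridge_zero hW hM, refMeasure, Measure.fst_compProd]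
    exact ⟨h0, step 0 h0⟩
  | succ n ih =>
    have h : (sinkhornBridge U V W (2 * (n + 1))).fst = gibbs U := by
      obtain ⟨h1, h2⟩ := measurable_sinkhornPot hU hV hW (2 * n + 1)
      have := isProbabilityMeasure_of_snd ih.2
      rw [sinkhornBridge_eq hU hV hW hM] at this
      rw [sinkhornBridge_eq hU hV hW hM, mul_add, sinkhornPot_even, bridge_newPot_fst hU hW h1 h2]
    exact ⟨h, step _ h⟩

lemma isProbabilityMeasure_sinkhornBridge (hU : Measurable U) (hV : Measurable V)
    (hW : Measurable (Function.uncurry W)) (hM : IsModel U V W) (n : ℕ) :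
    IsProbabilityMeasure (sinkhornBridge U V W n) := by
  have := hM.prob_U
  have := hM.prob_V
  rcases Nat.even_or_odd' n with ⟨k, rfl | rfl⟩
  · exact isProbabilityMeasure_of_fst (sinkhornBridge_marginals hU hV hW hM k).1
  · exact isProbabilityMeasure_of_snd (sinkhornBridge_marginals hU hV hW hM k).2

lemma isProbabilityMeasure_bridge_sinkhornPot (hU : Measurable U) (hV : Measurable V)
    (hW : Measurable (Function.uncurry W)) (hM : IsModel U V W) (n : ℕ) :
    IsProbabilityMeasure (bridge W (sinkhornPot U V W n).1 (sinkhornPot U V W n).2) := by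
  rw [← sinkhornBridge_eq hU hV hW hM]
  exact isProbabilityMeasure_sinkhornBridge hU hV hW hM n

theorem isSinkhornSequence_sinkhornBridge (hU : Measurable U) (hV : Measurable V)
    (hW : Measurable (Function.uncurry W)) (hM : IsModel U V W) :
    IsSinkhornSequence (refMeasure U W) (gibbs U) (gibbs V) (sinkhornBridge U V W) := by
  have := hM.prob_U
  have := hM.prob_V
  refine ⟨sinkhornBridge_zero hW hM, fun n => ?_, fun n => ?_⟩
  · obtain ⟨h1, h2⟩ := measurable_sinkhornPot hU hV hW (2 * n)
    have := isProbabilityMeasure_bridge_sinkhornPot hU hV hW hM (2 * n)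
    rw [sinkhornBridge_eq hU hV hW hM, sinkhornBridge_eq hU hV hW hM, sinkhornPot_odd]
    exact isEntropicProjection_newPot_snd hV hW h1 h2
  · obtain ⟨h1, h2⟩ := measurable_sinkhornPot hU hV hW (2 * n + 1)
    have := isProbabilityMeasure_bridge_sinkhornPot hU hV hW hM (2 * n + 1)
    rw [sinkhornBridge_eq hU hV hW hM, sinkhornBridge_eq hU hV hW hM, sinkhornPot_even]
    exact isEntropicProjection_newPot_fst hU hW h1 h2

/-- Along the Sinkhorn sequence the entropy of a coupling changes by an amount that does not depend
on the coupling. -/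
lemma exists_klDiv_eq_add (hU : Measurable U) (hV : Measurable V)
    (hW : Measurable (Function.uncurry W)) (hM : IsModel U V W) (n : ℕ) :
    ∃ c : ℝ≥0∞, ∀ R, IsCoupling R (gibbs U) (gibbs V) →
      klDiv R (refMeasure U W) = klDiv R (sinkhornBridge U V W n) + c := by
  have := hM.prob_U
  have := hM.prob_V
  induction n with
  | zero => exact ⟨0, fun R _ => by rw [sinkhornBridge_zero hW hM, add_zero]⟩
  | succ n ih =>
    obtain ⟨c, hc⟩ := ih
    obtain ⟨h1, h2⟩ := measurable_sinkhornPot hU hV hW n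
    have := isProbabilityMeasure_bridge_sinkhornPot hU hV hW hM n
    simp only [sinkhornBridge_eq hU hV hW hM] at hc ⊢
    rcases Nat.even_or_odd' n with ⟨k, rfl | rfl⟩
    · refine ⟨klDiv (gibbs V) (bridge W (sinkhornPot U V W (2 * k)).1
        (sinkhornPot U V W (2 * k)).2).snd + c, fun R hR => ?_⟩
      rw [hc R hR, klDiv_bridge_newPot_snd hV hW h1 h2 hR.2, sinkhornPot_odd, add_assoc]
    · refine ⟨klDiv (gibbs U) (bridge W (sinkhornPot U V W (2 * k + 1)).1
        (sinkhornPot U V W (2 * k + 1)).2).fst + c, fun R hR => ?_⟩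
      rw [hc R hR, klDiv_bridge_newPot_fst hU hW h1 h2 hR.1, sinkhornPot_even, add_assoc]

lemma schrodingerBridge_klDiv_le (hU : Measurable U) (hV : Measurable V)
    (hW : Measurable (Function.uncurry W)) (hM : IsModel U V W)
    (hfin : HasFiniteEntropyCoupling U V W) {Q : Measure (Eucl d × Eucl d)}
    (hQ : IsSchrodingerBridge (refMeasure U W) (gibbs U) (gibbs V) Q) (n : ℕ)
    {R : Measure (Eucl d × Eucl d)} (hR : IsCoupling R (gibbs U) (gibbs V)) :
    klDiv Q (sinkhornBridge U V W n) ≤ klDiv R (sinkhornBridge U V W n) := by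
  obtain ⟨c, hc⟩ := exists_klDiv_eq_add hU hV hW hM n
  obtain ⟨R₀, hR₀, hfin⟩ := hfin
  have hc' : c ≠ ⊤ := by
    rintro rfl
    rw [hc R₀ hR₀, add_top] at hfin
    exact hfin rfl
  have h := hQ.2 R hR
  rw [hc Q hQ.1, hc R hR] at h
  exact (ENNReal.add_le_add_iff_right hc').1 h

lemma sinkhornPi_even (hM : IsModel U V W) (n : ℕ) :
    sinkhornPi U V W (2 * n) = (sinkhornBridge U V W (2 * n)).snd := by
  have := hM.prob_U
  have : IsSFiniteKernel (sinkhornKernel U V W (2 * n)) := isSFiniteKernel_gibbsKernel _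
  rw [sinkhornPi, sinkhornBridge, if_pos (even_two_mul n), if_pos (even_two_mul n),
    Measure.snd_compProd]

lemma sinkhornPi_odd (hM : IsModel U V W) (n : ℕ) :
    sinkhornPi U V W (2 * n + 1) = (sinkhornBridge U V W (2 * n + 1)).fst := by
  have := hM.prob_V
  have h : ¬ Even (2 * n + 1) := by simp
  have : IsSFiniteKernel (sinkhornKernel U V W (2 * n + 1)) := isSFiniteKernel_gibbsKernel _
  rw [sinkhornPi, sinkhornBridge, if_neg h, if_neg h, Measure.fst_map_swap, Measure.snd_compProd]

variable {Q : Measure (Eucl d × Eucl d)} {κ ρ c : ℝ}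

lemma isCoupling_swap {R : Measure (Eucl d × Eucl d)} {μ η : Measure (Eucl d)}
    (h : IsCoupling R μ η) : IsCoupling (R.map Prod.swap) η μ :=
  ⟨by rw [Measure.fst_map_swap, h.2], by rw [Measure.snd_map_swap, h.1]⟩

lemma klDiv_even_le (hU : Measurable U) (hV : Measurable V)
    (hW : Measurable (Function.uncurry W)) (hM : IsModel U V W)
    (hfin : HasFiniteEntropyCoupling U V W)
    (hQ : IsSchrodingerBridge (refMeasure U W) (gibbs U) (gibbs V) Q) (n : ℕ)
    (hA : CondA0 (sinkhornKernel U V W (2 * n + 2)) κ ρ) (hT : TalagrandT2 (gibbs U) c) :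
    klDiv Q (sinkhornBridge U V W (2 * n + 2)) ≤
      ENNReal.ofReal (epsRate κ ρ c) * klDiv (sinkhornPi U V W (2 * n + 1)) (gibbs U) := by
  have := hM.prob_U
  obtain ⟨h1, h2⟩ := measurable_sinkhornPot hU hV hW (2 * n + 1)
  have hp := isProbabilityMeasure_bridge_sinkhornPot hU hV hW hM (2 * n + 1)
  have hs := (sinkhornBridge_marginals hU hV hW hM n).2
  have hmin := fun R => schrodingerBridge_klDiv_le hU hV hW hM hfin hQ (2 * n + 2) (R := R)
  rw [show 2 * n + 2 = 2 * (n + 1) by ring, sinkhornKernel_even, mul_add, sinkhornPot_even] at hA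
  rw [sinkhornPi_odd hM]
  simp only [sinkhornBridge_eq hU hV hW hM, sinkhornPot_even] at hs hmin ⊢
  exact klDiv_le_epsRate_mul hU hW h1 h2 (measurable_newPot hU hW h2) hs hA hT hmin

lemma klDiv_odd_le (hU : Measurable U) (hV : Measurable V)
    (hW : Measurable (Function.uncurry W)) (hM : IsModel U V W)
    (hfin : HasFiniteEntropyCoupling U V W)
    (hQ : IsSchrodingerBridge (refMeasure U W) (gibbs U) (gibbs V) Q) (n : ℕ)
    (hA : CondA0 (sinkhornKernel U V W (2 * n + 1)) κ ρ) (hT : TalagrandT2 (gibbs V) c) :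
    klDiv Q (sinkhornBridge U V W (2 * n + 1)) ≤
      ENNReal.ofReal (epsRate κ ρ c) * klDiv (sinkhornPi U V W (2 * n)) (gibbs V) := by
  have := hM.prob_U
  have := hM.prob_V
  obtain ⟨h1, h2⟩ := measurable_sinkhornPot hU hV hW (2 * n)
  have h3 := measurable_newPot hV (measurable_flat hW) h1
  have hp := isProbabilityMeasure_bridge_sinkhornPot hU hV hW hM (2 * n)
  have hp' := isProbabilityMeasure_bridge_sinkhornPot hU hV hW hM (2 * n + 1)
  have hpf := isProbabilityMeasure_bridge_flat hW h1 h2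
  have hs := (sinkhornBridge_marginals hU hV hW hM n).1
  have hmin := fun R => schrodingerBridge_klDiv_le hU hV hW hM hfin hQ (2 * n + 1) (R := R)
  rw [sinkhornKernel_odd, sinkhornPot_odd] at hA
  rw [sinkhornPi_even hM]
  simp only [sinkhornBridge_eq hU hV hW hM, sinkhornPot_odd] at hs hmin hp' ⊢
  have := isProbabilityMeasure_of_fst hQ.1.1
  have key := klDiv_le_epsRate_mul (W := flat W) (U := V) (V := U) (Q := Q.map Prod.swap)
    hV (measurable_flat hW) h2 h1 h3 (by rw [bridge_snd_eq hW h1 h2, hs]) hA hT (by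
      intro R hR
      have hR' := hmin _ (isCoupling_swap hR)
      have := isProbabilityMeasure_of_fst hR.1
      rw [← bridge_swap hW h1 h3, klDiv_swap]
      refine hR'.trans_eq ?_
      rw [← klDiv_swap R, ← klDiv_swap (R.map Prod.swap), Measure.map_map measurable_swap
        measurable_swap, klDiv_swap R, Prod.swap_swap_eq, Measure.map_id])
  rwa [← bridge_swap hW h1 h3, klDiv_swap, bridge_fst_eq hW h1 h2] at key

lemma klDiv_even_add_le (hU : Measurable U) (hV : Measurable V)
    (hW : Measurable (Function.uncurry W)) (hM : IsModel U V W)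
    (hQ : IsCoupling Q (gibbs U) (gibbs V)) (n : ℕ) :
    klDiv Q (sinkhornBridge U V W (2 * n + 2)) + klDiv (sinkhornPi U V W (2 * n + 1)) (gibbs U)
      ≤ klDiv Q (sinkhornBridge U V W (2 * n)) := by
  have := hM.prob_U
  have := hM.prob_V
  obtain ⟨h1, h2⟩ := measurable_sinkhornPot hU hV hW (2 * n)
  have hp := isProbabilityMeasure_bridge_sinkhornPot hU hV hW hM (2 * n)
  have hs := (sinkhornBridge_marginals hU hV hW hM n).1
  rw [sinkhornPi_odd hM]
  simp only [sinkhornBridge_eq hU hV hW hM, sinkhornPot_even, sinkhornPot_odd] at hs ⊢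
  exact klDiv_add_klDiv_fst_le hU hV hW h1 h2 hs hQ rfl

lemma klDiv_odd_add_le (hU : Measurable U) (hV : Measurable V)
    (hW : Measurable (Function.uncurry W)) (hM : IsModel U V W)
    (hQ : IsCoupling Q (gibbs U) (gibbs V)) (n : ℕ) :
    klDiv Q (sinkhornBridge U V W (2 * n + 3)) + klDiv (sinkhornPi U V W (2 * n + 2)) (gibbs V)
      ≤ klDiv Q (sinkhornBridge U V W (2 * n + 1)) := by
  have := hM.prob_U
  have := hM.prob_V
  have := isProbabilityMeasure_of_fst hQ.1
  obtain ⟨h1, h2⟩ := measurable_sinkhornPot hU hV hW (2 * n + 1)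
  have h3 := measurable_newPot hU hW h2
  have h4 := measurable_newPot hV (measurable_flat hW) h3
  have hp := isProbabilityMeasure_bridge_sinkhornPot hU hV hW hM (2 * n + 1)
  have hp2 := isProbabilityMeasure_bridge_sinkhornPot hU hV hW hM (2 * n + 2)
  have hp3 := isProbabilityMeasure_bridge_sinkhornPot hU hV hW hM (2 * n + 3)
  have hpf := isProbabilityMeasure_bridge_flat hW h1 h2
  have hs := (sinkhornBridge_marginals hU hV hW hM n).2
  rw [show 2 * n + 2 = 2 * (n + 1) by ring, sinkhornPi_even hM]
  rw [show 2 * (n + 1) = 2 * n + 2 by ring]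
  have e3 := sinkhornPot_odd U V W (n + 1)
  rw [show 2 * (n + 1) + 1 = 2 * n + 3 by ring, show 2 * (n + 1) = 2 * n + 2 by ring,
    sinkhornPot_even] at e3
  simp only [sinkhornBridge_eq hU hV hW hM, e3, sinkhornPot_even] at hs hp2 hp3 ⊢
  have key := klDiv_add_klDiv_fst_le (W := flat W) (U := V) (V := U) (Q := Q.map Prod.swap)
    hV hU (measurable_flat hW) h2 h1 (by rw [bridge_fst_eq hW h1 h2, hs]) (isCoupling_swap hQ)
    (v' := newPot U W (sinkhornPot U V W (2 * n + 1)).2) rfl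
  rwa [← bridge_swap hW h3 h4, ← bridge_swap hW h1 h2, ← bridge_swap hW h3 h2, klDiv_swap,
    klDiv_swap, Measure.fst_map_swap] at key

lemma epsRate_pos (hA : CondA0 (d := d) (sinkhornKernel U V W n) κ ρ) {μ : Measure (Eucl d)}
    (hT : TalagrandT2 μ c) : 0 < epsRate κ ρ c := by
  have h1 := hA.2.1.1
  have h2 := hA.2.2.1
  have h3 := hT.1
  unfold epsRate; positivity

theorem klDiv_even_contraction (hU : Measurable U) (hV : Measurable V)
    (hW : Measurable (Function.uncurry W)) (hM : IsModel U V W)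
    (hfin : HasFiniteEntropyCoupling U V W)
    (hQ : IsSchrodingerBridge (refMeasure U W) (gibbs U) (gibbs V) Q) (n : ℕ)
    (hA : CondA0 (sinkhornKernel U V W (2 * n + 2)) κ ρ) (hT : TalagrandT2 (gibbs U) c) :
    klDiv Q (sinkhornBridge U V W (2 * n + 2)) ≤
      ENNReal.ofReal ((1 + (epsRate κ ρ c)⁻¹)⁻¹) * klDiv Q (sinkhornBridge U V W (2 * n)) :=
  le_rate_mul_of_add_le (epsRate_pos hA hT) (klDiv_even_le hU hV hW hM hfin hQ n hA hT)
    (klDiv_even_add_le hU hV hW hM hQ.1 n)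

theorem klDiv_odd_contraction (hU : Measurable U) (hV : Measurable V)
    (hW : Measurable (Function.uncurry W)) (hM : IsModel U V W)
    (hfin : HasFiniteEntropyCoupling U V W)
    (hQ : IsSchrodingerBridge (refMeasure U W) (gibbs U) (gibbs V) Q) (n : ℕ)
    (hA : CondA0 (sinkhornKernel U V W (2 * n + 3)) κ ρ) (hT : TalagrandT2 (gibbs V) c) :
    klDiv Q (sinkhornBridge U V W (2 * n + 3)) ≤
      ENNReal.ofReal ((1 + (epsRate κ ρ c)⁻¹)⁻¹) * klDiv Q (sinkhornBridge U V W (2 * n + 1)) :=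
  le_rate_mul_of_add_le (epsRate_pos hA hT) (klDiv_odd_le hU hV hW hM hfin hQ (n + 1) hA hT)
    (klDiv_odd_add_le hU hV hW hM hQ.1 n)

end

/-! ### The Prékopa–Leindler inequality -/

section PrekopaLeindler

open Set Pointwise

lemma volume_add_le_of_isCompact {K L : Set ℝ} (hK : IsCompact K) (hL : IsCompact L)
    (hK0 : K.Nonempty) (hL0 : L.Nonempty) : volume K + volume L ≤ volume (K + L) := by
  set a := sSup K
  set b := sInf L
  have ha : a ∈ K := hK.sSup_mem hK0
  have hb : b ∈ L := hL.sInf_mem hL0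
  have h1 : (b +ᵥ K) ∪ (a +ᵥ L) ⊆ K + L := by
    rintro x (⟨k, hk, rfl⟩ | ⟨l, hl, rfl⟩)
    · exact ⟨k, hk, b, hb, add_comm k b⟩
    · exact ⟨a, ha, l, hl, rfl⟩
  -- the two translates lie on different sides of the point `a + b`
  have h2 : (b +ᵥ K) ∩ (a +ᵥ L) ⊆ {a + b} := by
    rintro x ⟨⟨k, hk, rfl⟩, ⟨l, hl, h⟩⟩
    have h3 : k ≤ a := le_csSup hK.bddAbove hk
    have h4 : b ≤ l := csInf_le hL.bddBelow hl
    simp only [vadd_eq_add, mem_singleton_iff] at h ⊢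
    linarith
  have h5 : volume ((b +ᵥ K) ∩ (a +ᵥ L)) = 0 :=
    measure_mono_null h2 (by simp)
  have h6 := measure_union_add_inter (μ := volume) (b +ᵥ K) (hL.vadd a).measurableSet
  rw [h5, add_zero, measure_vadd, measure_vadd] at h6
  rw [← h6]
  exact measure_mono h1

/-- Brunn–Minkowski on the line. -/
lemma volume_add_le {A B C : Set ℝ} (hA : MeasurableSet A) (hB : MeasurableSet B)
    (hA0 : A.Nonempty) (hB0 : B.Nonempty) (h : A + B ⊆ C) : volume A + volume B ≤ volume C := by
  obtain ⟨a, ha⟩ := hA0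
  obtain ⟨b, hb⟩ := hB0
  rw [hA.measure_eq_iSup_isCompact, hB.measure_eq_iSup_isCompact]
  simp only [iSup_and']
  refine ENNReal.biSup_add_biSup_le' ⟨∅, by simp⟩ ⟨∅, by simp⟩ ?_
  rintro K ⟨hKA, hK⟩ L ⟨hLB, hL⟩
  calc volume K + volume L ≤ volume (insert a K) + volume (insert b L) := by
        gcongr <;> exact subset_insert _ _
    _ ≤ volume (insert a K + insert b L) :=
        volume_add_le_of_isCompact (hK.insert a) (hL.insert b) ⟨a, by simp⟩ ⟨b, by simp⟩
    _ ≤ volume C := measure_mono ((add_subset_add (insert_subset ha hKA)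
        (insert_subset hb hLB)).trans h)

/-- Layer cake formula in which only the levels in `(0, 1)` contribute. -/
lemma lintegral_eq_lintegral_meas_lt_of_le_one {F : ℝ → ℝ≥0∞} (hF : Measurable F)
    (h1 : ∀ x, F x ≤ 1) :
    ∫⁻ x, F x = ∫⁻ l in Ioo (0 : ℝ) 1, volume {x | ENNReal.ofReal l < F x} := by
  have hfin : ∀ x, F x ≠ ⊤ := fun x => ((h1 x).trans_lt ENNReal.one_lt_top).ne
  have e : ∀ x, F x = ENNReal.ofReal (F x).toReal := fun x => (ENNReal.ofReal_toReal (hfin x)).symm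
  have e2 : ∀ l : ℝ, 0 < l → {x | l < (F x).toReal} = {x | ENNReal.ofReal l < F x} := by
    intro l hl; ext x
    exact (ENNReal.ofReal_lt_iff_lt_toReal hl.le (hfin x)).symm
  rw [lintegral_congr e, lintegral_eq_lintegral_meas_lt volume (.of_forall fun x => ENNReal.toReal_nonneg)
    (by fun_prop), ← Ioo_union_Ici_eq_Ioi zero_lt_one, lintegral_union measurableSet_Ici
    (by rw [disjoint_left]; intro x hx hx'; exact absurd hx.2 (not_lt.2 hx'))]
  have hz : ∫⁻ l in Ici (1 : ℝ), volume {x | l < (F x).toReal} = 0 := by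
    rw [setLIntegral_congr_fun (g := fun _ => 0) measurableSet_Ici]
    · simp
    · intro l hl
      have : {x | l < (F x).toReal} = ∅ := by
        ext x
        simp only [mem_ofPred_eq, mem_empty_iff_false, iff_false, not_lt]
        exact (ENNReal.toReal_mono ENNReal.one_ne_top (h1 x)).trans (by simpa using hl)
      simp [this]
  rw [hz, add_zero]
  exact setLIntegral_congr_fun measurableSet_Ioo fun l hl => by simp only [e2 l hl.1]

lemma ennreal_geom_mean_le {t s : ℝ} (ht : 0 < t) (hs : 0 < s) (hts : t + s = 1) (a b : ℝ≥0∞) :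
    a ^ t * b ^ s ≤ ENNReal.ofReal t * a + ENNReal.ofReal s * b := by
  by_cases ha : a = ⊤
  · rw [ha, ENNReal.mul_top (by simpa using ht), top_add]; exact le_top
  by_cases hb : b = ⊤
  · rw [hb, ENNReal.mul_top (by simpa using hs), add_top]; exact le_top
  lift a to NNReal using ha
  lift b to NNReal using hb
  have h := NNReal.geom_mean_le_arith_mean2_weighted ⟨t, ht.le⟩ ⟨s, hs.le⟩ a b
    (by ext; exact hts)
  rw [← ENNReal.coe_rpow_of_nonneg _ ht.le, ← ENNReal.coe_rpow_of_nonneg _ hs.le,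
    ENNReal.ofReal_eq_coe_nnreal ht.le, ENNReal.ofReal_eq_coe_nnreal hs.le]
  exact_mod_cast h

variable {t s : ℝ}

/-- When both suprema are `1`, the superlevel sets of `F` and `G` at each level in `(0, 1)` are
nonempty, so that the Brunn–Minkowski inequality applies to them; the result is even stronger than
the geometric mean. -/
lemma prekopaLeindler_normalized (ht : 0 < t) (hs : 0 < s) (hts : t + s = 1)
    {F G H : ℝ → ℝ≥0∞} (hF : Measurable F) (hG : Measurable G) (hH : Measurable H)
    (hF1 : ⨆ x, F x = 1) (hG1 : ⨆ x, G x = 1)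
    (h : ∀ x y, F x ^ t * G y ^ s ≤ H (t * x + s * y)) :
    (∫⁻ x, F x) ^ t * (∫⁻ x, G x) ^ s ≤ ∫⁻ x, H x := by
  refine (ennreal_geom_mean_le ht hs hts _ _).trans ?_
  set H' : ℝ → ℝ≥0∞ := fun x => min (H x) 1 with hH'
  have hH'm : Measurable H' := hH.min measurable_const
  have hFle : ∀ x, F x ≤ 1 := fun x => hF1 ▸ le_iSup F x
  have hGle : ∀ x, G x ≤ 1 := fun x => hG1 ▸ le_iSup G x
  refine le_trans ?_ (lintegral_mono (fun x => min_le_left (H x) 1))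
  rw [lintegral_eq_lintegral_meas_lt_of_le_one hF hFle,
    lintegral_eq_lintegral_meas_lt_of_le_one hG hGle,
    lintegral_eq_lintegral_meas_lt_of_le_one hH'm (fun x => min_le_right _ _),
    ← lintegral_const_mul' _ _ ENNReal.ofReal_ne_top,
    ← lintegral_const_mul' _ _ ENNReal.ofReal_ne_top]
  have key : ∀ l ∈ Ioo (0 : ℝ) 1, ENNReal.ofReal t * volume {x | ENNReal.ofReal l < F x} +
      ENNReal.ofReal s * volume {x | ENNReal.ofReal l < G x}
        ≤ volume {x | ENNReal.ofReal l < H' x} := by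
    intro l hl
    have hl1 : ENNReal.ofReal l < 1 := ENNReal.ofReal_lt_one.2 hl.2
    obtain ⟨x₀, hx₀⟩ := lt_iSup_iff.1 (hF1.symm ▸ hl1)
    obtain ⟨y₀, hy₀⟩ := lt_iSup_iff.1 (hG1.symm ▸ hl1)
    have e : ∀ (c : ℝ) (S : Set ℝ), 0 < c → ENNReal.ofReal c * volume S = volume (c • S) := by
      intro c S hc
      rw [Measure.addHaar_smul]; simp [abs_of_pos hc]
    rw [e t _ ht, e s _ hs]
    refine volume_add_le ((measurableSet_lt measurable_const hF).const_smul₀ t)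
      ((measurableSet_lt measurable_const hG).const_smul₀ s) ⟨_, smul_mem_smul_set hx₀⟩
      ⟨_, smul_mem_smul_set hy₀⟩ ?_
    rintro _ ⟨_, ⟨x, hx, rfl⟩, _, ⟨y, hy, rfl⟩, rfl⟩
    simp only [mem_ofPred_eq, smul_eq_mul] at hx hy ⊢
    refine lt_min ((lt_of_lt_of_le ?_ (h x y))) hl1
    calc ENNReal.ofReal l = ENNReal.ofReal l ^ t * ENNReal.ofReal l ^ s := by
          rw [← ENNReal.rpow_add _ _ (by simpa using hl.1) ENNReal.ofReal_ne_top, hts,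
            ENNReal.rpow_one]
      _ < F x ^ t * G y ^ s :=
          ENNReal.mul_lt_mul (ENNReal.rpow_lt_rpow hx ht) (ENNReal.rpow_lt_rpow hy hs)
  calc _ ≤ ∫⁻ l in Ioo (0 : ℝ) 1, (ENNReal.ofReal t * volume {x | ENNReal.ofReal l < F x} +
      ENNReal.ofReal s * volume {x | ENNReal.ofReal l < G x}) := le_lintegral_add _ _
    _ ≤ _ := setLIntegral_mono' measurableSet_Ioo key

lemma prekopaLeindler_bounded (ht : 0 < t) (hs : 0 < s) (hts : t + s = 1)
    {F G H : ℝ → ℝ≥0∞} (hF : Measurable F) (hG : Measurable G) (hH : Measurable H)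
    (hF1 : ⨆ x, F x ≠ ⊤) (hG1 : ⨆ x, G x ≠ ⊤)
    (h : ∀ x y, F x ^ t * G y ^ s ≤ H (t * x + s * y)) :
    (∫⁻ x, F x) ^ t * (∫⁻ x, G x) ^ s ≤ ∫⁻ x, H x := by
  set a := ⨆ x, F x
  set b := ⨆ x, G x
  by_cases ha : a = 0
  · have : ∀ x, F x = 0 := fun x => le_antisymm (ha ▸ le_iSup F x) zero_le
    simp [this, ht]
  by_cases hb : b = 0
  · have : ∀ x, G x = 0 := fun x => le_antisymm (hb ▸ le_iSup G x) zero_le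
    simp [this, hs]
  have hab0 : a ^ t * b ^ s ≠ 0 := mul_ne_zero (by simp [ha, hF1]) (by simp [hb, hG1])
  have habt : a ^ t * b ^ s ≠ ⊤ := ENNReal.mul_ne_top (by simp [ha, hF1])
    (by simp [hb, hG1])
  have key := prekopaLeindler_normalized ht hs hts (F := fun x => a⁻¹ * F x)
    (G := fun x => b⁻¹ * G x) (H := fun x => (a ^ t * b ^ s)⁻¹ * H x) (by fun_prop) (by fun_prop)
    (by fun_prop) (by rw [← ENNReal.mul_iSup]; exact ENNReal.inv_mul_cancel ha hF1)
    (by rw [← ENNReal.mul_iSup]; exact ENNReal.inv_mul_cancel hb hG1) (by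
      intro x y
      rw [ENNReal.mul_rpow_of_nonneg _ _ ht.le, ENNReal.mul_rpow_of_nonneg _ _ hs.le,
        mul_mul_mul_comm, ENNReal.inv_rpow, ENNReal.inv_rpow, ← ENNReal.mul_inv (by simp [ha, hF1])
          (by right; simp [hb, hG1])]
      gcongr
      exact h x y)
  rw [lintegral_const_mul _ hF, lintegral_const_mul _ hG, lintegral_const_mul _ hH,
    ENNReal.mul_rpow_of_nonneg _ _ ht.le, ENNReal.mul_rpow_of_nonneg _ _ hs.le,
    mul_mul_mul_comm, ENNReal.inv_rpow, ENNReal.inv_rpow, ← ENNReal.mul_inv (by simp [ha, hF1])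
      (by right; simp [hb, hG1])] at key
  exact (ENNReal.mul_le_mul_iff_right (by simpa using habt) (by simpa using hab0)).1 key

lemma tendsto_lintegral_min_nat {α : Type*} [MeasurableSpace α] {μ : Measure α} {F : α → ℝ≥0∞}
    (hF : Measurable F) :
    Filter.Tendsto (fun n : ℕ => ∫⁻ x, min (F x) n ∂μ) Filter.atTop (nhds (∫⁻ x, F x ∂μ)) := by
  refine lintegral_tendsto_of_tendsto_of_monotone (fun n => (hF.min measurable_const).aemeasurable)
    (.of_forall fun x n m hnm => min_le_min le_rfl (by exact_mod_cast hnm))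
    (.of_forall fun x => ?_)
  have h : Filter.Tendsto (fun n : ℕ => min (F x) (n : ℝ≥0∞)) Filter.atTop
      (nhds (min (F x) ⊤)) := tendsto_const_nhds.min ENNReal.tendsto_nat_nhds_top
  simpa using h

lemma prekopaLeindler_real (ht : 0 < t) (hs : 0 < s) (hts : t + s = 1)
    {F G H : ℝ → ℝ≥0∞} (hF : Measurable F) (hG : Measurable G) (hH : Measurable H)
    (h : ∀ x y, F x ^ t * G y ^ s ≤ H (t * x + s * y)) :
    (∫⁻ x, F x) ^ t * (∫⁻ x, G x) ^ s ≤ ∫⁻ x, H x := by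
  by_cases hF0 : ∫⁻ x, F x = 0
  · simp [hF0, ht]
  by_cases hG0 : ∫⁻ x, G x = 0
  · simp [hG0, hs]
  have hlim := ENNReal.Tendsto.mul
    ((ENNReal.continuous_rpow_const (y := t)).tendsto _ |>.comp
      (tendsto_lintegral_min_nat (μ := volume) hF)) (.inl (by simp [hF0, ht, not_lt.2 ht.le]))
    ((ENNReal.continuous_rpow_const (y := s)).tendsto _ |>.comp
      (tendsto_lintegral_min_nat (μ := volume) hG)) (.inl (by simp [hG0, hs, not_lt.2 hs.le]))
  refine le_of_tendsto' hlim fun n => ?_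
  have hb : ∀ F : ℝ → ℝ≥0∞, ⨆ x, min (F x) (n : ℝ≥0∞) ≠ ⊤ := fun F =>
    ((iSup_le fun x => min_le_right (F x) (n : ℝ≥0∞)).trans_lt (ENNReal.natCast_lt_top n)).ne
  refine prekopaLeindler_bounded ht hs hts (hF.min measurable_const) (hG.min measurable_const) hH
    (hb F) (hb G) fun x y => le_trans ?_ (h x y)
  gcongr <;> exact min_le_left _ _

/-- Induction on the dimension: the inequality on the line is applied to the integrals over the
remaining coordinates. -/
lemma prekopaLeindler_pi (ht : 0 < t) (hs : 0 < s) (hts : t + s = 1) (n : ℕ)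
    {F G H : (Fin n → ℝ) → ℝ≥0∞} (hF : Measurable F) (hG : Measurable G) (hH : Measurable H)
    (h : ∀ x y, F x ^ t * G y ^ s ≤ H (t • x + s • y)) :
    (∫⁻ x, F x) ^ t * (∫⁻ x, G x) ^ s ≤ ∫⁻ x, H x := by
  induction n with
  | zero =>
    rw [Measure.volume_pi_eq_dirac 0, lintegral_dirac, lintegral_dirac, lintegral_dirac]
    exact (h 0 0).trans_eq (by congr 1; exact Subsingleton.elim _ _)
  | succ n ih =>
    set e := MeasurableEquiv.piFinSuccAbove (fun _ : Fin (n + 1) => ℝ) 0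
    have he : MeasurePreserving e.symm :=
      (volume_preserving_piFinSuccAbove (fun _ : Fin (n + 1) => ℝ) 0).symm e
    have hint : ∀ F : (Fin (n + 1) → ℝ) → ℝ≥0∞, Measurable F →
        ∫⁻ x, F x = ∫⁻ a, ∫⁻ z, F (e.symm (a, z)) := by
      intro F hF
      rw [← he.lintegral_comp hF]
      exact lintegral_prod _ (hF.comp e.symm.measurable).aemeasurable
    have hmeas : ∀ F : (Fin (n + 1) → ℝ) → ℝ≥0∞, Measurable F →
        Measurable fun a => ∫⁻ z, F (e.symm (a, z)) := fun F hF =>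
      (hF.comp e.symm.measurable).lintegral_prod_right'
    have hlin : ∀ a b z w, e.symm (t * a + s * b, t • z + s • w)
        = t • e.symm (a, z) + s • e.symm (b, w) := by
      intro a b z w
      ext i
      refine Fin.cases ?_ (fun j => ?_) i
      · simp [e, MeasurableEquiv.piFinSuccAbove]
      · simp [e, MeasurableEquiv.piFinSuccAbove]
    rw [hint F hF, hint G hG, hint H hH]
    refine prekopaLeindler_real ht hs hts (hmeas F hF) (hmeas G hG) (hmeas H hH) fun a b => ?_
    refine ih (hF.comp (e.symm.measurable.comp measurable_prodMk_left))
      (hG.comp (e.symm.measurable.comp measurable_prodMk_left))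
      (hH.comp (e.symm.measurable.comp measurable_prodMk_left)) fun z w => ?_
    simp only [hlin]
    exact h _ _

/-- The **Prékopa–Leindler inequality** in Euclidean space. -/
theorem prekopaLeindler (ht : 0 < t) (hs : 0 < s) (hts : t + s = 1)
    {F G H : Eucl d → ℝ≥0∞} (hF : Measurable F) (hG : Measurable G) (hH : Measurable H)
    (h : ∀ x y, F x ^ t * G y ^ s ≤ H (t • x + s • y)) :
    (∫⁻ x, F x) ^ t * (∫⁻ x, G x) ^ s ≤ ∫⁻ x, H x := by
  have hp := PiLp.volume_preserving_toLp (Fin d)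
  rw [← hp.lintegral_comp hF, ← hp.lintegral_comp hG, ← hp.lintegral_comp hH]
  refine prekopaLeindler_pi ht hs hts d (hF.comp hp.measurable) (hG.comp hp.measurable)
    (hH.comp hp.measurable) fun x y => ?_
  simp only [WithLp.toLp_add, WithLp.toLp_smul]
  exact h _ _

end PrekopaLeindler

/-! ### The log-Sobolev inequality for smooth densities -/

section SmoothLogSobolev

open Set

lemma continuous_of_strongConvexOn {Ψ : Eucl d → ℝ} {m : ℝ} (h : StrongConvexOn univ m Ψ) :
    Continuous Ψ := by
  have h1 := (strongConvexOn_iff_convex.1 h).locallyLipschitzOn isOpen_univ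
  have h2 : Continuous fun x => Ψ x - m / 2 * ‖x‖ ^ 2 := by
    rw [← continuousOn_univ]; exact h1.continuousOn
  have h3 : Ψ = fun x => (Ψ x - m / 2 * ‖x‖ ^ 2) + m / 2 * ‖x‖ ^ 2 := by ext x; ring
  rw [h3]; fun_prop

lemma le_add_fderiv_add_sq {g : Eucl d → ℝ} (hg : Differentiable ℝ g) {K : NNReal}
    (hK : LipschitzWith K (fderiv ℝ g)) (z h : Eucl d) :
    g (z + h) ≤ g z + fderiv ℝ g z h + K * ‖h‖ ^ 2 := by
  obtain ⟨w, hw, e⟩ := domain_mvt (f := g) (f' := fderiv ℝ g) (s := univ) (x := z) (y := z + h)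
    (fun x _ => (hg x).hasFDerivAt.hasFDerivWithinAt) convex_univ trivial trivial
  rw [add_sub_cancel_left] at e
  have h1 : (fderiv ℝ g w - fderiv ℝ g z) h ≤ K * ‖h‖ ^ 2 := by
    refine (Real.le_norm_self _).trans ((ContinuousLinearMap.le_opNorm _ _).trans ?_)
    have h2 : ‖fderiv ℝ g w - fderiv ℝ g z‖ ≤ K * ‖h‖ := by
      refine (hK.norm_sub_le w z).trans ?_
      gcongr
      have h3 := norm_sub_le_of_mem_segment hw
      rwa [add_sub_cancel_left] at h3
    calc ‖fderiv ℝ g w - fderiv ℝ g z‖ * ‖h‖ ≤ K * ‖h‖ * ‖h‖ := by gcongr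
      _ = K * ‖h‖ ^ 2 := by ring
  rw [sub_apply] at h1
  linarith

/-- The pointwise hypothesis of the Prékopa–Leindler inequality for `exp (g / t - Ψ)` and
`exp (-Ψ)`: strong convexity of `Ψ` pays for the increment of `g`, up to its squared gradient. -/
lemma prekopaLeindler_exponent_le {Ψ : Eucl d → ℝ} {m : ℝ} (hm : 0 < m)
    (h : StrongConvexOn univ m Ψ) {g : Eucl d → ℝ} (hg : Differentiable ℝ g) {K : NNReal}
    (hK : LipschitzWith K (fderiv ℝ g)) {t s : ℝ} (ht : 0 < t) (hs : 0 < s) (hts : t + s = 1)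
    (hsK : s * (m / 2 + K) ≤ m / 6) (x y : Eucl d) :
    g x - t * Ψ x - s * Ψ y ≤ g (t • x + s • y) +
      s * (3 / (4 * m)) * ‖fderiv ℝ g (t • x + s • y)‖ ^ 2 - Ψ (t • x + s • y) := by
  set z := t • x + s • y
  have h1 := h.2 (mem_univ x) (mem_univ y) ht.le hs.le hts
  simp only [smul_eq_mul] at h1
  have hx : x = z + s • (x - y) := by
    have : x = (t + s) • x := by rw [hts, one_smul]
    conv_lhs => rw [this]
    simp only [z]; module
  have h2 := le_add_fderiv_add_sq hg hK z (s • (x - y))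
  rw [← hx, map_smul, smul_eq_mul, norm_smul, Real.norm_eq_abs, abs_of_pos hs] at h2
  have h3 : fderiv ℝ g z (x - y) ≤ ‖fderiv ℝ g z‖ * ‖x - y‖ :=
    (Real.le_norm_self _).trans (ContinuousLinearMap.le_opNorm _ _)
  set a := ‖fderiv ℝ g z‖
  set k := ‖x - y‖
  have h4 : a * k ≤ 3 / (4 * m) * a ^ 2 + m / 3 * k ^ 2 := by
    have e : 3 / (4 * m) * a ^ 2 + m / 3 * k ^ 2 - a * k
        = 3 / (4 * m) * (a - 2 * m / 3 * k) ^ 2 := by field_simp; ring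
    have : 0 ≤ 3 / (4 * m) * (a - 2 * m / 3 * k) ^ 2 := by positivity
    linarith
  have h5 : s * fderiv ℝ g z (x - y) ≤ s * (3 / (4 * m) * a ^ 2 + m / 3 * k ^ 2) := by
    gcongr; exact h3.trans h4
  have h6 : K * (s * k) ^ 2 ≤ s * (t * (m / 2) - m / 3) * k ^ 2 := by
    have : s * K ≤ t * (m / 2) - m / 3 := by
      have : t = 1 - s := by linarith
      rw [this]; nlinarith
    calc K * (s * k) ^ 2 = s * (s * K) * k ^ 2 := by ring
      _ ≤ s * (t * (m / 2) - m / 3) * k ^ 2 := by gcongr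
  nlinarith [h1, h2, h5, h6]

lemma integrable_exp_mul_of_bounded {μ : Measure (Eucl d)} [IsFiniteMeasure μ] {h : Eucl d → ℝ}
    (hc : Continuous h) {C : ℝ} (hb : ∀ x, |h x| ≤ C) : Integrable h μ :=
  Integrable.of_bound hc.aestronglyMeasurable C (.of_forall fun x => by simpa using hb x)

lemma lintegral_exp_sub {Ψ : Eucl d → ℝ} (hΨ : Continuous Ψ) [IsFiniteMeasure (gibbs Ψ)]
    {h : Eucl d → ℝ} (hc : Continuous h) {C : ℝ} (hb : ∀ x, |h x| ≤ C) :
    ∫⁻ x, ENNReal.ofReal (Real.exp (h x - Ψ x))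
      = ENNReal.ofReal (∫ x, Real.exp (h x) ∂gibbs Ψ) := by
  have hint : Integrable (fun x => Real.exp (h x)) (gibbs Ψ) :=
    integrable_exp_mul_of_bounded (by fun_prop) (C := Real.exp C) fun x => by
      rw [abs_of_pos (Real.exp_pos _)]; exact Real.exp_le_exp.2 (abs_le.1 (hb x)).2
  rw [ofReal_integral_eq_lintegral_ofReal hint (.of_forall fun x => (Real.exp_pos _).le), gibbs,
    lintegral_withDensity_eq_lintegral_mul _ (by fun_prop) (by fun_prop)]
  refine lintegral_congr fun x => ?_
  rw [Pi.mul_apply, ← ENNReal.ofReal_mul (Real.exp_pos _).le, ← Real.exp_add]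
  congr 2; ring

/-- Log-Sobolev inequality for a uniformly log-concave measure and the density `exp g`.  Only one
small value of the Prékopa–Leindler parameter `s` is used, at the price of a factor `2` in the
constant. -/
lemma entropy_exp_le_of_strongConvexOn {Ψ : Eucl d → ℝ} {m : ℝ} (hm : 0 < m)
    (h : StrongConvexOn univ m Ψ) [IsFiniteMeasure (gibbs Ψ)] (hZ : 0 < (gibbs Ψ).real univ)
    {g : Eucl d → ℝ} (hg : Differentiable ℝ g) {B L : ℝ} (hB : ∀ x, |g x| ≤ B)
    (hL : ∀ x, ‖fderiv ℝ g x‖ ≤ L) {K : NNReal} (hK : LipschitzWith K (fderiv ℝ g)) :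
    ∫ x, g x * Real.exp (g x) ∂gibbs Ψ - (∫ x, Real.exp (g x) ∂gibbs Ψ) *
        Real.log ((∫ x, Real.exp (g x) ∂gibbs Ψ) / (gibbs Ψ).real univ)
      ≤ 1 / m * ∫ x, ‖fderiv ℝ g x‖ ^ 2 * Real.exp (g x) ∂gibbs Ψ := by
  have hΨ := continuous_of_strongConvexOn h
  have hgc : Continuous g := hg.continuous
  have hfc : Continuous (fderiv ℝ g) := hK.continuous
  have hL0 : 0 ≤ L := (norm_nonneg _).trans (hL 0)
  have hB0 : 0 ≤ B := (abs_nonneg _).trans (hB 0)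
  have hfsq : ∀ x, ‖fderiv ℝ g x‖ ^ 2 ≤ L ^ 2 := fun x => by gcongr; exact hL x
  set M := gibbs Ψ with hM
  have : NeZero M := ⟨fun h0 => by simp [h0] at hZ⟩
  set Z := M.real univ
  set I := ∫ x, Real.exp (g x) ∂M
  set J := ∫ x, g x * Real.exp (g x) ∂M
  set D := ∫ x, ‖fderiv ℝ g x‖ ^ 2 * Real.exp (g x) ∂M
  have hexpB : ∀ x, |Real.exp (g x)| ≤ Real.exp B := fun x => by
    rw [abs_of_pos (Real.exp_pos _)]; exact Real.exp_le_exp.2 (abs_le.1 (hB x)).2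
  have iI : Integrable (fun x => Real.exp (g x)) M :=
    integrable_exp_mul_of_bounded (by fun_prop) hexpB
  have iJ : Integrable (fun x => g x * Real.exp (g x)) M :=
    integrable_exp_mul_of_bounded (by fun_prop) (C := B * Real.exp B) fun x => by
      rw [abs_mul]; gcongr; exacts [hB x, hexpB x]
  have iD : Integrable (fun x => ‖fderiv ℝ g x‖ ^ 2 * Real.exp (g x)) M :=
    integrable_exp_mul_of_bounded (by fun_prop) (C := L ^ 2 * Real.exp B) fun x => by
      rw [abs_mul, abs_of_nonneg (by positivity)]; gcongr; exacts [hL x, hexpB x]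
  have hI : 0 < I := integral_exp_pos iI
  -- a value of `s` small enough for all the estimates below
  obtain ⟨s, hs, hs1, hs2, hs3⟩ : ∃ s : ℝ, 0 < s ∧ s ≤ 1 / 2 ∧ s * (m / 2 + K) ≤ m / 6 ∧
      s * (3 / (4 * m)) * L ^ 2 ≤ 1 / 4 := by
    have hK0 : (0 : ℝ) ≤ K := K.2
    refine ⟨min (1 / 2) (min (m / 6 / (m / 2 + K)) (1 / 4 / (3 / (4 * m) * L ^ 2 + 1))), by
      positivity, min_le_left _ _, ?_, ?_⟩
    · rw [← le_div_iff₀ (by positivity)]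
      exact (min_le_right _ _).trans (min_le_left _ _)
    · have h1 : min (1 / 2) (min (m / 6 / (m / 2 + K)) (1 / 4 / (3 / (4 * m) * L ^ 2 + 1)))
          ≤ 1 / 4 / (3 / (4 * m) * L ^ 2 + 1) := (min_le_right _ _).trans (min_le_right _ _)
      rw [le_div_iff₀ (by positivity)] at h1
      refine le_trans ?_ h1
      rw [mul_assoc]
      gcongr
      linarith
  set t := 1 - s with htdef
  have ht : 0 < t := by linarith
  have hts : t + s = 1 := by simp [t]
  set c := s * (3 / (4 * m)) with hc
  have hc0 : 0 < c := by positivity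
  have hcb : ∀ x, c * ‖fderiv ℝ g x‖ ^ 2 ≤ 1 / 4 := fun x =>
    (by gcongr; exact hL x : c * ‖fderiv ℝ g x‖ ^ 2 ≤ c * L ^ 2).trans hs3
  have hPL := prekopaLeindler ht hs hts (d := d)
    (F := fun x => ENNReal.ofReal (Real.exp (g x / t - Ψ x)))
    (G := fun x => ENNReal.ofReal (Real.exp (0 - Ψ x)))
    (H := fun x => ENNReal.ofReal (Real.exp (g x + c * ‖fderiv ℝ g x‖ ^ 2 - Ψ x)))
    (by fun_prop) (by fun_prop) (by fun_prop) (by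
      intro x y
      rw [ENNReal.ofReal_rpow_of_pos (Real.exp_pos _), ENNReal.ofReal_rpow_of_pos (Real.exp_pos _),
        ← ENNReal.ofReal_mul (by positivity), ← Real.exp_mul, ← Real.exp_mul, ← Real.exp_add]
      refine ENNReal.ofReal_le_ofReal (Real.exp_le_exp.2 ?_)
      refine le_trans (le_of_eq ?_) (prekopaLeindler_exponent_le hm h hg hK ht hs hts hs2 x y)
      field_simp; ring)
  rw [lintegral_exp_sub hΨ (by fun_prop) (C := B / t) (fun x => by
      rw [abs_div, abs_of_pos ht]; gcongr; exact hB x),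
    lintegral_exp_sub hΨ (by fun_prop) (C := 0) (fun x => by simp),
    lintegral_exp_sub hΨ (by fun_prop) (C := B + 1 / 4) (fun x => by
      refine (abs_add_le _ _).trans (add_le_add (hB x) ?_)
      rw [abs_of_nonneg (by positivity)]; exact hcb x)] at hPL
  set X := ∫ x, Real.exp (g x / t) ∂M
  set Y := ∫ x, Real.exp (g x + c * ‖fderiv ℝ g x‖ ^ 2) ∂M
  have iX : Integrable (fun x => Real.exp (g x / t)) M :=
    integrable_exp_mul_of_bounded (by fun_prop) (C := Real.exp (B / t)) fun x => by
      rw [abs_of_pos (Real.exp_pos _)]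
      exact Real.exp_le_exp.2 (by gcongr; exact (abs_le.1 (hB x)).2)
  have iY : Integrable (fun x => Real.exp (g x + c * ‖fderiv ℝ g x‖ ^ 2)) M :=
    integrable_exp_mul_of_bounded (by fun_prop) (C := Real.exp (B + 1 / 4)) fun x => by
      rw [abs_of_pos (Real.exp_pos _)]
      exact Real.exp_le_exp.2 (add_le_add (abs_le.1 (hB x)).2 (hcb x))
  have hX : 0 < X := integral_exp_pos iX
  have hY : 0 < Y := integral_exp_pos iY
  have e0 : ∫ _, Real.exp 0 ∂M = Z := by simp [Z]
  rw [e0, ENNReal.ofReal_rpow_of_pos hX, ENNReal.ofReal_rpow_of_pos hZ,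
    ← ENNReal.ofReal_mul (by positivity), ENNReal.ofReal_le_ofReal_iff hY.le] at hPL
  -- Jensen's inequality for the tilted measure bounds `X` from below
  have hXlow : I * Real.exp (s / t * (J / I)) ≤ X := by
    set b := s / t * (J / I) with hb
    have h1 : ∀ x, Real.exp b * (Real.exp (g x) + s / t * (g x * Real.exp (g x))
        - b * Real.exp (g x)) ≤ Real.exp (g x / t) := by
      intro x
      have e1 : g x / t = b + g x + (s / t * g x - b) := by
        have : (1 : ℝ) = t + s := hts.symm
        field_simp; linear_combination (g x) * this
      rw [e1, Real.exp_add, Real.exp_add]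
      calc _ = Real.exp b * Real.exp (g x) * ((s / t * g x - b) + 1) := by ring
        _ ≤ _ := by gcongr; exact Real.add_one_le_exp _
    have h2 := integral_mono (((iI.add (iJ.const_mul (s / t))).sub (iI.const_mul b)).const_mul
      (Real.exp b)) iX h1
    refine le_trans (le_of_eq ?_) h2
    rw [integral_const_mul]
    have e2 : ∫ x, ((fun x => Real.exp (g x)) + fun x => s / t * (g x * Real.exp (g x))) x
        - b * Real.exp (g x) ∂M = I + s / t * J - b * I := by
      rw [integral_sub (iI.add (iJ.const_mul (s / t))) (iI.const_mul b)]
      simp only [Pi.add_apply]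
      rw [integral_add iI (iJ.const_mul (s / t)), integral_const_mul, integral_const_mul]
    have e3 := e2
    simp only [Pi.add_apply] at e3
    simp only [Pi.add_apply, Pi.sub_apply]
    rw [e3, hb]
    field_simp
    ring
  have hYup : Y ≤ I + s / m * D := by
    have h1 : ∀ x, Real.exp (g x + c * ‖fderiv ℝ g x‖ ^ 2)
        ≤ Real.exp (g x) + s / m * (‖fderiv ℝ g x‖ ^ 2 * Real.exp (g x)) := by
      intro x
      set q := c * ‖fderiv ℝ g x‖ ^ 2 with hq
      have hq0 : 0 ≤ q := by positivity
      have hq1 : q ≤ 1 / 4 := hcb x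
      -- `exp q ≤ 1 / (1 - q) ≤ 1 + 4 q / 3` on `[0, 1/4]`
      have h2 : Real.exp q ≤ 1 + 4 / 3 * q := by
        have h3 : Real.exp q ≤ 1 / (1 - q) := Real.exp_bound_div_one_sub_of_interval hq0 (by linarith)
        refine h3.trans ?_
        rw [div_le_iff₀ (by linarith)]
        nlinarith
      rw [Real.exp_add]
      calc Real.exp (g x) * Real.exp q ≤ Real.exp (g x) * (1 + 4 / 3 * q) := by gcongr
        _ = _ := by rw [hq, hc]; field_simp
    refine (integral_mono iY (iI.add (iD.const_mul _)) h1).trans_eq ?_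
    simp only [Pi.add_apply]
    rw [integral_add iI (iD.const_mul _), integral_const_mul]
  have hlow : Real.exp (s * (J / I - Real.log (I / Z))) * I ≤ X ^ t * Z ^ s := by
    have h1 : (I * Real.exp (s / t * (J / I))) ^ t ≤ X ^ t :=
      Real.rpow_le_rpow (by positivity) hXlow ht.le
    refine le_trans (le_of_eq ?_) (mul_le_mul_of_nonneg_right h1 (by positivity))
    rw [Real.mul_rpow hI.le (by positivity), ← Real.exp_mul, Real.rpow_def_of_pos hI,
      Real.rpow_def_of_pos hZ, ← Real.exp_add, ← Real.exp_add]
    conv_lhs => rw [← Real.exp_log hI, ← Real.exp_add, Real.exp_log hI]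
    congr 1
    rw [Real.log_div hI.ne' hZ.ne', htdef]
    have : (1 : ℝ) - s ≠ 0 := ht.ne'
    field_simp
    ring
  have hfin : Real.exp (s * (J / I - Real.log (I / Z))) * I ≤ I + s / m * D :=
    hlow.trans (hPL.trans hYup)
  have h7 := Real.add_one_le_exp (s * (J / I - Real.log (I / Z)))
  have h8 : (s * (J / I - Real.log (I / Z)) + 1) * I ≤ I + s / m * D :=
    (mul_le_mul_of_nonneg_right h7 hI.le).trans hfin
  have h9 : s * (J - I * Real.log (I / Z)) ≤ s * (1 / m * D) := by
    have e : (s * (J / I - Real.log (I / Z)) + 1) * I = s * (J - I * Real.log (I / Z)) + I := by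
      field_simp
    rw [e] at h8
    calc s * (J - I * Real.log (I / Z)) ≤ s / m * D := by linarith
      _ = _ := by ring
  exact le_of_mul_le_mul_left h9 hs

end SmoothLogSobolev

section SmoothLogSobolev

open Set

lemma gibbs_le_smul_gibbs {Φ Ψ : Eucl d → ℝ} {b : ℝ} (hΦ : Measurable Φ)
    (h : ∀ x, Φ x - Ψ x ≤ b) :
    gibbs Ψ ≤ ENNReal.ofReal (Real.exp b) • gibbs Φ := by
  rw [gibbs, gibbs, ← withDensity_smul _ (by fun_prop)]
  refine withDensity_mono (.of_forall fun x => ?_)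
  rw [Pi.smul_apply, smul_eq_mul, ← ENNReal.ofReal_mul (Real.exp_pos _).le, ← Real.exp_add]
  exact ENNReal.ofReal_le_ofReal (Real.exp_le_exp.2 (by linarith [h x]))

lemma mul_klFun_div {y a : ℝ} (ha : 0 < a) :
    a * klFun (y / a) = y * Real.log (y / a) - y + a := by
  rw [klFun_apply]; field_simp; ring

/-- Log-Sobolev inequality, for smooth densities that are constant outside a compact set, under a
measure `gibbs Φ` whose potential is a bounded perturbation of a strongly convex one. -/
lemma lintegral_klFun_le_of_smooth {Φ φ : Eucl d → ℝ} {m b : ℝ} (hm : 0 < m) (hΦ : Measurable Φ)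
    (hφ : ∀ x, |φ x| ≤ b) (h : StrongConvexOn univ m (fun x => Φ x + φ x))
    [IsProbabilityMeasure (gibbs Φ)] {f : Eucl d → ℝ} (hf : ContDiff ℝ 2 f)
    (hfs : HasCompactSupport f) (hf0 : ∀ x, 0 ≤ f x) {δ : ℝ} (hδ : 0 < δ) :
    ∫⁻ x, ENNReal.ofReal (klFun ((f x + δ) / ∫ y, (f y + δ) ∂gibbs Φ)) ∂gibbs Φ ≤
      ENNReal.ofReal (Real.exp (2 * b) / m / ∫ y, (f y + δ) ∂gibbs Φ) *
        ∫⁻ x, ENNReal.ofReal (‖fderiv ℝ f x‖ ^ 2 / (f x + δ)) ∂gibbs Φ := by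
  set Ψ : Eucl d → ℝ := fun x => Φ x + φ x
  set μ := gibbs Φ with hμ
  set M := gibbs Ψ with hM
  have hΨc : Continuous Ψ := continuous_of_strongConvexOn h
  have hle1 : M ≤ ENNReal.ofReal (Real.exp b) • μ :=
    gibbs_le_smul_gibbs hΦ fun x => by simp only [Ψ]; linarith [(abs_le.1 (hφ x)).1]
  have hle2 : μ ≤ ENNReal.ofReal (Real.exp b) • M :=
    gibbs_le_smul_gibbs hΨc.measurable fun x => by simp only [Ψ]; linarith [(abs_le.1 (hφ x)).2]
  have hfin1 : IsFiniteMeasure (ENNReal.ofReal (Real.exp b) • μ) :=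
    Measure.smul_finite _ ENNReal.ofReal_ne_top
  have hMfin : IsFiniteMeasure M := isFiniteMeasure_of_le _ hle1
  have hMne : NeZero M := by
    refine ⟨fun h0 => ?_⟩
    rw [h0, smul_zero] at hle2
    exact IsProbabilityMeasure.ne_zero μ (le_antisymm hle2 (Measure.zero_le _))
  have hZ : 0 < M.real univ := by
    rw [measureReal_def]; exact ENNReal.toReal_pos (by simpa using hMne.out) (measure_ne_top _ _)
  -- comparison of integrals of nonnegative functions
  have hcmp1 : ∀ k : Eucl d → ℝ, Integrable k μ → (∀ x, 0 ≤ k x) →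
      ∫ x, k x ∂M ≤ Real.exp b * ∫ x, k x ∂μ := by
    intro k hk hk0
    refine (integral_mono_measure hle1 (.of_forall hk0)
      (hk.smul_measure ENNReal.ofReal_ne_top)).trans_eq ?_
    rw [integral_smul_measure, ENNReal.toReal_ofReal (Real.exp_pos _).le, smul_eq_mul]
  have hcmp2 : ∀ k : Eucl d → ℝ, Integrable k M → (∀ x, 0 ≤ k x) →
      ∫ x, k x ∂μ ≤ Real.exp b * ∫ x, k x ∂M := by
    intro k hk hk0
    refine (integral_mono_measure hle2 (.of_forall hk0)
      (hk.smul_measure ENNReal.ofReal_ne_top)).trans_eq ?_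
    rw [integral_smul_measure, ENNReal.toReal_ofReal (Real.exp_pos _).le, smul_eq_mul]
  set F : Eucl d → ℝ := fun x => f x + δ
  have hFc : ContDiff ℝ 2 F := hf.add contDiff_const
  have hF0 : ∀ x, 0 < F x := fun x => add_pos_of_nonneg_of_pos (hf0 x) hδ
  have hFcont : Continuous F := hFc.continuous
  have hFd : fderiv ℝ F = fderiv ℝ f := by ext1 x; exact fderiv_add_const δ
  -- the logarithm, normalised to have compact support
  set g : Eucl d → ℝ := fun x => Real.log (F x) with hgdef
  set g₀ : Eucl d → ℝ := fun x => g x - Real.log δ with hg₀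
  have hgc : ContDiff ℝ 2 g := hFc.log fun x => (hF0 x).ne'
  have hg₀c : ContDiff ℝ 2 g₀ := hgc.sub contDiff_const
  have hg₀s : HasCompactSupport g₀ := by
    refine hfs.mono fun x hx => ?_
    contrapose! hx
    simp only [Function.mem_support, not_not] at hx
    simp [g₀, g, F, hx]
  have hgd : fderiv ℝ g = fderiv ℝ g₀ := by ext1 x; exact (fderiv_sub_const _).symm
  have hdg₀ : ContDiff ℝ 1 (fderiv ℝ g₀) := hg₀c.fderiv_right (by norm_num)
  obtain ⟨K, hK⟩ := hdg₀.lipschitzWith_of_hasCompactSupport (hg₀s.fderiv ℝ) one_ne_zero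
  obtain ⟨B, hB⟩ := hg₀c.continuous.bounded_above_of_compact_support hg₀s
  obtain ⟨L, hL⟩ := hdg₀.continuous.bounded_above_of_compact_support (hg₀s.fderiv ℝ)
  have hgB : ∀ x, |g x| ≤ B + |Real.log δ| := fun x => by
    have h1 := hB x
    rw [Real.norm_eq_abs] at h1
    have h2 := abs_add_le (g₀ x) (Real.log δ)
    simp only [hg₀, sub_add_cancel] at h2 h1
    linarith
  have key := entropy_exp_le_of_strongConvexOn hm h hZ (hgc.differentiable two_ne_zero) hgB
    (by rw [hgd]; exact hL) (by rw [hgd]; exact hK)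
  have hexp : ∀ x, Real.exp (g x) = F x := fun x => Real.exp_log (hF0 x)
  simp only [hexp] at key
  have hder : ∀ x, ‖fderiv ℝ g x‖ ^ 2 * F x = ‖fderiv ℝ f x‖ ^ 2 / F x := by
    intro x
    have h1 : fderiv ℝ g x = (F x)⁻¹ • fderiv ℝ f x := by
      rw [← hFd]
      exact (((hFc.differentiable two_ne_zero) x).hasFDerivAt.log (hF0 x).ne').fderiv
    rw [h1, norm_smul, norm_inv, Real.norm_eq_abs, abs_of_pos (hF0 x)]
    have := (hF0 x).ne'
    field_simp
  simp only [hder] at key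
  -- boundedness and integrability of the functions involved
  obtain ⟨C, hC⟩ := hf.continuous.bounded_above_of_compact_support hfs
  have hFle : ∀ x, F x ≤ C + δ := fun x => by
    have := (Real.le_norm_self _).trans (hC x)
    simp only [F]; linarith
  have hbdd : ∀ k : ℝ → ℝ, ContinuousOn k (Icc δ (C + δ)) →
      ∀ (P : Measure (Eucl d)) [IsFiniteMeasure P], Integrable (fun x => k (F x)) P := by
    intro k hk P _
    obtain ⟨c, hc⟩ := isCompact_Icc.exists_bound_of_continuousOn hk
    have hmem : ∀ x, F x ∈ Icc δ (C + δ) := fun x =>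
      ⟨by simp only [F]; linarith [hf0 x], hFle x⟩
    exact Integrable.of_bound
      (hk.comp_continuous hFcont hmem).aestronglyMeasurable c (.of_forall fun x => hc _ (hmem x))
  have hkint : ∀ a : ℝ, ∀ (P : Measure (Eucl d)) [IsFiniteMeasure P],
      Integrable (fun x => a * klFun (F x / a)) P := fun a P _ =>
    hbdd (fun y => a * klFun (y / a)) (by fun_prop) P
  have hFint : ∀ (P : Measure (Eucl d)) [IsFiniteMeasure P], Integrable F P := fun P _ =>
    hbdd (fun y => y) (by fun_prop) P
  have hFlogint : ∀ (P : Measure (Eucl d)) [IsFiniteMeasure P],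
      Integrable (fun x => g x * F x) P := fun P _ =>
    hbdd (fun y => Real.log y * y) (ContinuousOn.mul (Real.continuousOn_log.mono fun y hy =>
      (hδ.trans_le hy.1).ne') continuousOn_id) P
  have hfd : Continuous (fderiv ℝ f) := hf.continuous_fderiv two_ne_zero
  obtain ⟨L', hL'⟩ := hfd.bounded_above_of_compact_support (hfs.fderiv ℝ)
  have hDint : ∀ (P : Measure (Eucl d)) [IsFiniteMeasure P],
      Integrable (fun x => ‖fderiv ℝ f x‖ ^ 2 / F x) P := fun P _ => by
    refine integrable_exp_mul_of_bounded (Continuous.div (by fun_prop) hFcont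
      fun x => (hF0 x).ne') (C := L' ^ 2 / δ) fun x => ?_
    have := hF0 x
    rw [abs_of_nonneg (by positivity)]
    gcongr
    · exact hL' x
    · simp only [F]; linarith [hf0 x]
  have hent : ∀ (P : Measure (Eucl d)) [IsFiniteMeasure P] (a : ℝ), 0 < a →
      ∫ x, a * klFun (F x / a) ∂P =
        ∫ x, g x * F x ∂P - (∫ x, F x ∂P) * Real.log a - ∫ x, F x ∂P + a * P.real univ := by
    intro P _ a ha
    have e : ∀ x, a * klFun (F x / a) = g x * F x - Real.log a * F x - F x + a := by
      intro x
      rw [mul_klFun_div ha, Real.log_div (hF0 x).ne' ha.ne']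
      simp only [g]; ring
    have i1 := hFlogint P
    have i2 := (hFint P).const_mul (Real.log a)
    have i3 := hFint P
    simp only [e]
    rw [integral_add (f := fun x => g x * F x - Real.log a * F x - F x) ((i1.sub i2).sub i3)
      (integrable_const a), integral_sub (f := fun x => g x * F x - Real.log a * F x) (i1.sub i2) i3,
      integral_sub i1 i2, integral_const_mul, integral_const, smul_eq_mul]
    ring
  have hpos : ∀ (P : Measure (Eucl d)) [IsFiniteMeasure P] [NeZero P], 0 < ∫ x, F x ∂P := by
    intro P _ _
    have := integral_exp_pos (μ := P) (f := g) (by simpa only [hexp] using hFint P)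
    simpa only [hexp] using this
  set I := ∫ y, F y ∂μ with hI
  have hI0 : 0 < I := hpos μ
  set a := (∫ x, F x ∂M) / M.real univ with ha
  have ha0 : 0 < a := div_pos (hpos M) hZ
  -- Holley–Stroock: `∫ a klFun (F / a) ∂μ` is minimal at the mean `a = I` of `F`, and its integrand is
  -- nonnegative for every `a`, so that `μ` may be replaced by `M` at the price of a factor
  have s1 : ∫ x, I * klFun (F x / I) ∂μ ≤ ∫ x, a * klFun (F x / a) ∂μ := by
    have h1 := hent μ I hI0
    have h2 := hent μ a ha0
    have h3 : 0 ≤ a * klFun (I / a) :=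
      mul_nonneg ha0.le (klFun_nonneg (div_nonneg hI0.le ha0.le))
    rw [mul_klFun_div ha0, Real.log_div hI0.ne' ha0.ne'] at h3
    rw [h1, h2]
    simp only [probReal_univ, mul_one, ← hI]
    linarith
  have hk0 : ∀ x, 0 ≤ a * klFun (F x / a) := fun x =>
    mul_nonneg ha0.le (klFun_nonneg (div_nonneg (hF0 x).le ha0.le))
  have hd0 : ∀ x, 0 ≤ ‖fderiv ℝ f x‖ ^ 2 / F x := fun x => by have := hF0 x; positivity
  have s3 : ∫ x, a * klFun (F x / a) ∂M ≤ 1 / m * ∫ x, ‖fderiv ℝ f x‖ ^ 2 / F x ∂M := by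
    rw [hent M a ha0]
    have : a * M.real univ = ∫ x, F x ∂M := by rw [ha]; field_simp
    rw [this]; linarith
  have s5 : ∫ x, I * klFun (F x / I) ∂μ
      ≤ Real.exp (2 * b) / m * ∫ x, ‖fderiv ℝ f x‖ ^ 2 / F x ∂μ := by
    calc _ ≤ ∫ x, a * klFun (F x / a) ∂μ := s1
      _ ≤ Real.exp b * ∫ x, a * klFun (F x / a) ∂M := hcmp2 _ (hkint a M) hk0
      _ ≤ Real.exp b * (1 / m * (Real.exp b * ∫ x, ‖fderiv ℝ f x‖ ^ 2 / F x ∂μ)) := by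
          gcongr
          refine s3.trans ?_
          gcongr
          exact hcmp1 _ (hDint μ) hd0
      _ = _ := by rw [two_mul, Real.exp_add]; ring
  rw [integral_const_mul] at s5
  have i1 : Integrable (fun x => klFun (F x / I)) μ :=
    hbdd (fun y => klFun (y / I)) (by fun_prop) μ
  rw [← ofReal_integral_eq_lintegral_ofReal i1
      (.of_forall fun x => klFun_nonneg (div_nonneg (hF0 x).le hI0.le)),
    ← ofReal_integral_eq_lintegral_ofReal (hDint μ) (.of_forall hd0),
    ← ENNReal.ofReal_mul (by positivity)]
  refine ENNReal.ofReal_le_ofReal ?_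
  rw [div_mul_eq_mul_div, le_div_iff₀ hI0]
  linarith

end SmoothLogSobolev

/-! ### Mollification and weak gradients -/

section Mollification

open Set Filter Topology Convolution

/-- The smooth bump function behind the `n`-th mollifier, supported in the ball of radius
`1 / (n + 1)`. -/
def mollBump (d n : ℕ) : ContDiffBump (0 : Eucl d) where
  rIn := 1 / (n + 1) / 2
  rOut := 1 / (n + 1)
  rIn_pos := by positivity
  rIn_lt_rOut := half_lt_self (by positivity)

/-- The `n`-th mollifier: a smooth probability density supported in the ball of radius
`1 / (n + 1)`. -/
def moll (n : ℕ) : Eucl d → ℝ := (mollBump d n).normed volume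

lemma hasCompactSupport_of_eq_zero {F : Type*} [NormedAddCommGroup F] {g : Eucl d → F} {R : ℝ}
    (hg : ∀ x, R ≤ ‖x‖ → g x = 0) : HasCompactSupport g :=
  HasCompactSupport.intro (isCompact_closedBall 0 R) fun x hx => hg x (by
    rw [Metric.mem_closedBall, dist_zero_right, not_le] at hx; exact hx.le)

variable {F : Type*} [NormedAddCommGroup F] [NormedSpace ℝ F]

/-- The `n`-th mollification of `g`. -/
def mollify (n : ℕ) (g : Eucl d → F) : Eucl d → F :=
  moll n ⋆[ContinuousLinearMap.lsmul ℝ ℝ, volume] g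

lemma moll_nonneg (n : ℕ) (x : Eucl d) : 0 ≤ moll n x := (mollBump d n).nonneg_normed x

lemma contDiff_moll (n : ℕ) : ContDiff ℝ ∞ (moll (d := d) n) := (mollBump d n).contDiff_normed

lemma hasCompactSupport_moll (n : ℕ) : HasCompactSupport (moll (d := d) n) :=
  (mollBump d n).hasCompactSupport_normed

lemma integral_moll (n : ℕ) : ∫ x : Eucl d, moll n x = 1 := (mollBump d n).integral_normed

lemma integrable_moll (n : ℕ) : Integrable (moll (d := d) n) := (mollBump d n).integrable_normed

lemma moll_eq_zero {n : ℕ} {x : Eucl d} (h : 1 / ((n : ℝ) + 1) ≤ ‖x‖) : moll n x = 0 := by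
  rw [← Function.notMem_support, moll, (mollBump d n).support_normed_eq]
  simpa [mollBump] using h

lemma moll_sub_comm (n : ℕ) (x y : Eucl d) : moll n (x - y) = moll n (y - x) := by
  rw [moll, ← (mollBump d n).normed_neg (x - y), neg_sub]

lemma lintegral_moll (n : ℕ) : ∫⁻ x : Eucl d, ENNReal.ofReal (moll n x) = 1 := by
  rw [← ofReal_integral_eq_lintegral_ofReal (integrable_moll n) (.of_forall (moll_nonneg n)),
    integral_moll, ENNReal.ofReal_one]

lemma mollify_eq (n : ℕ) (g : Eucl d → F) (x : Eucl d) :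
    mollify n g x = ∫ y, moll n (x - y) • g y := convolution_lsmul_swap

lemma continuous_moll (n : ℕ) : Continuous (moll (d := d) n) := (contDiff_moll n).continuous

lemma integrable_moll_smul {g : Eucl d → F} (hg : LocallyIntegrable g) (n : ℕ) (x : Eucl d) :
    Integrable fun y => moll n (x - y) • g y := by
  refine hg.integrable_smul_left_of_hasCompactSupport
    ((continuous_moll n).comp (continuous_const.sub continuous_id)) ?_
  exact (hasCompactSupport_moll n).comp_homeomorph (Homeomorph.subLeft x)

lemma contDiff_mollify {g : Eucl d → F} (hg : LocallyIntegrable g) (n : ℕ) :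
    ContDiff ℝ ∞ (mollify n g) :=
  (hasCompactSupport_moll n).contDiff_convolution_left _ (contDiff_moll n) hg

lemma tendsto_mollify [CompleteSpace F] {g : Eucl d → F} (hg : LocallyIntegrable g) :
    ∀ᵐ x, Tendsto (fun n => mollify n g x) atTop (𝓝 (g x)) := by
  refine ContDiffBump.ae_convolution_tendsto_right_of_locallyIntegrable (K := 2)
    (φ := fun n => mollBump d n) ?_ (.of_forall fun n => ?_) hg
  · exact tendsto_one_div_add_atTop_nhds_zero_nat
  · simp only [mollBump]; linarith

lemma norm_mollify_le (g : Eucl d → F) (n : ℕ) (x : Eucl d) :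
    ‖mollify n g x‖ ≤ mollify n (fun y => ‖g y‖) x := by
  rw [mollify_eq, mollify_eq]
  refine (norm_integral_le_integral_norm _).trans_eq ?_
  congr 1; ext y
  rw [norm_smul, Real.norm_eq_abs, abs_of_nonneg (moll_nonneg _ _), smul_eq_mul]

lemma mollify_nonneg {f : Eucl d → ℝ} (hf : ∀ x, 0 ≤ f x) (n : ℕ) (x : Eucl d) :
    0 ≤ mollify n f x := by
  rw [mollify_eq]
  exact integral_nonneg fun y => mul_nonneg (moll_nonneg _ _) (hf y)

lemma integral_mollify {f : Eucl d → ℝ} (hf : Integrable f) (n : ℕ) :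
    ∫ x, mollify n f x = ∫ x, f x := by
  have := integral_convolution (ContinuousLinearMap.lsmul ℝ ℝ) (integrable_moll n) hf
  rw [mollify, this, integral_moll]; simp

lemma integrable_mollify {g : Eucl d → F} (hf : Integrable g) (n : ℕ) :
    Integrable (mollify n g) := (integrable_moll n).integrable_convolution _ hf

lemma mollify_eq_zero {g : Eucl d → F} {R : ℝ} (hg : ∀ x, R ≤ ‖x‖ → g x = 0) (n : ℕ) {x : Eucl d}
    (hx : R + 1 ≤ ‖x‖) : mollify n g x = 0 := by
  rw [mollify_eq, integral_eq_zero_of_ae]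
  refine .of_forall fun y => ?_
  by_cases hy : R ≤ ‖y‖
  · simp [hg y hy]
  · have h1 : 1 / ((n : ℝ) + 1) ≤ ‖x - y‖ := by
      have h2 : 1 / ((n : ℝ) + 1) ≤ 1 := by
        rw [div_le_one (by positivity)]; linarith [Nat.cast_nonneg (α := ℝ) n]
      linarith [norm_sub_norm_le x y]
    simp [moll_eq_zero h1]

/-- The gradient of a mollification is the mollified weak gradient. -/
lemma fderiv_mollify {f : Eucl d → ℝ} {G : Eucl d → Eucl d} (h : HasWeakGradient f G) (n : ℕ)
    (x : Eucl d) : fderiv ℝ (mollify n f) x = innerSL ℝ (mollify n G x) := by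
  obtain ⟨hf, hG, hw⟩ := h
  have hd := (hasCompactSupport_moll n).hasFDerivAt_convolution_left
    (ContinuousLinearMap.lsmul ℝ ℝ) ((contDiff_moll n).of_le (by exact_mod_cast le_top)) hf x
  rw [mollify, hd.fderiv]
  -- the test function `y ↦ moll n (x - y)`
  set φ : Eucl d → ℝ := fun y => moll n (x - y)
  have hφ : ContDiff ℝ ∞ φ := (contDiff_moll n).comp (contDiff_const.sub contDiff_id)
  have hφs : HasCompactSupport φ := (hasCompactSupport_moll n).comp_homeomorph (Homeomorph.subLeft x)
  have hφd : ∀ y v, inner ℝ (gradient φ y) v = -fderiv ℝ (moll n) (x - y) v := by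
    intro y v
    have h1 : HasFDerivAt φ (-(fderiv ℝ (moll n) (x - y))) y := by
      have h2 := ((contDiff_moll (d := d) n).differentiable (by simp) (x - y)).hasFDerivAt
      have h3 : HasFDerivAt (fun y : Eucl d => x - y) (-ContinuousLinearMap.id ℝ (Eucl d)) y :=
        (hasFDerivAt_id y).const_sub x
      exact (h2.comp y h3).congr_fderiv (by ext v; simp)
    rw [gradient, InnerProductSpace.toDual_symm_apply, h1.fderiv]; simp
  have hw' := hw φ hφ hφs
  have hφc : Continuous (gradient φ) :=
    (InnerProductSpace.toDual ℝ (Eucl d)).symm.continuous.comp (hφ.continuous_fderiv (by simp))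
  have hφgs : HasCompactSupport (gradient φ) :=
    (hφs.fderiv ℝ).comp_left (g := (InnerProductSpace.toDual ℝ (Eucl d)).symm) (map_zero _)
  have i1 : Integrable fun y => f y • gradient φ y :=
    hf.integrable_smul_right_of_hasCompactSupport hφc hφgs
  have i2 : Integrable fun y => φ y • G y :=
    hG.integrable_smul_left_of_hasCompactSupport hφ.continuous hφs
  have hcs : HasCompactSupport (fderiv ℝ (moll (d := d) n)) := (hasCompactSupport_moll n).fderiv ℝ
  have hdc : Continuous (fderiv ℝ (moll (d := d) n)) := (contDiff_moll n).continuous_fderiv (by simp)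
  ext v
  rw [convolution_eq_swap, ContinuousLinearMap.integral_apply]
  · have e1 : ∀ y, ((ContinuousLinearMap.lsmul ℝ ℝ).precompL (Eucl d)
        (fderiv ℝ (moll n) (x - y)) (f y)) v = -inner ℝ v (f y • gradient φ y) := by
      intro y
      rw [inner_smul_right, real_inner_comm, hφd]
      simp [ContinuousLinearMap.precompL_apply]; ring
    simp_rw [e1]
    rw [integral_neg, integral_inner i1, hw', inner_neg_right, neg_neg, innerSL_apply_apply,
      mollify_eq, real_inner_comm]
  · have := hcs.convolutionExists_left
      ((ContinuousLinearMap.lsmul ℝ ℝ : ℝ →L[ℝ] ℝ →L[ℝ] ℝ).precompL (Eucl d)) hdc hf x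
    exact (this.integrable_swap)

/-- Dominated convergence with a convergent sequence of bounds. -/
lemma tendsto_integral_of_bound_tendsto {α : Type*} [MeasurableSpace α] {μ : Measure α}
    [CompleteSpace F]
    {X : ℕ → α → F} {Y : α → F} {N : ℕ → α → ℝ} {M : α → ℝ}
    (hX : ∀ n, AEStronglyMeasurable (X n) μ) (hN : ∀ n, Integrable (N n) μ) (hM : Integrable M μ)
    (hbd : ∀ n x, ‖X n x‖ ≤ N n x) (hlim : ∀ᵐ x ∂μ, Tendsto (fun n => X n x) atTop (𝓝 (Y x)))
    (hNlim : ∀ᵐ x ∂μ, Tendsto (fun n => N n x) atTop (𝓝 (M x)))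
    (hint : Tendsto (fun n => ∫ x, N n x ∂μ) atTop (𝓝 (∫ x, M x ∂μ))) :
    Tendsto (fun n => ∫ x, X n x ∂μ) atTop (𝓝 (∫ x, Y x ∂μ)) := by
  have hYm : AEStronglyMeasurable Y μ := aestronglyMeasurable_of_tendsto_ae atTop hX hlim
  have hN0 : ∀ n x, 0 ≤ N n x := fun n x => (norm_nonneg _).trans (hbd n x)
  have hYle : ∀ᵐ x ∂μ, ‖Y x‖ ≤ M x := by
    filter_upwards [hlim, hNlim] with x h1 h2
    exact le_of_tendsto_of_tendsto' h1.norm h2 fun n => hbd n x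
  have hXi : ∀ n, Integrable (X n) μ := fun n => (hN n).mono' (hX n) (.of_forall (hbd n))
  have hYi : Integrable Y μ := hM.mono' hYm hYle
  have hM0 : ∀ᵐ x ∂μ, 0 ≤ M x := by
    filter_upwards [hYle] with x h using (norm_nonneg _).trans h
  have t1 : Tendsto (fun n => ∫ x, max (M x - N n x) 0 ∂μ) atTop (𝓝 (∫ _, (0 : ℝ) ∂μ)) := by
    refine tendsto_integral_of_dominated_convergence M
      (fun n => ((hM.sub (hN n)).aestronglyMeasurable.sup aestronglyMeasurable_const)) hM
      (fun n => ?_) ?_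
    · filter_upwards [hM0] with x h
      rw [Real.norm_eq_abs, abs_of_nonneg (le_max_right _ _)]
      exact max_le (by linarith [hN0 n x]) h
    · filter_upwards [hNlim] with x h
      have := (tendsto_const_nhds (x := M x)).sub h |>.max (tendsto_const_nhds (x := (0 : ℝ)))
      simpa using this
  have t2 : Tendsto (fun n => ∫ x, min ‖X n x - Y x‖ (2 * M x) ∂μ) atTop
      (𝓝 (∫ _, (0 : ℝ) ∂μ)) := by
    refine tendsto_integral_of_dominated_convergence (fun x => 2 * M x)
      (fun n => ((hX n).sub hYm).norm.inf (hM.const_mul 2).aestronglyMeasurable) (hM.const_mul 2)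
      (fun n => ?_) ?_
    · filter_upwards [hM0] with x h
      rw [Real.norm_eq_abs, abs_of_nonneg (le_min (norm_nonneg _) (by linarith))]
      exact min_le_right _ _
    · filter_upwards [hlim, hM0] with x h h0
      have h1 : Tendsto (fun n => ‖X n x - Y x‖) atTop (𝓝 0) := by
        simpa using (h.sub (tendsto_const_nhds (x := Y x))).norm
      have := h1.min (tendsto_const_nhds (x := 2 * M x))
      rwa [min_eq_left (by linarith : (0 : ℝ) ≤ 2 * M x)] at this
  have t3 := (hint.sub (tendsto_const_nhds (x := ∫ x, M x ∂μ))).add ((t1.const_mul 2).add t2)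
  simp only [integral_zero, sub_self, mul_zero, add_zero] at t3
  rw [tendsto_iff_norm_sub_tendsto_zero]
  refine squeeze_zero (fun n => norm_nonneg _) (fun n => ?_) t3
  have i1 : Integrable (fun x => max (M x - N n x) 0) μ := (hM.sub (hN n)).sup (integrable_zero _ _ _)
  have i2 : Integrable (fun x => min ‖X n x - Y x‖ (2 * M x)) μ :=
    ((hXi n).sub hYi).norm.inf (hM.const_mul 2)
  have i3 : Integrable (fun x => N n x - M x) μ := (hN n).sub hM
  have i4 : Integrable (fun x => 2 * max (M x - N n x) 0 + min ‖X n x - Y x‖ (2 * M x)) μ :=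
    (i1.const_mul 2).add i2
  rw [← integral_sub (hXi n) hYi]
  refine (norm_integral_le_integral_norm _).trans ?_
  rw [← integral_sub (hN n) hM, ← integral_const_mul, ← integral_add (i1.const_mul 2) i2,
    ← integral_add i3 i4]
  refine integral_mono_ae ((hXi n).sub hYi).norm (i3.add i4) ?_
  filter_upwards [hYle] with x h
  have h1 : ‖X n x - Y x‖ ≤ N n x + M x := (norm_sub_le _ _).trans (add_le_add (hbd n x) h)
  rcases min_cases ‖X n x - Y x‖ (2 * M x) with h2 | h2 <;>
    rcases max_cases (M x - N n x) 0 with h3 | h3 <;> linarith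

end Mollification

/-! ### Weak gradients -/

section WeakGradient

open Set Filter Topology Convolution

/-- The truncation `t / (1 + k t)`, bounded by `1 / k`, tests the weak gradient where `f` is small. -/
lemma hasDerivAt_div_one_add_mul {k t : ℝ} (h : 0 < 1 + k * t) :
    HasDerivAt (fun t => t / (1 + k * t)) (1 / (1 + k * t) ^ 2) t := by
  have h1 : HasDerivAt (fun t : ℝ => 1 + k * t) k t := by
    simpa using ((hasDerivAt_id t).const_mul k).const_add 1
  refine ((hasDerivAt_id t).div h1 h.ne').congr_deriv ?_
  simp; ring

lemma abs_integral_truncated_gradient_le {f : Eucl d → ℝ} (hf : ContDiff ℝ 1 f)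
    (hf0 : ∀ x, 0 ≤ f x) {φ : Eucl d → ℝ} (hφ : ContDiff ℝ ∞ φ) (hφs : HasCompactSupport φ)
    (v : Eucl d) {k : ℝ} (hk : 0 < k) :
    |∫ x, φ x * (1 / (1 + k * f x) ^ 2) * fderiv ℝ f x v| ≤ (∫ x, ‖fderiv ℝ φ x‖ * ‖v‖) / k := by
  have hpos : ∀ x, 0 < 1 + k * f x := fun x => by have := hf0 x; positivity
  set w : Eucl d → ℝ := fun x => f x / (1 + k * f x)
  have hwd : ∀ x, HasFDerivAt w ((1 / (1 + k * f x) ^ 2) • fderiv ℝ f x) x := fun x =>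
    (hasDerivAt_div_one_add_mul (hpos x)).comp_hasFDerivAt x
      ((hf.differentiable one_ne_zero) x).hasFDerivAt
  have hfc : Continuous f := hf.continuous
  have hfdc : Continuous (fderiv ℝ f) := hf.continuous_fderiv one_ne_zero
  have hφc : Continuous φ := hφ.continuous
  have hφdc : Continuous (fderiv ℝ φ) := hφ.continuous_fderiv (by simp)
  have hφds : HasCompactSupport (fun x => fderiv ℝ φ x v) :=
    (hφs.fderiv ℝ).comp_left (g := fun L : Eucl d →L[ℝ] ℝ => L v) (by simp)
  have hwc : Continuous w := hfc.div (by fun_prop) fun x => (hpos x).ne'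
  have hqc : Continuous fun x => 1 / (1 + k * f x) ^ 2 :=
    continuous_const.div (by fun_prop) fun x => (pow_pos (hpos x) 2).ne'
  have e1 : ∀ x, fderiv ℝ w x v = 1 / (1 + k * f x) ^ 2 * fderiv ℝ f x v := fun x => by
    rw [(hwd x).fderiv]; rfl
  have h := integral_mul_fderiv_eq_neg_fderiv_mul_of_integrable (μ := volume) (f := w) (g := φ)
    (v := v) (by
      simp only [e1]
      exact Continuous.integrable_of_hasCompactSupport (by fun_prop) hφs.mul_left)
    (Continuous.integrable_of_hasCompactSupport (by fun_prop) hφds.mul_left)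
    (Continuous.integrable_of_hasCompactSupport (by fun_prop) hφs.mul_left)
    (fun x _ => (hwd x).differentiableAt) (fun x _ => (hφ.differentiable (by simp)) x)
  have e2 : ∫ x, φ x * (1 / (1 + k * f x) ^ 2) * fderiv ℝ f x v = -∫ x, w x * fderiv ℝ φ x v := by
    rw [h, neg_neg]
    congr 1; ext x; rw [e1]; ring
  rw [e2, abs_neg, ← integral_div]
  refine (norm_integral_le_integral_norm _).trans (integral_mono_of_nonneg
    (Eventually.of_forall fun x => norm_nonneg (w x * fderiv ℝ φ x v)) ?_ (.of_forall fun x => ?_))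
  · have : HasCompactSupport fun x => ‖fderiv ℝ φ x‖ * ‖v‖ / k :=
      (hφs.fderiv ℝ).comp_left (g := fun L => ‖L‖ * ‖v‖ / k) (by simp)
    exact Continuous.integrable_of_hasCompactSupport (by fun_prop) this
  · simp only [norm_mul]
    have h1 : ‖w x‖ ≤ 1 / k := by
      have := hpos x
      have h0 := hf0 x
      rw [Real.norm_eq_abs, abs_of_nonneg (by positivity), div_le_div_iff₀ this hk]
      nlinarith
    calc ‖w x‖ * ‖fderiv ℝ φ x v‖ ≤ 1 / k * (‖fderiv ℝ φ x‖ * ‖v‖) := by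
          gcongr; exact ContinuousLinearMap.le_opNorm _ _
      _ = _ := by ring

/-- The weak gradient of a nonnegative function vanishes almost everywhere on its zero set. -/
lemma ae_gradient_eq_zero_of_eq_zero {f : Eucl d → ℝ} {G : Eucl d → Eucl d}
    (h : HasWeakGradient f G) (hf0 : ∀ x, 0 ≤ f x) (hG : Integrable G) :
    ∀ᵐ x, f x = 0 → G x = 0 := by
  have hfl := h.1
  have hGl := h.2.1
  set Y : Eucl d → Eucl d := fun x => if f x = 0 then G x else 0 with hY
  -- pointwise limit of the truncations
  have hlimk : ∀ x, Tendsto (fun k : ℕ => (1 / (1 + ((k : ℝ) + 1) * f x) ^ 2) • G x) atTop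
      (𝓝 (Y x)) := by
    intro x
    by_cases hx : f x = 0
    · simp [hY, hx]
    · simp only [hY, if_neg hx]
      have hx' : 0 < f x := lt_of_le_of_ne (hf0 x) (Ne.symm hx)
      have h1 : Tendsto (fun k : ℕ => ((k : ℝ) + 1)) atTop atTop :=
        tendsto_atTop_add_const_right _ _ tendsto_natCast_atTop_atTop
      have h2 : Tendsto (fun k : ℕ => 1 / (1 + ((k : ℝ) + 1) * f x) ^ 2) atTop (𝓝 0) := by
        simp only [one_div]
        refine Tendsto.inv_tendsto_atTop ?_
        exact (tendsto_pow_atTop two_ne_zero).comp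
          (tendsto_atTop_add_const_left _ 1 (h1.atTop_mul_const hx'))
      simpa using h2.smul_const (G x)
  have hq1 : ∀ (k : ℕ) (t : ℝ), 0 ≤ t → |1 / (1 + ((k : ℝ) + 1) * t) ^ 2| ≤ 1 := by
    intro k t ht
    rw [abs_of_nonneg (by positivity), div_le_one (by positivity)]
    exact one_le_pow₀ (by nlinarith [Nat.cast_nonneg (α := ℝ) k])
  have hfm : AEStronglyMeasurable f := hfl.aestronglyMeasurable
  have hqm : ∀ k : ℕ, AEStronglyMeasurable (fun x => 1 / (1 + ((k : ℝ) + 1) * f x) ^ 2) := by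
    intro k
    have := hfm.aemeasurable
    exact AEMeasurable.aestronglyMeasurable (by fun_prop)
  have hYm : AEStronglyMeasurable Y := aestronglyMeasurable_of_tendsto_ae atTop
    (fun k => (hqm k).smul hG.aestronglyMeasurable) (.of_forall hlimk)
  have hYle : ∀ x, ‖Y x‖ ≤ ‖G x‖ := fun x => by
    simp only [hY]; split_ifs <;> simp
  have hYi : Integrable Y := hG.mono hYm (.of_forall hYle)
  have hY0 : ∀ᵐ x, Y x = 0 := by
    refine ae_eq_zero_of_integral_contDiff_smul_eq_zero hYi.locallyIntegrable fun φ hφ hφs => ?_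
    obtain ⟨C, hC⟩ := hφ.continuous.bounded_above_of_compact_support hφs
    have hC0 : 0 ≤ C := (norm_nonneg _).trans (hC 0)
    -- removal of the mollification
    have hn : ∀ k : ℕ, Tendsto (fun n => ∫ x, (φ x * (1 / (1 + ((k : ℝ) + 1) * mollify n f x) ^ 2)) •
        mollify n G x) atTop (𝓝 (∫ x, (φ x * (1 / (1 + ((k : ℝ) + 1) * f x) ^ 2)) • G x)) := by
      intro k
      refine tendsto_integral_of_bound_tendsto (N := fun n x => C * mollify n (fun y => ‖G y‖) x)
        (M := fun x => C * ‖G x‖) (fun n => ?_) (fun n => (integrable_mollify hG.norm n).const_mul C)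
        (hG.norm.const_mul C) (fun n x => ?_) ?_ ?_ ?_
      · have h1 := (contDiff_mollify hfl n).continuous
        have h2 := (contDiff_mollify hGl n).continuous
        have h3 := hφ.continuous
        have h4 : Continuous fun x => 1 / (1 + ((k : ℝ) + 1) * mollify n f x) ^ 2 :=
          continuous_const.div (by fun_prop) fun x => by
            have := mollify_nonneg hf0 n x
            positivity
        exact (Continuous.aestronglyMeasurable (by fun_prop))
      · rw [norm_smul, norm_mul]
        calc ‖φ x‖ * ‖1 / (1 + ((k : ℝ) + 1) * mollify n f x) ^ 2‖ * ‖mollify n G x‖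
            ≤ C * 1 * mollify n (fun y => ‖G y‖) x := by
              gcongr
              · exact hC x
              · exact hq1 k _ (mollify_nonneg hf0 n x)
              · exact norm_mollify_le G n x
          _ = _ := by ring
      · filter_upwards [tendsto_mollify hfl, tendsto_mollify hGl] with x h1 h2
        refine Tendsto.smul (Tendsto.mul tendsto_const_nhds ?_) h2
        refine Tendsto.div tendsto_const_nhds ((tendsto_const_nhds.add (h1.const_mul _)).pow 2) ?_
        have := hf0 x
        positivity
      · filter_upwards [tendsto_mollify (hG.norm).locallyIntegrable] with x h1
        exact h1.const_mul C
      · simp only [integral_const_mul, integral_mollify hG.norm]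
        exact tendsto_const_nhds
    have hk : Tendsto (fun k : ℕ => ∫ x, (φ x * (1 / (1 + ((k : ℝ) + 1) * f x) ^ 2)) • G x) atTop
        (𝓝 (∫ x, φ x • Y x)) := by
      refine tendsto_integral_of_dominated_convergence (fun x => C * ‖G x‖)
        (fun k => (hφ.continuous.aestronglyMeasurable.mul (hqm k)).smul hG.aestronglyMeasurable)
        (hG.norm.const_mul C) (fun k => .of_forall fun x => ?_) (.of_forall fun x => ?_)
      · rw [norm_smul, norm_mul]
        calc ‖φ x‖ * ‖1 / (1 + ((k : ℝ) + 1) * f x) ^ 2‖ * ‖G x‖ ≤ C * 1 * ‖G x‖ := by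
              gcongr
              · exact hC x
              · exact hq1 k _ (hf0 x)
          _ = _ := by ring
      · simp only [mul_smul]
        exact (hlimk x).const_smul (φ x)
    refine ext_inner_right ℝ fun v => ?_
    rw [inner_zero_left]
    have hbd : ∀ k : ℕ, |inner ℝ (∫ x, (φ x * (1 / (1 + ((k : ℝ) + 1) * f x) ^ 2)) • G x) v|
        ≤ (∫ x, ‖fderiv ℝ φ x‖ * ‖v‖) / ((k : ℝ) + 1) := by
      intro k
      refine le_of_tendsto' (((hn k).inner tendsto_const_nhds).abs) fun n => ?_
      have hb := abs_integral_truncated_gradient_le ((contDiff_mollify hfl n).of_le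
        (by exact_mod_cast le_top)) (mollify_nonneg hf0 n) hφ hφs v (k := (k : ℝ) + 1) (by positivity)
      have hint : Integrable fun x => (φ x * (1 / (1 + ((k : ℝ) + 1) * mollify n f x) ^ 2)) •
          mollify n G x := by
        have h1 := (contDiff_mollify hfl n).continuous
        have h2 := (contDiff_mollify hGl n).continuous
        have h3 := hφ.continuous
        have h4 : Continuous fun x => 1 / (1 + ((k : ℝ) + 1) * mollify n f x) ^ 2 :=
          continuous_const.div (by fun_prop) fun x => by
            have := mollify_nonneg hf0 n x
            positivity
        exact Continuous.integrable_of_hasCompactSupport (by fun_prop)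
          (hφs.mul_right.smul_right)
      have e : inner ℝ (∫ x, (φ x * (1 / (1 + ((k : ℝ) + 1) * mollify n f x) ^ 2)) •
          mollify n G x) v = ∫ x, φ x * (1 / (1 + ((k : ℝ) + 1) * mollify n f x) ^ 2) *
            fderiv ℝ (mollify n f) x v := by
        rw [real_inner_comm, ← integral_inner hint]
        congr 1; ext x
        rw [inner_smul_right, fderiv_mollify h, innerSL_apply_apply, real_inner_comm]
      rw [e]
      exact hb
    have hlim0 : Tendsto (fun k : ℕ => (∫ x, ‖fderiv ℝ φ x‖ * ‖v‖) / ((k : ℝ) + 1)) atTop (𝓝 0) :=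
      tendsto_const_nhds.div_atTop
        (tendsto_atTop_add_const_right _ _ tendsto_natCast_atTop_atTop)
    have := le_of_tendsto_of_tendsto' ((hk.inner (tendsto_const_nhds (x := v))).abs) hlim0 hbd
    exact abs_nonpos_iff.1 this
  filter_upwards [hY0] with x hx h0
  simpa [hY, h0] using hx

/-- Multiplication by a smooth function preserves weak differentiability. -/
lemma HasWeakGradient.mul_smooth {f : Eucl d → ℝ} {G : Eucl d → Eucl d} (h : HasWeakGradient f G)
    {χ : Eucl d → ℝ} (hχ : ContDiff ℝ ∞ χ) :
    HasWeakGradient (fun x => χ x * f x) (fun x => χ x • G x + f x • gradient χ x) := by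
  obtain ⟨hf, hG, hw⟩ := h
  have hgc : ∀ {φ : Eucl d → ℝ}, ContDiff ℝ ∞ φ → Continuous (gradient φ) := fun hφ =>
    (InnerProductSpace.toDual ℝ (Eucl d)).symm.continuous.comp (hφ.continuous_fderiv (by simp))
  have hχf : LocallyIntegrable (fun x => χ x • f x) := hf.continuous_smul hχ.continuous
  have hχG : LocallyIntegrable (fun x => χ x • G x) := hG.continuous_smul hχ.continuous
  have hfχ : LocallyIntegrable (fun x => f x • gradient χ x) := by
    exact hf.smul_continuous (hgc hχ)
  refine ⟨hχf, hχG.add hfχ, fun φ hφ hφs => ?_⟩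
  have hprod : ∀ x, gradient (fun x => χ x * φ x) x = χ x • gradient φ x + φ x • gradient χ x := by
    intro x
    have h1 : HasFDerivAt (fun x => χ x * φ x) (χ x • fderiv ℝ φ x + φ x • fderiv ℝ χ x) x :=
      (hχ.differentiable (by simp) x).hasFDerivAt.mul (hφ.differentiable (by simp) x).hasFDerivAt
    rw [gradient, h1.fderiv, map_add, map_smul, map_smul]; rfl
  have h0 := hw (fun x => χ x * φ x) (hχ.mul hφ) hφs.mul_left
  have hφgs : HasCompactSupport (gradient φ) := by
    refine (hφs.fderiv ℝ).mono fun x hx h0 => hx ?_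
    rw [gradient, h0, map_zero]
  have hφc := hφ.continuous
  have hχc := hχ.continuous
  have hφg := hgc hφ
  have hχg := hgc hχ
  have c1 : Continuous fun x => χ x • gradient φ x := hχc.smul hφg
  have c2 : Continuous fun x => φ x • gradient χ x := hφc.smul hχg
  have s1 : HasCompactSupport fun x => χ x • gradient φ x :=
    hφgs.mono fun x hx h0 => hx (by simp only [h0, smul_zero])
  have s2 : HasCompactSupport fun x => φ x • gradient χ x :=
    hφs.mono fun x hx h0 => hx (by simp only [h0, zero_smul])
  have i1 := hf.integrable_smul_right_of_hasCompactSupport c1 s1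
  have i2 := hf.integrable_smul_right_of_hasCompactSupport c2 s2
  have i3 : Integrable fun x => φ x • (χ x • G x) :=
    hχG.integrable_smul_left_of_hasCompactSupport hφc hφs
  simp only [hprod, smul_add] at h0
  rw [integral_add i1 i2] at h0
  have e1 : ∀ x, (χ x * f x) • gradient φ x = f x • (χ x • gradient φ x) := fun x => by
    rw [smul_smul, mul_comm]
  have e2 : ∀ x, φ x • (χ x • G x + f x • gradient χ x)
      = φ x • (χ x • G x) + f x • (φ x • gradient χ x) := fun x => by
    rw [smul_add, smul_smul (φ x) (f x), smul_smul (f x) (φ x), mul_comm (φ x)]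
  have e3 : ∀ x, (χ x * φ x) • G x = φ x • (χ x • G x) := fun x => by
    rw [smul_smul, mul_comm]
  simp only [e3] at h0
  simp only [e1, e2]
  rw [integral_add i3 i2, neg_add, ← h0, add_neg_cancel_right]

end WeakGradient

/-! ### Log-Sobolev inequality for weakly differentiable densities -/

section LogSobolevWeak

open Set Filter Topology

/-- Joint convexity of `(v, t) ↦ ‖v‖² / t`, in the form of Jensen's inequality for a
mollification. -/
lemma ofReal_norm_mollify_sq_le {f : Eucl d → ℝ} {G : Eucl d → Eucl d} (hf0 : ∀ x, 0 ≤ f x)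
    (hf : LocallyIntegrable f) (hG : LocallyIntegrable G) (h0 : ∀ᵐ x, f x = 0 → G x = 0)
    (n : ℕ) (x : Eucl d) :
    ENNReal.ofReal (‖mollify n G x‖ ^ 2) ≤ ENNReal.ofReal (mollify n f x) *
      ∫⁻ y, ENNReal.ofReal (moll n (x - y)) * ENNReal.ofReal (‖G y‖ ^ 2 / f y) := by
  have hfm : AEMeasurable f := hf.aestronglyMeasurable.aemeasurable
  have hGm : AEMeasurable (fun y => ‖G y‖) := hG.aestronglyMeasurable.norm.aemeasurable
  have hmm : Measurable fun y => moll n (x - y) :=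
    ((continuous_moll n).comp (continuous_const.sub continuous_id)).measurable
  have e1 : ENNReal.ofReal (mollify n f x) = ∫⁻ y, ENNReal.ofReal (moll n (x - y) * f y) := by
    rw [mollify_eq]
    exact ofReal_integral_eq_lintegral_ofReal (integrable_moll_smul hf n x)
      (.of_forall fun y => mul_nonneg (moll_nonneg _ _) (hf0 y))
  have e2 : ‖mollify n G x‖ₑ ≤ ∫⁻ y, ENNReal.ofReal (moll n (x - y) * ‖G y‖) := by
    rw [mollify_eq]
    refine (enorm_integral_le_lintegral_enorm _).trans_eq (lintegral_congr fun y => ?_)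
    rw [← ofReal_norm, norm_smul, Real.norm_eq_abs, abs_of_nonneg (moll_nonneg _ _)]
  set a : Eucl d → ℝ≥0∞ := fun y => ENNReal.ofReal (moll n (x - y) * f y)
  set c : Eucl d → ℝ≥0∞ := fun y => ENNReal.ofReal (moll n (x - y)) *
    ENNReal.ofReal (‖G y‖ ^ 2 / f y)
  have ham : AEMeasurable a := (hmm.aemeasurable.mul hfm).ennreal_ofReal
  have hcm : AEMeasurable c :=
    hmm.ennreal_ofReal.aemeasurable.mul ((hGm.pow_const 2).div hfm).ennreal_ofReal
  have e3 : ∫⁻ y, ENNReal.ofReal (moll n (x - y) * ‖G y‖)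
      = ∫⁻ y, a y ^ (1 / 2 : ℝ) * c y ^ (1 / 2 : ℝ) := by
    refine lintegral_congr_ae ?_
    filter_upwards [h0] with y hy
    have hm := moll_nonneg n (x - y)
    by_cases hfy : f y = 0
    · simp [a, c, hfy, hy hfy]
    have hfp : 0 < f y := lt_of_le_of_ne (hf0 y) (Ne.symm hfy)
    simp only [a, c]
    rw [← ENNReal.mul_rpow_of_nonneg _ _ (by norm_num), ← ENNReal.ofReal_mul hm,
      ← ENNReal.ofReal_mul (by positivity), ENNReal.ofReal_rpow_of_nonneg (by positivity)
        (by norm_num), ← Real.sqrt_eq_rpow]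
    congr 1
    rw [eq_comm, Real.sqrt_eq_iff_mul_self_eq (by positivity) (by positivity)]
    field_simp
  have e4 := ENNReal.lintegral_mul_norm_pow_le ham hcm (p := 1 / 2) (q := 1 / 2) (by norm_num)
    (by norm_num) (by norm_num)
  have e5 := e2.trans (e3.trans_le e4)
  rw [ENNReal.ofReal_pow (norm_nonneg _), ofReal_norm, e1]
  calc ‖mollify n G x‖ₑ ^ 2
      ≤ ((∫⁻ y, a y) ^ (1 / 2 : ℝ) * (∫⁻ y, c y) ^ (1 / 2 : ℝ)) ^ 2 := by gcongr
    _ = _ := by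
      rw [mul_pow, ← ENNReal.rpow_natCast, ← ENNReal.rpow_natCast, ← ENNReal.rpow_mul,
        ← ENNReal.rpow_mul]
      norm_num

/-- Fatou's lemma with a convergent sequence of upper bounds. -/
lemma lintegral_le_of_ae_tendsto {α : Type*} [MeasurableSpace α] {μ : Measure α}
    {u : ℕ → α → ℝ≥0∞} {v : α → ℝ≥0∞} {b : ℕ → ℝ≥0∞} {c : ℝ≥0∞}
    (hu : ∀ n, AEMeasurable (u n) μ) (huv : ∀ᵐ x ∂μ, Tendsto (fun n => u n x) atTop (𝓝 (v x)))
    (hb : ∀ᶠ n in atTop, ∫⁻ x, u n x ∂μ ≤ b n) (hbc : Tendsto b atTop (𝓝 c)) :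
    ∫⁻ x, v x ∂μ ≤ c := by
  calc ∫⁻ x, v x ∂μ = ∫⁻ x, liminf (fun n => u n x) atTop ∂μ := by
        refine lintegral_congr_ae ?_
        filter_upwards [huv] with x hx using hx.liminf_eq.symm
    _ ≤ liminf (fun n => ∫⁻ x, u n x ∂μ) atTop := lintegral_liminf_le' hu
    _ ≤ liminf b atTop := liminf_le_liminf hb
    _ = c := hbc.liminf_eq

lemma gibbs_absolutelyContinuous (Φ : Eucl d → ℝ) : gibbs Φ ≪ volume :=
  withDensity_absolutelyContinuous _ _

lemma integral_gibbs {Φ : Eucl d → ℝ} (hΦ : Measurable Φ) (g : Eucl d → ℝ) :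
    ∫ x, g x ∂gibbs Φ = ∫ x, Real.exp (-Φ x) * g x := by
  rw [gibbs, integral_withDensity_eq_integral_toReal_smul (by fun_prop)
    (.of_forall fun x => ENNReal.ofReal_lt_top)]
  congr 1; ext x
  rw [ENNReal.toReal_ofReal (Real.exp_pos _).le, smul_eq_mul]

lemma lintegral_gibbs {Φ : Eucl d → ℝ} (hΦ : Measurable Φ) (g : Eucl d → ℝ≥0∞) :
    ∫⁻ x, g x ∂gibbs Φ = ∫⁻ x, ENNReal.ofReal (Real.exp (-Φ x)) * g x := by
  rw [gibbs, lintegral_withDensity_eq_lintegral_mul_non_measurable₀ _ (by fun_prop)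
    (.of_forall fun x => ENNReal.ofReal_lt_top)]
  rfl

lemma lintegral_moll_sub (n : ℕ) (y : Eucl d) :
    ∫⁻ x : Eucl d, ENNReal.ofReal (moll n (y - x)) = 1 := by
  rw [← lintegral_moll (d := d) n]
  exact lintegral_sub_left_eq_self (μ := (volume : Measure (Eucl d)))
    (fun z => ENNReal.ofReal (moll n z)) y

/-- The Fisher information of a mollified density is controlled by that of the density, as the
weight `exp (-Φ)` varies by a factor at most `2` at the mollification scale. -/
lemma lintegral_mollify_fisher_le {Φ : Eucl d → ℝ} (hΦ : Continuous Φ) {f : Eucl d → ℝ}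
    {G : Eucl d → Eucl d} (hf0 : ∀ x, 0 ≤ f x) (hf : LocallyIntegrable f)
    (hG : LocallyIntegrable G) (h0 : ∀ᵐ x, f x = 0 → G x = 0) {R : ℝ}
    (hfR : ∀ x, R ≤ ‖x‖ → f x = 0) {n : ℕ}
    (hosc : ∀ x y, ‖y‖ < R → ‖x - y‖ < 1 / ((n : ℝ) + 1) →
      Real.exp (-Φ x) ≤ 2 * Real.exp (-Φ y)) {δ : ℝ} (hδ : 0 < δ) :
    ∫⁻ x, ENNReal.ofReal (‖mollify n G x‖ ^ 2 / (mollify n f x + δ)) ∂gibbs Φ ≤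
      2 * ∫⁻ x, ENNReal.ofReal (‖G x‖ ^ 2 / f x) ∂gibbs Φ := by
  set w : Eucl d → ℝ≥0∞ := fun y => ENNReal.ofReal (‖G y‖ ^ 2 / f y) with hw
  set ℓ : Eucl d → ℝ≥0∞ := fun x => ENNReal.ofReal (Real.exp (-Φ x)) with hℓ
  have hfm : AEMeasurable f := hf.aestronglyMeasurable.aemeasurable
  have hGm : AEMeasurable (fun y => ‖G y‖) := hG.aestronglyMeasurable.norm.aemeasurable
  have hwm : AEMeasurable w := ((hGm.pow_const 2).div hfm).ennreal_ofReal
  have hℓm : Measurable ℓ := (Real.measurable_exp.comp hΦ.measurable.neg).ennreal_ofReal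
  have hmm : Measurable fun p : Eucl d × Eucl d => ENNReal.ofReal (moll n (p.1 - p.2)) :=
    ENNReal.measurable_ofReal.comp
      ((continuous_moll n).comp (continuous_fst.sub continuous_snd)).measurable
  have step : ∀ x, ENNReal.ofReal (‖mollify n G x‖ ^ 2 / (mollify n f x + δ)) ≤
      ∫⁻ y, ENNReal.ofReal (moll n (x - y)) * w y := by
    intro x
    have hp : 0 < mollify n f x + δ := by
      have := mollify_nonneg hf0 n x
      linarith
    rw [ENNReal.ofReal_div_of_pos hp]
    refine ENNReal.div_le_of_le_mul' ((ofReal_norm_mollify_sq_le hf0 hf hG h0 n x).trans ?_)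
    gcongr
    linarith
  rw [lintegral_gibbs hΦ.measurable, lintegral_gibbs hΦ.measurable]
  calc ∫⁻ x, ℓ x * ENNReal.ofReal (‖mollify n G x‖ ^ 2 / (mollify n f x + δ))
      ≤ ∫⁻ x, ∫⁻ y, ℓ x * (ENNReal.ofReal (moll n (x - y)) * w y) := by
        refine lintegral_mono fun x => ?_
        rw [lintegral_const_mul' _ _ ENNReal.ofReal_ne_top]
        gcongr
        exact step x
    _ = ∫⁻ y, ∫⁻ x, ℓ x * (ENNReal.ofReal (moll n (x - y)) * w y) := by
        have h1 : AEMeasurable (fun p : Eucl d × Eucl d => ℓ p.1) (volume.prod volume) :=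
          (hℓm.comp measurable_fst).aemeasurable
        have h2 : AEMeasurable (fun p : Eucl d × Eucl d => w p.2) (volume.prod volume) :=
          hwm.comp_snd
        exact lintegral_lintegral_swap (h1.mul (hmm.aemeasurable.mul h2))
    _ ≤ ∫⁻ y, ∫⁻ x, ENNReal.ofReal (moll n (y - x)) * (2 * ℓ y * w y) := by
        refine lintegral_mono fun y => lintegral_mono fun x => ?_
        rw [moll_sub_comm n y x]
        by_cases hy : R ≤ ‖y‖
        · simp [hw, hfR y hy]
        by_cases hxy : 1 / ((n : ℝ) + 1) ≤ ‖x - y‖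
        · simp [moll_eq_zero hxy]
        have h1 : ℓ x ≤ 2 * ℓ y := by
          have := ENNReal.ofReal_le_ofReal (hosc x y (not_le.1 hy) (not_le.1 hxy))
          rwa [ENNReal.ofReal_mul zero_le_two, ENNReal.ofReal_ofNat] at this
        calc ℓ x * (ENNReal.ofReal (moll n (x - y)) * w y)
            ≤ 2 * ℓ y * (ENNReal.ofReal (moll n (x - y)) * w y) := by gcongr
          _ = _ := by ring
    _ = ∫⁻ y, 2 * (ℓ y * w y) := by
        refine lintegral_congr fun y => ?_
        have hmy : Measurable fun x => ENNReal.ofReal (moll n (y - x)) :=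
          ((continuous_moll n).comp
            (continuous_const.sub continuous_id)).measurable.ennreal_ofReal
        calc ∫⁻ x, ENNReal.ofReal (moll n (y - x)) * (2 * ℓ y * w y)
            = (∫⁻ x, ENNReal.ofReal (moll n (y - x))) * (2 * ℓ y * w y) :=
              lintegral_mul_const _ hmy
          _ = 2 * (ℓ y * w y) := by rw [lintegral_moll_sub, one_mul, mul_assoc]
    _ = 2 * ∫⁻ y, ℓ y * w y := lintegral_const_mul' 2 (fun y => ℓ y * w y) ENNReal.ofNat_ne_top

lemma exists_forall_exp_le_two_mul {Φ : Eucl d → ℝ} (hΦ : Continuous Φ) (R : ℝ) :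
    ∃ N : ℕ, ∀ n ≥ N, ∀ x y : Eucl d, ‖y‖ < R → ‖x - y‖ < 1 / ((n : ℝ) + 1) →
      Real.exp (-Φ x) ≤ 2 * Real.exp (-Φ y) := by
  have huc := (isCompact_closedBall (0 : Eucl d) (R + 1)).uniformContinuousOn_of_continuous
    hΦ.continuousOn
  obtain ⟨ε, hε, h⟩ := Metric.uniformContinuousOn_iff.1 huc (Real.log 2) (Real.log_pos one_lt_two)
  obtain ⟨N, hN⟩ := exists_nat_one_div_lt hε
  refine ⟨N, fun n hn x y hy hxy => ?_⟩
  have h1 : 1 / ((n : ℝ) + 1) ≤ 1 / ((N : ℝ) + 1) := by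
    gcongr
  have h2 : 1 / ((n : ℝ) + 1) ≤ 1 := by
    rw [div_le_one (by positivity)]; linarith [Nat.cast_nonneg (α := ℝ) n]
  have h3 : ‖x‖ ≤ R + 1 := by linarith [norm_sub_norm_le x y]
  have h4 := h x (by simpa using h3) y (by simp; linarith)
    (by rw [dist_eq_norm]; linarith)
  rw [Real.dist_eq] at h4
  have h5 := (abs_lt.1 h4).1
  calc Real.exp (-Φ x) ≤ Real.exp (Real.log 2 + -Φ y) := Real.exp_le_exp.2 (by linarith)
    _ = 2 * Real.exp (-Φ y) := by rw [Real.exp_add, Real.exp_log two_pos]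

lemma tendsto_integral_mollify {Φ : Eucl d → ℝ} (hΦ : Continuous Φ) {f : Eucl d → ℝ}
    (hf0 : ∀ x, 0 ≤ f x) (hf : Integrable f) {R : ℝ} (hfR : ∀ x, R ≤ ‖x‖ → f x = 0) :
    Tendsto (fun n => ∫ x, mollify n f x ∂gibbs Φ) atTop (𝓝 (∫ x, f x ∂gibbs Φ)) := by
  obtain ⟨C, hC⟩ := (isCompact_closedBall (0 : Eucl d) (R + 1)).exists_bound_of_continuousOn
    (f := fun x => Real.exp (-Φ x)) (by fun_prop)
  simp only [integral_gibbs hΦ.measurable]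
  refine tendsto_integral_of_bound_tendsto (N := fun n x => C * mollify n f x)
    (M := fun x => C * f x) (fun n => ?_) (fun n => (integrable_mollify hf n).const_mul C)
    (hf.const_mul C) (fun n x => ?_) ?_ ?_ ?_
  · have := (contDiff_mollify hf.locallyIntegrable n).continuous
    exact Continuous.aestronglyMeasurable (by fun_prop)
  · by_cases hx : R + 1 ≤ ‖x‖
    · simp [mollify_eq_zero hfR n hx]
    rw [norm_mul, Real.norm_eq_abs (mollify n f x), abs_of_nonneg (mollify_nonneg hf0 n x)]
    exact mul_le_mul_of_nonneg_right (hC x (by simpa using (not_le.1 hx).le))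
      (mollify_nonneg hf0 n x)
  · filter_upwards [tendsto_mollify hf.locallyIntegrable] with x h1
    exact h1.const_mul _
  · filter_upwards [tendsto_mollify hf.locallyIntegrable] with x h1
    exact h1.const_mul C
  · simp only [integral_const_mul, integral_mollify hf]
    exact tendsto_const_nhds

/-- Log-Sobolev inequality for weakly differentiable densities with bounded support. -/
lemma lintegral_klFun_le_of_hasWeakGradient {Φ φ : Eucl d → ℝ} {m b : ℝ} (hm : 0 < m)
    (hΦ : Continuous Φ) (hφ : ∀ x, |φ x| ≤ b) (h : StrongConvexOn univ m (fun x => Φ x + φ x))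
    [IsProbabilityMeasure (gibbs Φ)] {f : Eucl d → ℝ} {G : Eucl d → Eucl d}
    (hw : HasWeakGradient f G) (hf0 : ∀ x, 0 ≤ f x) (hf : Integrable f) (hG : Integrable G)
    {R : ℝ} (hfR : ∀ x, R ≤ ‖x‖ → f x = 0) (hI : 0 < ∫ x, f x ∂gibbs Φ) :
    ∫⁻ x, ENNReal.ofReal (klFun (f x / ∫ y, f y ∂gibbs Φ)) ∂gibbs Φ ≤
      ENNReal.ofReal (Real.exp (2 * b) / m / ∫ y, f y ∂gibbs Φ) *
        (2 * ∫⁻ x, ENNReal.ofReal (‖G x‖ ^ 2 / f x) ∂gibbs Φ) := by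
  set I := ∫ y, f y ∂gibbs Φ
  set J := ∫⁻ x, ENNReal.ofReal (‖G x‖ ^ 2 / f x) ∂gibbs Φ with hJ
  by_cases hJt : J = ⊤
  · rw [hJt, ENNReal.mul_top (by simp), ENNReal.mul_top]
    · exact le_top
    · exact (ENNReal.ofReal_pos.2 (by positivity)).ne'
  have hfl := hf.locallyIntegrable
  have hGl := hG.locallyIntegrable
  have h0 := ae_gradient_eq_zero_of_eq_zero hw hf0 hG
  obtain ⟨N, hN⟩ := exists_forall_exp_le_two_mul hΦ R
  set δ : ℕ → ℝ := fun n => 1 / ((n : ℝ) + 1)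
  have hδ : ∀ n, 0 < δ n := fun n => by positivity
  have hδt : Tendsto δ atTop (𝓝 0) := tendsto_one_div_add_atTop_nhds_zero_nat
  have hcs : ∀ n, HasCompactSupport (mollify n f) := fun n =>
    hasCompactSupport_of_eq_zero fun x hx => mollify_eq_zero hfR n hx
  have hmc : ∀ n, Continuous (mollify n f) := fun n => (contDiff_mollify hfl n).continuous
  set In : ℕ → ℝ := fun n => ∫ y, (mollify n f y + δ n) ∂gibbs Φ
  have hIn : Tendsto In atTop (𝓝 I) := by
    have h1 : ∀ n, In n = ∫ y, mollify n f y ∂gibbs Φ + δ n := fun n => by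
      simp only [In]
      rw [integral_add ((hmc n).integrable_of_hasCompactSupport (hcs n)) (integrable_const _)]
      simp
    refine Tendsto.congr (fun n => (h1 n).symm) ?_
    simpa using (tendsto_integral_mollify hΦ hf0 hf hfR).add hδt
  -- the constants `δ n` keep the smooth densities away from zero
  refine lintegral_le_of_ae_tendsto
    (u := fun n x => ENNReal.ofReal (klFun ((mollify n f x + δ n) / In n)))
    (b := fun n => ENNReal.ofReal (Real.exp (2 * b) / m / In n) * (2 * J)) (fun n => ?_) ?_ ?_ ?_
  · have := hmc n
    have hk := measurable_klFun
    fun_prop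
  · have := (gibbs_absolutelyContinuous Φ).ae_le (tendsto_mollify hfl)
    filter_upwards [this] with x hx
    have h1 : Tendsto (fun n => (mollify n f x + δ n) / In n) atTop (𝓝 (f x / I)) := by
      have h2 := (hx.add hδt).div hIn hI.ne'
      rwa [add_zero] at h2
    exact (ENNReal.continuous_ofReal.tendsto _).comp ((continuous_klFun.tendsto _).comp h1)
  · filter_upwards [eventually_ge_atTop N] with n hn
    refine (lintegral_klFun_le_of_smooth hm hΦ.measurable hφ h
      (contDiff_infty.1 (contDiff_mollify hfl n) 2) (hcs n)
      (mollify_nonneg hf0 n) (hδ n)).trans ?_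
    gcongr
    refine le_trans (le_of_eq ?_) (lintegral_mollify_fisher_le hΦ hf0 hfl hGl h0 hfR (hN n hn)
      (hδ n))
    refine lintegral_congr fun x => ?_
    rw [fderiv_mollify hw, innerSL_apply_norm]
  · refine ENNReal.Tendsto.mul_const ?_ (.inr (ENNReal.mul_ne_top (by simp) hJt))
    exact (ENNReal.continuous_ofReal.tendsto _).comp (tendsto_const_nhds.div hIn hI.ne')

/-- Smooth cutoffs `ψ` of radius `r ≥ 1` whose gradients satisfy `‖∇ψ‖² ≤ L ψ / r²`; the factor `ψ`
comes from taking squares of bump functions. -/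
lemma exists_smooth_cutoff (d : ℕ) : ∃ L : ℝ, 0 ≤ L ∧ ∀ k : ℕ, ∃ ψ : Eucl d → ℝ, ContDiff ℝ ∞ ψ ∧
    (∀ x, 0 ≤ ψ x ∧ ψ x ≤ 1) ∧ (∀ x, ‖x‖ ≤ (k : ℝ) + 1 → ψ x = 1) ∧
    (∀ x, 2 * ((k : ℝ) + 1) ≤ ‖x‖ → ψ x = 0) ∧
    ∀ x, ‖gradient ψ x‖ ^ 2 ≤ L / ((k : ℝ) + 1) ^ 2 * ψ x := by
  set χ : ContDiffBump (0 : Eucl d) := ⟨1, 2, one_pos, one_lt_two⟩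
  have hχ : ContDiff ℝ ∞ (χ : Eucl d → ℝ) := χ.contDiff
  obtain ⟨C, hC⟩ := (hχ.continuous_fderiv (by simp)).bounded_above_of_compact_support
    (χ.hasCompactSupport.fderiv ℝ)
  refine ⟨4 * C ^ 2, by positivity, fun k => ?_⟩
  set r : ℝ := (k : ℝ) + 1 with hr
  have hr0 : 0 < r := by positivity
  have hnorm : ∀ x : Eucl d, ‖r⁻¹ • x‖ = ‖x‖ / r := fun x => by
    rw [norm_smul, norm_inv, Real.norm_eq_abs, abs_of_pos hr0]; ring
  refine ⟨fun x => χ (r⁻¹ • x) ^ 2, (hχ.comp (contDiff_const_smul _)).pow 2, fun x => ⟨by positivity,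
    pow_le_one₀ χ.nonneg χ.le_one⟩, fun x hx => ?_, fun x hx => ?_, fun x => ?_⟩
  · beta_reduce
    rw [χ.one_of_mem_closedBall, one_pow]
    simp only [mem_closedBall_zero_iff, hnorm]
    exact (div_le_one hr0).2 hx
  · beta_reduce
    rw [χ.zero_of_le_dist, zero_pow two_ne_zero]
    simp only [dist_zero_right, hnorm]
    rw [le_div_iff₀ hr0]; exact hx
  · have hd : HasFDerivAt (fun x => χ (r⁻¹ • x) ^ 2)
        ((2 * χ (r⁻¹ • x) * r⁻¹) • fderiv ℝ χ (r⁻¹ • x)) x := by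
      have h1 := (hχ.differentiable (by simp) (r⁻¹ • x)).hasFDerivAt
      have h2 : HasFDerivAt (fun x : Eucl d => r⁻¹ • x) (r⁻¹ • ContinuousLinearMap.id ℝ (Eucl d)) x :=
        (hasFDerivAt_id x).const_smul r⁻¹
      refine ((h1.comp x h2).pow 2).congr_fderiv ?_
      ext v
      simp; ring
    have h3 : ‖gradient (fun x => χ (r⁻¹ • x) ^ 2) x‖
        = 2 * χ (r⁻¹ • x) * r⁻¹ * ‖fderiv ℝ χ (r⁻¹ • x)‖ := by
      rw [gradient, LinearIsometryEquiv.norm_map, hd.fderiv, norm_smul, Real.norm_eq_abs,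
        abs_of_nonneg (mul_nonneg (mul_nonneg zero_le_two χ.nonneg) (by positivity))]
    rw [h3]
    calc (2 * χ (r⁻¹ • x) * r⁻¹ * ‖fderiv ℝ χ (r⁻¹ • x)‖) ^ 2
        = 4 * ‖fderiv ℝ χ (r⁻¹ • x)‖ ^ 2 / r ^ 2 * χ (r⁻¹ • x) ^ 2 := by
          field_simp; ring
      _ ≤ _ := by gcongr; exact hC _

/-- Fisher information density of a product `s t`, where `a` is the gradient of `t` and `c` that of
`s`.  It also holds when `s t = 0`, where the left-hand side is a division by zero. -/
lemma norm_cutoff_sq_div_le {t s K : ℝ} (ht : 0 ≤ t) (hs : 0 ≤ s) (hs1 : s ≤ 1)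
    {a c : Eucl d} (hc : ‖c‖ ^ 2 ≤ K * s) (hK : 0 ≤ K) :
    ‖s • a + t • c‖ ^ 2 / (s * t) ≤ 2 * (‖a‖ ^ 2 / t) + 2 * K * t := by
  rcases ht.eq_or_lt with rfl | ht
  · simp
  rcases hs.eq_or_lt with rfl | hs
  · simp; positivity
  rw [div_le_iff₀ (by positivity)]
  have h1 : ‖s • a + t • c‖ ^ 2 ≤ 2 * (s ^ 2 * ‖a‖ ^ 2) + 2 * (t ^ 2 * ‖c‖ ^ 2) := by
    have := norm_add_le (s • a) (t • c)
    rw [norm_smul, norm_smul, Real.norm_eq_abs, Real.norm_eq_abs, abs_of_pos hs,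
      abs_of_pos ht] at this
    nlinarith [norm_nonneg (s • a + t • c), sq_nonneg (s * ‖a‖ - t * ‖c‖)]
  have h2 : (2 * (‖a‖ ^ 2 / t) + 2 * K * t) * (s * t) = 2 * (s * ‖a‖ ^ 2) + 2 * (t ^ 2 * (K * s)) := by
    field_simp
  rw [h2]
  have h3 : s ^ 2 * ‖a‖ ^ 2 ≤ s * ‖a‖ ^ 2 := by
    gcongr; nlinarith
  have h4 : t ^ 2 * ‖c‖ ^ 2 ≤ t ^ 2 * (K * s) := by gcongr
  linarith

/-- Log-Sobolev inequality for arbitrary weakly differentiable probability densities. -/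
lemma lintegral_klFun_le_of_hasWeakGradient_of_integral_eq_one {Φ φ : Eucl d → ℝ} {m b : ℝ}
    (hm : 0 < m) (hΦ : Continuous Φ) (hφ : ∀ x, |φ x| ≤ b)
    (h : StrongConvexOn univ m (fun x => Φ x + φ x)) [IsProbabilityMeasure (gibbs Φ)]
    {f : Eucl d → ℝ} {G : Eucl d → Eucl d} (hw : HasWeakGradient f G) (hf0 : ∀ x, 0 ≤ f x)
    (hf : Integrable f (gibbs Φ)) (hI : ∫ x, f x ∂gibbs Φ = 1) :
    ∫⁻ x, ENNReal.ofReal (klFun (f x)) ∂gibbs Φ ≤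
      ENNReal.ofReal (Real.exp (2 * b) / m) *
        (2 * (2 * ∫⁻ x, ENNReal.ofReal (‖G x‖ ^ 2 / f x) ∂gibbs Φ)) := by
  set J := ∫⁻ x, ENNReal.ofReal (‖G x‖ ^ 2 / f x) ∂gibbs Φ with hJ
  by_cases hJt : J = ⊤
  · rw [hJt, ENNReal.mul_top (by simp), ENNReal.mul_top (by simp), ENNReal.mul_top]
    · exact le_top
    · exact (ENNReal.ofReal_pos.2 (by positivity)).ne'
  obtain ⟨L, hL, hψ⟩ := exists_smooth_cutoff d
  choose ψ hψc hψ01 hψ1 hψ0 hψg using hψ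
  set r : ℕ → ℝ := fun k => L / ((k : ℝ) + 1) ^ 2
  have hr0 : ∀ k, 0 ≤ r k := fun k => by positivity
  have hrt : Tendsto r atTop (𝓝 0) := by
    refine tendsto_const_nhds.div_atTop ((tendsto_pow_atTop two_ne_zero).comp ?_)
    exact tendsto_atTop_add_const_right _ _ tendsto_natCast_atTop_atTop
  have hψt : ∀ x, Tendsto (fun k => ψ k x) atTop (𝓝 1) := by
    intro x
    obtain ⟨N, hN⟩ := exists_nat_ge ‖x‖
    refine tendsto_const_nhds.congr' ?_
    filter_upwards [eventually_ge_atTop N] with k hk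
    refine (hψ1 k x ?_).symm
    have : (N : ℝ) ≤ k := by exact_mod_cast hk
    linarith
  have hfm : AEStronglyMeasurable f := hw.1.aestronglyMeasurable
  have hfmμ : AEStronglyMeasurable f (gibbs Φ) := hf.aestronglyMeasurable
  set In : ℕ → ℝ := fun k => ∫ x, ψ k x * f x ∂gibbs Φ
  have hIn : Tendsto In atTop (𝓝 1) := by
    rw [← hI]
    refine tendsto_integral_of_dominated_convergence f
      (fun k => (hψc k).continuous.aestronglyMeasurable.mul hfmμ) hf
      (fun k => .of_forall fun x => ?_) (.of_forall fun x => ?_)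
    · rw [norm_mul, Real.norm_eq_abs, Real.norm_eq_abs, abs_of_nonneg (hψ01 k x).1,
        abs_of_nonneg (hf0 x)]
      exact mul_le_of_le_one_left (hf0 x) (hψ01 k x).2
    · simpa using (hψt x).mul_const (f x)
  have hball : ∀ k, HasCompactSupport (ψ k) := fun k => hasCompactSupport_of_eq_zero (hψ0 k)
  have hgc : ∀ k, Continuous (gradient (ψ k)) := fun k =>
    (InnerProductSpace.toDual ℝ (Eucl d)).symm.continuous.comp
      ((hψc k).continuous_fderiv (by simp))
  have hgs : ∀ k, HasCompactSupport (gradient (ψ k)) := fun k => by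
    refine ((hball k).fderiv ℝ).mono fun x hx h0 => hx ?_
    rw [gradient, h0, map_zero]
  have hfI : ∀ k, Integrable fun x => ψ k x * f x := fun k =>
    hw.1.integrable_smul_left_of_hasCompactSupport (hψc k).continuous (hball k)
  have hGI : ∀ k, Integrable fun x => ψ k x • G x + f x • gradient (ψ k) x := fun k =>
    (hw.2.1.integrable_smul_left_of_hasCompactSupport (hψc k).continuous (hball k)).add
      (hw.1.integrable_smul_right_of_hasCompactSupport (hgc k) (hgs k))
  have hfl1 : ∫⁻ x, ENNReal.ofReal (f x) ∂gibbs Φ = 1 := by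
    rw [← ofReal_integral_eq_lintegral_ofReal hf (.of_forall hf0), hI, ENNReal.ofReal_one]
  have hJk : ∀ k, ∫⁻ x, ENNReal.ofReal (‖ψ k x • G x + f x • gradient (ψ k) x‖ ^ 2 /
      (ψ k x * f x)) ∂gibbs Φ ≤ 2 * J + ENNReal.ofReal (2 * r k) := by
    intro k
    calc _ ≤ ∫⁻ x, (2 * ENNReal.ofReal (‖G x‖ ^ 2 / f x) +
          ENNReal.ofReal (2 * r k) * ENNReal.ofReal (f x)) ∂gibbs Φ := by
          refine lintegral_mono fun x => ?_
          have h1 := norm_cutoff_sq_div_le (hf0 x) (hψ01 k x).1 (hψ01 k x).2 (a := G x)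
            (hψg k x) (hr0 k)
          refine (ENNReal.ofReal_le_ofReal h1).trans_eq ?_
          have := hf0 x
          have := hr0 k
          rw [ENNReal.ofReal_add (by positivity) (by positivity), ENNReal.ofReal_mul (by positivity),
            ENNReal.ofReal_mul (by positivity), ENNReal.ofReal_ofNat]
      _ = _ := by
          rw [lintegral_add_right' _ (by have := hfmμ.aemeasurable; fun_prop),
            lintegral_const_mul' _ _ (by simp), lintegral_const_mul' _ _ ENNReal.ofReal_ne_top,
            hfl1, mul_one]
  refine lintegral_le_of_ae_tendsto
    (u := fun k x => ENNReal.ofReal (klFun (ψ k x * f x / In k)))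
    (b := fun k => ENNReal.ofReal (Real.exp (2 * b) / m / In k) *
      (2 * (2 * J + ENNReal.ofReal (2 * r k)))) (fun k => ?_) (.of_forall fun x => ?_) ?_ ?_
  · have h1 := (hψc k).continuous
    have h2 := hfmμ.aemeasurable
    have hk := measurable_klFun
    fun_prop
  · have h1 : Tendsto (fun k => ψ k x * f x / In k) atTop (𝓝 (f x)) := by
      have h2 := ((hψt x).mul_const (f x)).div hIn one_ne_zero
      rwa [one_mul, div_one] at h2
    exact (ENNReal.continuous_ofReal.tendsto _).comp ((continuous_klFun.tendsto _).comp h1)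
  · filter_upwards [hIn.eventually (lt_mem_nhds one_pos)] with k hk
    refine (lintegral_klFun_le_of_hasWeakGradient hm hΦ hφ h (hw.mul_smooth (hψc k))
      (fun x => mul_nonneg (hψ01 k x).1 (hf0 x)) (hfI k) (hGI k) (R := 2 * ((k : ℝ) + 1))
      (fun x hx => by simp [hψ0 k x hx]) hk).trans ?_
    gcongr
    exact hJk k
  · have h1 : Tendsto (fun k => ENNReal.ofReal (Real.exp (2 * b) / m / In k)) atTop
        (𝓝 (ENNReal.ofReal (Real.exp (2 * b) / m))) := by
      refine (ENNReal.continuous_ofReal.tendsto _).comp ?_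
      have h2 := (tendsto_const_nhds (x := Real.exp (2 * b) / m)).div hIn one_ne_zero
      rwa [div_one] at h2
    have h2 : Tendsto (fun k => ENNReal.ofReal (2 * r k)) atTop (𝓝 0) := by
      have h2 := (ENNReal.continuous_ofReal.tendsto _).comp (hrt.const_mul 2)
      rwa [mul_zero, ENNReal.ofReal_zero] at h2
    have h3 : Tendsto (fun k => 2 * (2 * J + ENNReal.ofReal (2 * r k))) atTop (𝓝 (2 * (2 * J))) := by
      have := ENNReal.Tendsto.const_mul (a := 2) (h2.const_add (2 * J)) (.inr (by simp))
      simpa using this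
    exact ENNReal.Tendsto.mul h1 (.inr (ENNReal.mul_ne_top (by simp)
      (ENNReal.mul_ne_top (by simp) hJt))) h3 (.inr ENNReal.ofReal_ne_top)

/-- A Gibbs measure whose potential is a bounded perturbation of a strongly convex one satisfies a
log-Sobolev inequality. -/
lemma logSobolev_gibbs {Φ φ : Eucl d → ℝ} {m b : ℝ} (hm : 0 < m) (hΦ : Continuous Φ)
    (hφ : ∀ x, |φ x| ≤ b) (h : StrongConvexOn univ m (fun x => Φ x + φ x))
    [IsProbabilityMeasure (gibbs Φ)] : LogSobolev (gibbs Φ) (8 * Real.exp (2 * b) / m) := by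
  refine ⟨by positivity, fun ν hν => ?_⟩
  set c : ℝ≥0∞ := ENNReal.ofReal (8 * Real.exp (2 * b) / m / 2) with hc
  have hc0 : c ≠ 0 := (ENNReal.ofReal_pos.2 (by positivity)).ne'
  have hce : c = ENNReal.ofReal (Real.exp (2 * b) / m) * 4 := by
    rw [hc, ← ENNReal.ofReal_ofNat 4, ← ENNReal.ofReal_mul (by positivity)]
    congr 1; ring
  rw [← ENNReal.div_le_iff' hc0 ENNReal.ofReal_ne_top]
  refine le_iInf fun f => le_iInf fun G => le_iInf fun ⟨hac, hf0, hfd, hw⟩ => ?_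
  rw [ENNReal.div_le_iff' hc0 ENNReal.ofReal_ne_top]
  have hfm : AEStronglyMeasurable f (gibbs Φ) :=
    hw.1.aestronglyMeasurable.mono_ac (gibbs_absolutelyContinuous Φ)
  have : SigmaFinite ν := inferInstance
  have h1 : ∫⁻ x, ENNReal.ofReal (f x) ∂gibbs Φ = 1 := by
    rw [← lintegral_congr_ae hfd, Measure.lintegral_rnDeriv hac, measure_univ]
  have hfi : Integrable f (gibbs Φ) := by
    refine ⟨hfm, ?_⟩
    rw [hasFiniteIntegral_iff_ofReal (.of_forall hf0), h1]
    exact ENNReal.one_lt_top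
  have hI : ∫ x, f x ∂gibbs Φ = 1 := by
    rw [integral_eq_lintegral_of_nonneg_ae (.of_forall hf0) hfm, h1, ENNReal.toReal_one]
  rw [klDiv_eq_lintegral_klFun_of_ac hac]
  calc ∫⁻ x, ENNReal.ofReal (klFun (ν.rnDeriv (gibbs Φ) x).toReal) ∂gibbs Φ
      = ∫⁻ x, ENNReal.ofReal (klFun (f x)) ∂gibbs Φ := by
        refine lintegral_congr_ae ?_
        filter_upwards [hfd] with x hx
        rw [hx, ENNReal.toReal_ofReal (hf0 x)]
    _ ≤ _ := lintegral_klFun_le_of_hasWeakGradient_of_integral_eq_one hm hΦ hφ h hw hf0 hfi hI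
    _ = _ := by rw [hce]; ring

end LogSobolevWeak

/-! ### Quadratic forms -/

section Quad

open Set Filter Topology

/-- The quadratic form `x ↦ xᵀ A x`. -/
def quad (A : Matrix (Fin d) (Fin d) ℝ) (x : Eucl d) : ℝ :=
  inner ℝ x (Matrix.toEuclideanCLM (n := Fin d) (𝕜 := ℝ) A x)

lemma quad_add (A B : Matrix (Fin d) (Fin d) ℝ) (x : Eucl d) :
    quad (A + B) x = quad A x + quad B x := by
  simp [quad, inner_add_right]

lemma quad_sub (A B : Matrix (Fin d) (Fin d) ℝ) (x : Eucl d) :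
    quad (A - B) x = quad A x - quad B x := by
  simp [quad, inner_sub_right]

lemma quad_smul (c : ℝ) (A : Matrix (Fin d) (Fin d) ℝ) (x : Eucl d) :
    quad (c • A) x = c * quad A x := by
  simp [quad, inner_smul_right]

lemma quad_one (x : Eucl d) : quad 1 x = ‖x‖ ^ 2 := by
  simp [quad]

lemma quad_nonneg {A : Matrix (Fin d) (Fin d) ℝ} (hA : A.PosSemidef) (x : Eucl d) :
    0 ≤ quad A x := by
  have := hA.dotProduct_mulVec_nonneg x.ofLp
  rwa [quad, Matrix.inner_toEuclideanCLM]

lemma quad_pos {A : Matrix (Fin d) (Fin d) ℝ} (hA : A.PosDef) {x : Eucl d} (hx : x ≠ 0) :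
    0 < quad A x := by
  have := hA.dotProduct_mulVec_pos (x := x.ofLp) (by simpa using hx)
  rwa [quad, Matrix.inner_toEuclideanCLM]

lemma continuous_quad (A : Matrix (Fin d) (Fin d) ℝ) : Continuous (quad A) := by
  unfold quad; fun_prop

lemma quad_le (A : Matrix (Fin d) (Fin d) ℝ) (x : Eucl d) : quad A x ≤ specNorm A * ‖x‖ ^ 2 := by
  refine (real_inner_le_norm _ _).trans ?_
  have := (Matrix.toEuclideanCLM (n := Fin d) (𝕜 := ℝ) A).le_opNorm x
  rw [specNorm]
  nlinarith [norm_nonneg x]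

lemma quad_smul_right (A : Matrix (Fin d) (Fin d) ℝ) (c : ℝ) (x : Eucl d) :
    quad A (c • x) = c ^ 2 * quad A x := by
  simp [quad, inner_smul_left, inner_smul_right]; ring

lemma exists_mul_norm_sq_le_quad {A : Matrix (Fin d) (Fin d) ℝ} (hA : A.PosDef) :
    ∃ a : ℝ, 0 < a ∧ ∀ x, a * ‖x‖ ^ 2 ≤ quad A x := by
  by_cases hne : (Metric.sphere (0 : Eucl d) 1).Nonempty
  · obtain ⟨z, hz, hmin⟩ := (isCompact_sphere (0 : Eucl d) 1).exists_isMinOn hne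
      (continuous_quad A).continuousOn
    have hz0 : z ≠ 0 := by
      rintro rfl; simp at hz
    refine ⟨quad A z, quad_pos hA hz0, fun x => ?_⟩
    by_cases hx : x = 0
    · simp [hx, quad]
    have hx' : 0 < ‖x‖ := norm_pos_iff.2 hx
    have h1 : quad A z ≤ quad A (‖x‖⁻¹ • x) := hmin (by simp [norm_smul, hx'.ne'])
    rw [quad_smul_right] at h1
    calc quad A z * ‖x‖ ^ 2 ≤ ‖x‖⁻¹ ^ 2 * quad A x * ‖x‖ ^ 2 := by gcongr
      _ = quad A x := by field_simp
  · refine ⟨1, one_pos, fun x => ?_⟩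
    have hx : x = 0 := by
      by_contra hx
      have hx' : 0 < ‖x‖ := norm_pos_iff.2 hx
      exact hne ⟨‖x‖⁻¹ • x, by simp [norm_smul, hx'.ne']⟩
    simp [hx, quad]

/-- Matrix inversion is strictly decreasing in the Löwner order; with `y = B⁻¹ x` this is
`xᵀ A⁻¹ x ≥ 2 xᵀ y - yᵀ A y > 2 xᵀ y - yᵀ B y = xᵀ B⁻¹ x`. -/
lemma posDef_inv_sub_inv {A B : Matrix (Fin d) (Fin d) ℝ} (hA : A.PosDef) (hB : B.PosDef)
    (h : (B - A).PosDef) : (A⁻¹ - B⁻¹).PosDef := by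
  refine .of_dotProduct_mulVec_pos (hA.inv.1.sub hB.inv.1) fun x hx => ?_
  have uA : IsUnit A.det := (Matrix.isUnit_iff_isUnit_det A).1 hA.isUnit
  have uB : IsUnit B.det := (Matrix.isUnit_iff_isUnit_det B).1 hB.isUnit
  simp only [star_trivial]
  set y := Matrix.mulVec B⁻¹ x with hy
  set z := Matrix.mulVec A⁻¹ x with hz
  have hBy : Matrix.mulVec B y = x := by
    rw [hy, Matrix.mulVec_mulVec, Matrix.mul_nonsing_inv _ uB, Matrix.one_mulVec]
  have hAz : Matrix.mulVec A z = x := by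
    rw [hz, Matrix.mulVec_mulVec, Matrix.mul_nonsing_inv _ uA, Matrix.one_mulVec]
  have hy0 : y ≠ 0 := by
    rintro h0; rw [h0, Matrix.mulVec_zero] at hBy; exact hx hBy.symm
  have h1 := h.dotProduct_mulVec_pos hy0
  have h2 := hA.posSemidef.dotProduct_mulVec_nonneg (z - y)
  have hsymm : dotProduct z (Matrix.mulVec A y) = dotProduct x y := by
    have hAt : A.transpose = A := hA.1
    rw [Matrix.dotProduct_mulVec, ← Matrix.mulVec_transpose, hAt, hAz]
  simp only [star_trivial, Matrix.sub_mulVec, Matrix.mulVec_sub, dotProduct_sub, sub_dotProduct,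
    hAz, hBy, hsymm] at h1 h2
  rw [Matrix.sub_mulVec, dotProduct_sub]
  have e1 := dotProduct_comm x y
  have e2 := dotProduct_comm x z
  linarith

lemma quad_hess (f : Eucl d → ℝ) (x k : Eucl d) :
    quad (hess f x) k = fderiv ℝ (fderiv ℝ f) x k k := by
  have hk : k = ∑ i, k i • EuclideanSpace.single i (1 : ℝ) := by
    simpa using ((EuclideanSpace.basisFun (Fin d) ℝ).sum_repr k).symm
  conv_rhs => rw [hk]
  rw [quad, Matrix.inner_toEuclideanCLM]
  simp only [map_sum, map_smul, _root_.sum_apply, _root_.smul_apply,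
    smul_eq_mul, dotProduct, Matrix.mulVec, hess, Matrix.of_apply, Finset.mul_sum]
  rw [Finset.sum_comm]
  refine Finset.sum_congr rfl fun i _ => Finset.sum_congr rfl fun j _ => ?_
  ring

end Quad

/-! ### Convexity along lines -/

section Lines

open Set Filter Topology

/-- `f` is twice differentiable along every line, and `q x k` is its second derivative at `x` in
the direction `k`. -/
def HasLineSecondDeriv (f : Eucl d → ℝ) (q : Eucl d → Eucl d → ℝ) : Prop :=
  ∃ p : Eucl d → Eucl d → ℝ, ∀ (x k : Eucl d) (t : ℝ),
    HasDerivAt (fun t : ℝ => f (x + t • k)) (p (x + t • k) k) t ∧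
      HasDerivAt (fun t : ℝ => p (x + t • k) k) (q (x + t • k) k) t

lemma HasLineSecondDeriv.add {f g : Eucl d → ℝ} {q r : Eucl d → Eucl d → ℝ}
    (hf : HasLineSecondDeriv f q) (hg : HasLineSecondDeriv g r) :
    HasLineSecondDeriv (fun x => f x + g x) (fun x k => q x k + r x k) := by
  obtain ⟨p, hp⟩ := hf
  obtain ⟨p', hp'⟩ := hg
  exact ⟨fun x k => p x k + p' x k, fun x k t =>
    ⟨(hp x k t).1.add (hp' x k t).1, (hp x k t).2.add (hp' x k t).2⟩⟩

lemma HasLineSecondDeriv.sub {f g : Eucl d → ℝ} {q r : Eucl d → Eucl d → ℝ}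
    (hf : HasLineSecondDeriv f q) (hg : HasLineSecondDeriv g r) :
    HasLineSecondDeriv (fun x => f x - g x) (fun x k => q x k - r x k) := by
  obtain ⟨p, hp⟩ := hf
  obtain ⟨p', hp'⟩ := hg
  exact ⟨fun x k => p x k - p' x k, fun x k t =>
    ⟨(hp x k t).1.sub (hp' x k t).1, (hp x k t).2.sub (hp' x k t).2⟩⟩

lemma hasDerivAt_line (x k : Eucl d) (t : ℝ) : HasDerivAt (fun t : ℝ => x + t • k) k t := by
  simpa using ((hasDerivAt_id t).smul_const k).const_add x

lemma hasLineSecondDeriv_of_contDiff {f : Eucl d → ℝ} (hf : ContDiff ℝ 2 f) :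
    HasLineSecondDeriv f (fun x k => quad (hess f x) k) := by
  refine ⟨fun x k => fderiv ℝ f x k, fun x k t => ⟨?_, ?_⟩⟩
  · exact ((hf.differentiable two_ne_zero _).hasFDerivAt).comp_hasDerivAt t (hasDerivAt_line x k t)
  · simp only [quad_hess]
    have h1 : ContDiff ℝ 1 (fderiv ℝ f) := hf.fderiv_right (by norm_num)
    have h2 := ((h1.differentiable one_ne_zero (x + t • k)).hasFDerivAt).comp_hasDerivAt t
      (hasDerivAt_line x k t)
    simpa using h2.clm_apply (hasDerivAt_const t k)

lemma hasLineSecondDeriv_quad (A : Matrix (Fin d) (Fin d) ℝ) :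
    HasLineSecondDeriv (quad A) (fun _ k => 2 * quad A k) := by
  set T := Matrix.toEuclideanCLM (n := Fin d) (𝕜 := ℝ) A with hT
  refine ⟨fun x k => inner ℝ x (T k) + inner ℝ k (T x), fun x k t => ?_⟩
  have h1 := hasDerivAt_line x k t
  have h2 : HasDerivAt (fun t : ℝ => T (x + t • k)) (T k) t := T.hasFDerivAt.comp_hasDerivAt t h1
  refine ⟨h1.inner ℝ h2, ?_⟩
  have h3 := (h1.inner ℝ (hasDerivAt_const t (T k))).add ((hasDerivAt_const t k).inner ℝ h2)
  refine h3.congr_deriv ?_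
  simp [quad, ← hT]; ring

lemma HasLineSecondDeriv.convexOn {f : Eucl d → ℝ} {q : Eucl d → Eucl d → ℝ}
    (hf : HasLineSecondDeriv f q) (hq : ∀ x k, 0 ≤ q x k) : ConvexOn ℝ univ f := by
  obtain ⟨p, hp⟩ := hf
  refine ⟨convex_univ, fun x _ y _ a b ha hb hab => ?_⟩
  set g : ℝ → ℝ := fun t => f (x + t • (y - x))
  have hg' : deriv g = fun t => p (x + t • (y - x)) (y - x) :=
    funext fun t => (hp x (y - x) t).1.deriv
  have hg : ConvexOn ℝ univ g := by
    refine convexOn_univ_of_deriv2_nonneg (fun t => (hp x (y - x) t).1.differentiableAt)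
      (by rw [hg']; exact fun t => (hp x (y - x) t).2.differentiableAt) fun t => ?_
    rw [Function.iterate_succ_apply, Function.iterate_one, hg', (hp x (y - x) t).2.deriv]
    exact hq _ _
  have h := hg.2 (mem_univ 0) (mem_univ 1) ha hb hab
  have e1 : x + b • (y - x) = a • x + b • y := by
    have : a = 1 - b := by linarith
    rw [this]; module
  simpa [g, e1] using h

/-- The function `x ↦ -M T exp (-√(1 + ‖x‖²) / T)` is bounded, very convex near the origin and
almost flat elsewhere. -/
lemma hasLineSecondDeriv_exp_sqrt (M : ℝ) {T : ℝ} (hT : 0 < T) :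
    HasLineSecondDeriv (fun x : Eucl d => -(M * T * Real.exp (-(√(1 + ‖x‖ ^ 2) / T))))
      (fun x k => M * Real.exp (-(√(1 + ‖x‖ ^ 2) / T)) *
        (‖k‖ ^ 2 / √(1 + ‖x‖ ^ 2) - inner ℝ x k ^ 2 / √(1 + ‖x‖ ^ 2) ^ 3 -
          inner ℝ x k ^ 2 / (√(1 + ‖x‖ ^ 2) ^ 2 * T))) := by
  have hr : ∀ x k : Eucl d, ∀ t : ℝ, HasDerivAt (fun t : ℝ => √(1 + ‖x + t • k‖ ^ 2))
      (inner ℝ (x + t • k) k / √(1 + ‖x + t • k‖ ^ 2)) t := by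
    intro x k t
    have h1 := (((hasDerivAt_line x k t).norm_sq).const_add 1).sqrt (by positivity)
    refine h1.congr_deriv ?_
    field_simp
  have he : ∀ x k : Eucl d, ∀ t : ℝ, HasDerivAt
      (fun t : ℝ => Real.exp (-(√(1 + ‖x + t • k‖ ^ 2) / T)))
      (-(Real.exp (-(√(1 + ‖x + t • k‖ ^ 2) / T)) *
        (inner ℝ (x + t • k) k / √(1 + ‖x + t • k‖ ^ 2) / T))) t := by
    intro x k t
    refine (((hr x k t).div_const T).neg.exp).congr_deriv ?_
    simp only [Pi.neg_apply]
    ring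
  refine ⟨fun x k => M * Real.exp (-(√(1 + ‖x‖ ^ 2) / T)) * (inner ℝ x k / √(1 + ‖x‖ ^ 2)),
    fun x k t => ⟨?_, ?_⟩⟩
  · refine (((he x k t).const_mul (M * T)).neg).congr_deriv ?_
    field_simp
  · have h0 : 0 < √(1 + ‖x + t • k‖ ^ 2) := Real.sqrt_pos.2 (by positivity)
    have h1 := ((hasDerivAt_line x k t).inner ℝ (hasDerivAt_const t k)).div (hr x k t) h0.ne'
    refine (((he x k t).const_mul M).mul h1).congr_deriv ?_
    simp only [inner_zero_right, zero_add, real_inner_self_eq_norm_sq, Pi.div_apply]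
    field_simp
    ring

/-- A bounded perturbation that compensates a lack of convexity inside a ball, at the price of a
small loss elsewhere. -/
lemma exists_bounded_convexifier (d : ℕ) {a b : ℝ} (ha : 0 < a) (hb : 0 ≤ b) (δ : ℝ) :
    ∃ (φ : Eucl d → ℝ) (q : Eucl d → Eucl d → ℝ) (C : ℝ), Continuous φ ∧ (∀ x, |φ x| ≤ C) ∧
      HasLineSecondDeriv φ q ∧ (∀ x k, -(a / 2) * ‖k‖ ^ 2 ≤ q x k) ∧
      ∀ x k, ‖x‖ < δ → (b + a / 2) * ‖k‖ ^ 2 ≤ q x k := by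
  -- the gain of convexity `M exp (-1) / s ^ 3` in the ball is `b + a`, the loss `M / T` at most `a / 2`
  set s : ℝ := √(1 + δ ^ 2)
  have hs : 0 < s := Real.sqrt_pos.2 (by positivity)
  set M : ℝ := Real.exp 1 * s ^ 3 * (b + a)
  have hM : 0 < M := by positivity
  set T : ℝ := max s (2 * M / a)
  have hT : 0 < T := lt_of_lt_of_le hs (le_max_left _ _)
  have hMT : M / T ≤ a / 2 := by
    have : 2 * M / a ≤ T := le_max_right _ _
    rw [div_le_iff₀ ha] at this
    rw [div_le_div_iff₀ hT two_pos]; linarith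
  have key : ∀ x k : Eucl d, M * Real.exp (-(√(1 + ‖x‖ ^ 2) / T)) * (‖k‖ ^ 2 / √(1 + ‖x‖ ^ 2) ^ 3)
      - a / 2 * ‖k‖ ^ 2 ≤ M * Real.exp (-(√(1 + ‖x‖ ^ 2) / T)) *
        (‖k‖ ^ 2 / √(1 + ‖x‖ ^ 2) - inner ℝ x k ^ 2 / √(1 + ‖x‖ ^ 2) ^ 3 -
          inner ℝ x k ^ 2 / (√(1 + ‖x‖ ^ 2) ^ 2 * T)) := by
    intro x k
    set r := √(1 + ‖x‖ ^ 2)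
    have hr2 : r ^ 2 = 1 + ‖x‖ ^ 2 := Real.sq_sqrt (by positivity)
    have hr : 0 < r := Real.sqrt_pos.2 (by positivity)
    set e := Real.exp (-(r / T))
    have he : e ≤ 1 := Real.exp_le_one_iff.2 (by
      have : 0 ≤ r / T := by positivity
      linarith)
    have he0 : 0 < e := Real.exp_pos _
    have hin : inner ℝ x k ^ 2 ≤ ‖x‖ ^ 2 * ‖k‖ ^ 2 := by
      rw [← mul_pow]; exact sq_le_sq' (by linarith [neg_le_of_abs_le (abs_real_inner_le_norm x k)])
        (real_inner_le_norm x k)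
    have h1 : ‖k‖ ^ 2 / r ^ 3 + inner ℝ x k ^ 2 / r ^ 3 ≤ ‖k‖ ^ 2 / r := by
      rw [← add_div, div_le_div_iff₀ (by positivity) hr]
      calc (‖k‖ ^ 2 + inner ℝ x k ^ 2) * r ≤ (‖k‖ ^ 2 + ‖x‖ ^ 2 * ‖k‖ ^ 2) * r := by gcongr
        _ = ‖k‖ ^ 2 * r ^ 2 * r := by rw [hr2]; ring
        _ = ‖k‖ ^ 2 * r ^ 3 := by ring
    have h2 : inner ℝ x k ^ 2 / (r ^ 2 * T) ≤ ‖k‖ ^ 2 / T := by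
      rw [div_le_div_iff₀ (by positivity) hT]
      have : inner ℝ x k ^ 2 ≤ r ^ 2 * ‖k‖ ^ 2 := by
        rw [hr2]; nlinarith [sq_nonneg ‖k‖]
      nlinarith
    have h3 : M * e * (‖k‖ ^ 2 / T) ≤ a / 2 * ‖k‖ ^ 2 := by
      calc M * e * (‖k‖ ^ 2 / T) ≤ M * 1 * (‖k‖ ^ 2 / T) := by gcongr
        _ = M / T * ‖k‖ ^ 2 := by ring
        _ ≤ _ := by gcongr
    have h4 : M * e * (‖k‖ ^ 2 / r ^ 3 - ‖k‖ ^ 2 / T) ≤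
        M * e * (‖k‖ ^ 2 / r - inner ℝ x k ^ 2 / r ^ 3 - inner ℝ x k ^ 2 / (r ^ 2 * T)) := by
      refine mul_le_mul_of_nonneg_left ?_ (by positivity)
      linarith
    rw [mul_sub] at h4
    linarith
  refine ⟨_, _, M * T, ?_, fun x => ?_, hasLineSecondDeriv_exp_sqrt M hT, fun x k => ?_,
    fun x k hx => ?_⟩
  · fun_prop
  · rw [abs_neg, abs_of_nonneg (by positivity)]
    refine mul_le_of_le_one_right (by positivity) (Real.exp_le_one_iff.2 ?_)
    have : 0 ≤ √(1 + ‖x‖ ^ 2) / T := by positivity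
    linarith
  · refine le_trans ?_ (key x k)
    have : 0 ≤ M * Real.exp (-(√(1 + ‖x‖ ^ 2) / T)) * (‖k‖ ^ 2 / √(1 + ‖x‖ ^ 2) ^ 3) := by
      positivity
    linarith
  · refine le_trans ?_ (key x k)
    set r := √(1 + ‖x‖ ^ 2)
    have hr : 0 < r := Real.sqrt_pos.2 (by positivity)
    have hrs : r ≤ s := Real.sqrt_le_sqrt (by gcongr)
    have hrT : r / T ≤ 1 := (div_le_one hT).2 (hrs.trans (le_max_left _ _))
    have h1 : Real.exp (-1) ≤ Real.exp (-(r / T)) := Real.exp_le_exp.2 (by linarith)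
    have h2 : (b + a) * ‖k‖ ^ 2 ≤ M * Real.exp (-(r / T)) * (‖k‖ ^ 2 / r ^ 3) := by
      calc (b + a) * ‖k‖ ^ 2 = M * Real.exp (-1) * (‖k‖ ^ 2 / s ^ 3) := by
            simp only [M]
            rw [Real.exp_neg]; field_simp
        _ ≤ _ := by gcongr
    linarith

end Lines

/-! ### Logarithms of integrals of convex functions -/

section LogIntegral

open Set Filter Topology

variable {g : Eucl d → Eucl d → ℝ}

lemma lintegral_exp_ne_zero (hm : ∀ y, Measurable fun x => g x y) (y : Eucl d) :
    ∫⁻ x, ENNReal.ofReal (Real.exp (g x y)) ≠ 0 := by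
  have hmy := hm y
  rw [Ne, lintegral_eq_zero_iff (by fun_prop)]
  intro h
  obtain ⟨x, hx⟩ := h.exists
  exact (ENNReal.ofReal_pos.2 (Real.exp_pos _)).ne' hx

/-- Hölder's inequality: an integral of log-convex functions is log-convex. -/
lemma lintegral_exp_combo_le (hm : ∀ y, Measurable fun x => g x y)
    (hg : ∀ x, ConvexOn ℝ univ (g x)) {y z : Eucl d} {a b : ℝ} (ha : 0 ≤ a) (hb : 0 ≤ b)
    (hab : a + b = 1) :
    ∫⁻ x, ENNReal.ofReal (Real.exp (g x (a • y + b • z))) ≤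
      (∫⁻ x, ENNReal.ofReal (Real.exp (g x y))) ^ a *
        (∫⁻ x, ENNReal.ofReal (Real.exp (g x z))) ^ b := by
  have hmy := hm y
  have hmz := hm z
  refine le_trans (lintegral_mono fun x => ?_)
    (ENNReal.lintegral_mul_norm_pow_le (by fun_prop) (by fun_prop) ha hb hab)
  rw [ENNReal.ofReal_rpow_of_pos (Real.exp_pos _), ENNReal.ofReal_rpow_of_pos (Real.exp_pos _),
    ← Real.exp_mul, ← Real.exp_mul, ← ENNReal.ofReal_mul (Real.exp_pos _).le, ← Real.exp_add]
  refine ENNReal.ofReal_le_ofReal (Real.exp_le_exp.2 ?_)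
  have := (hg x).2 (mem_univ y) (mem_univ z) ha hb hab
  simp only [smul_eq_mul] at this
  linarith

/-- The set of finiteness is convex, and a convex set of full measure is the whole space. -/
lemma lintegral_exp_ne_top (hm : ∀ y, Measurable fun x => g x y)
    (hg : ∀ x, ConvexOn ℝ univ (g x))
    (hfin : ∀ᵐ y, ∫⁻ x, ENNReal.ofReal (Real.exp (g x y)) ≠ ⊤) (y : Eucl d) :
    ∫⁻ x, ENNReal.ofReal (Real.exp (g x y)) ≠ ⊤ := by
  have h2 : ∀ᵐ z : Eucl d, ∫⁻ x, ENNReal.ofReal (Real.exp (g x ((2 : ℝ) • y - z))) ≠ ⊤ :=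
    (Measure.measurePreserving_sub_left volume ((2 : ℝ) • y)).quasiMeasurePreserving.ae hfin
  obtain ⟨z, hz1, hz2⟩ := (hfin.and h2).exists
  have h := lintegral_exp_combo_le hm hg (y := z) (z := (2 : ℝ) • y - z) (a := 1 / 2) (b := 1 / 2)
    (by norm_num) (by norm_num) (by norm_num)
  have e : (1 / 2 : ℝ) • z + (1 / 2 : ℝ) • ((2 : ℝ) • y - z) = y := by module
  rw [e] at h
  refine (h.trans_lt (ENNReal.mul_lt_top ?_ ?_)).ne
  · exact ENNReal.rpow_lt_top_of_nonneg (by norm_num) hz1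
  · exact ENNReal.rpow_lt_top_of_nonneg (by norm_num) hz2

lemma convexOn_log_lintegral_exp (hm : ∀ y, Measurable fun x => g x y)
    (hg : ∀ x, ConvexOn ℝ univ (g x))
    (hfin : ∀ y, ∫⁻ x, ENNReal.ofReal (Real.exp (g x y)) ≠ ⊤) :
    ConvexOn ℝ univ fun y => Real.log (∫⁻ x, ENNReal.ofReal (Real.exp (g x y))).toReal := by
  have hpos : ∀ y, 0 < (∫⁻ x, ENNReal.ofReal (Real.exp (g x y))).toReal := fun y =>
    ENNReal.toReal_pos (lintegral_exp_ne_zero hm y) (hfin y)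
  refine ⟨convex_univ, fun y _ z _ a b ha hb hab => ?_⟩
  have h := ENNReal.toReal_mono (ENNReal.mul_ne_top
    (ENNReal.rpow_ne_top_of_nonneg ha (hfin y)) (ENNReal.rpow_ne_top_of_nonneg hb (hfin z)))
    (lintegral_exp_combo_le hm hg ha hb hab)
  have h' := Real.log_le_log (hpos _) h
  rwa [ENNReal.toReal_mul, ← ENNReal.toReal_rpow, ← ENNReal.toReal_rpow,
    Real.log_mul (Real.rpow_pos_of_pos (hpos y) a).ne' (Real.rpow_pos_of_pos (hpos z) b).ne',
    Real.log_rpow (hpos y), Real.log_rpow (hpos z)] at h'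

end LogIntegral

/-! ### Sinkhorn potentials -/

section Potentials

open Set Filter Topology

variable {W : Eucl d → Eucl d → ℝ} {u : Eucl d → ℝ} {Q : Matrix (Fin d) (Fin d) ℝ}

lemma contDiff_apply (hW : ContDiff ℝ 2 (Function.uncurry W)) (x : Eucl d) : ContDiff ℝ 2 (W x) :=
  hW.comp (contDiff_const.prodMk contDiff_id)

lemma contDiff_flat (hW : ContDiff ℝ 2 (Function.uncurry W)) :
    ContDiff ℝ 2 (Function.uncurry (flat W)) :=
  hW.comp (contDiff_snd.prodMk contDiff_fst)

lemma convexOn_sub_add_quad (hW : ContDiff ℝ 2 (Function.uncurry W))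
    (hQ : HessOscBound (flat W) Q) (x₀ x : Eucl d) :
    ConvexOn ℝ univ fun y => W x₀ y - W x y + quad ((1 / 2 : ℝ) • Q) y := by
  refine (((hasLineSecondDeriv_of_contDiff (contDiff_apply hW x₀)).sub
    (hasLineSecondDeriv_of_contDiff (contDiff_apply hW x))).add
      (hasLineSecondDeriv_quad ((1 / 2 : ℝ) • Q))).convexOn fun y k => ?_
  have h : 0 ≤ quad (Q - (hess (W x) y - hess (W x₀) y)) k := quad_nonneg (hQ y x x₀) k
  rw [quad_sub, quad_sub] at h
  rw [quad_smul]
  linarith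

lemma exp_sub_add_quad (x₀ x y : Eucl d) :
    ENNReal.ofReal (Real.exp (W x₀ y - W x y + quad Q y - u x)) =
      ENNReal.ofReal (Real.exp (W x₀ y + quad Q y)) *
        ENNReal.ofReal (Real.exp (-(W x y + u x))) := by
  rw [← ENNReal.ofReal_mul (Real.exp_pos _).le, ← Real.exp_add]
  congr 2; ring

lemma lintegral_exp_potential_ne_top (hW : ContDiff ℝ 2 (Function.uncurry W)) (hu : Measurable u)
    (hQ : HessOscBound (flat W) Q)
    (hfin : ∀ᵐ y, ∫⁻ x, ENNReal.ofReal (Real.exp (-(W x y + u x))) ≠ ⊤) (y : Eucl d) :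
    ∫⁻ x, ENNReal.ofReal (Real.exp (-(W x y + u x))) ≠ ⊤ := by
  have hWm : ∀ y, Measurable fun x => W x y := fun y =>
    (contDiff_apply (contDiff_flat hW) y).continuous.measurable
  have key : ∀ y, ∫⁻ x, ENNReal.ofReal (Real.exp (W 0 y - W x y + quad ((1 / 2 : ℝ) • Q) y - u x)) =
      ENNReal.ofReal (Real.exp (W 0 y + quad ((1 / 2 : ℝ) • Q) y)) *
        ∫⁻ x, ENNReal.ofReal (Real.exp (-(W x y + u x))) := fun y => by
    simp only [exp_sub_add_quad]
    rw [lintegral_const_mul' _ _ ENNReal.ofReal_ne_top]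
  have h := lintegral_exp_ne_top
    (g := fun x y => W 0 y - W x y + quad ((1 / 2 : ℝ) • Q) y - u x)
    (fun y => by have := hWm y; fun_prop)
    (fun x => (convexOn_sub_add_quad hW hQ 0 x).sub (concaveOn_const _ convex_univ)) ?_ y
  · rw [key] at h
    exact fun ht => h (by
      rw [ht, ENNReal.mul_top (ENNReal.ofReal_pos.2 (Real.exp_pos _)).ne'])
  · filter_upwards [hfin] with y hy
    rw [key]
    exact ENNReal.mul_ne_top ENNReal.ofReal_ne_top hy

/-- The Sinkhorn potential inherits semi-convexity from the reference potential: it is the logarithm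
of an integral of log-convex functions. -/
lemma convexOn_add_log_gibbsOp (hW : ContDiff ℝ 2 (Function.uncurry W)) (hu : Measurable u)
    (hQ : HessOscBound (flat W) Q)
    (hfin : ∀ y, ∫⁻ x, ENNReal.ofReal (Real.exp (-(W x y + u x))) ≠ ⊤) (x₀ : Eucl d) :
    ConvexOn ℝ univ fun y => W x₀ y +
      Real.log (gibbsOp (flat W) (fun x => Real.exp (-u x)) y) + quad ((1 / 2 : ℝ) • Q) y := by
  have hWm : ∀ y, Measurable fun x => W x y := fun y =>
    (contDiff_apply (contDiff_flat hW) y).continuous.measurable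
  set Q' := (1 / 2 : ℝ) • Q
  set Z : Eucl d → ℝ≥0∞ := fun y => ∫⁻ x, ENNReal.ofReal (Real.exp (-(W x y + u x)))
  have hZ0 : ∀ y, Z y ≠ 0 := fun y =>
    lintegral_exp_ne_zero (g := fun x y => -(W x y + u x))
      (fun y => by have := hWm y; fun_prop) y
  have key : ∀ y, ∫⁻ x, ENNReal.ofReal (Real.exp (W x₀ y - W x y + quad Q' y - u x)) =
      ENNReal.ofReal (Real.exp (W x₀ y + quad Q' y)) * Z y := fun y => by
    simp only [exp_sub_add_quad]
    rw [lintegral_const_mul' _ _ ENNReal.ofReal_ne_top]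
  have hZ : ∀ y, gibbsOp (flat W) (fun x => Real.exp (-u x)) y = (Z y).toReal := by
    intro y
    have := hWm y
    rw [gibbsOp, integral_eq_lintegral_of_nonneg_ae (.of_forall fun x => by positivity)
      (Measurable.aestronglyMeasurable (by unfold flat; fun_prop))]
    congr 1
    refine lintegral_congr fun x => ?_
    rw [← Real.exp_add, flat]; congr 2; ring
  have h := convexOn_log_lintegral_exp
    (g := fun x y => W x₀ y - W x y + quad Q' y - u x)
    (fun y => by have := hWm y; fun_prop)
    (fun x => (convexOn_sub_add_quad hW hQ x₀ x).sub (concaveOn_const _ convex_univ))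
    (fun y => by rw [key]; exact ENNReal.mul_ne_top ENNReal.ofReal_ne_top (hfin y))
  refine h.congr fun y _ => ?_
  simp only [key, hZ]
  rw [ENNReal.toReal_mul, ENNReal.toReal_ofReal (Real.exp_pos _).le,
    Real.log_mul (Real.exp_pos _).ne' (ENNReal.toReal_pos (hZ0 y) (hfin y)).ne', Real.log_exp]
  ring

end Potentials

/-! ### Log-Sobolev and Fisher-Lipschitz inequalities for Gibbs kernels -/

section GibbsKernel

open Set Filter Topology

/-- `ρ` is a log-Sobolev constant of every Gibbs probability measure whose potential is the sum of
a `C²` function `V` and a function that becomes convex after addition of `yᵀ Q y / 2`, where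
`∇²V - Q` is at least `A⁻¹` outside the ball of radius `δ` and at least `-B` inside. -/
def IsLogSobolevBound (A B : Matrix (Fin d) (Fin d) ℝ) (δ ρ : ℝ) : Prop :=
  0 < ρ ∧ ∀ (V Φ : Eucl d → ℝ) (Q : Matrix (Fin d) (Fin d) ℝ), ContDiff ℝ 2 V →
    ConvexOn ℝ univ (fun y => Φ y - V y + quad ((1 / 2 : ℝ) • Q) y) →
    (∀ x, δ ≤ ‖x‖ → (hess V x - Q - A⁻¹).PosSemidef) →
    (∀ x, ‖x‖ < δ → (hess V x - Q + B).PosSemidef) →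
    IsProbabilityMeasure (gibbs Φ) → LogSobolev (gibbs Φ) ρ

lemma exists_isLogSobolevBound {A : Matrix (Fin d) (Fin d) ℝ} (B : Matrix (Fin d) (Fin d) ℝ)
    (δ : ℝ) (hA : A.PosDef) : ∃ ρ, IsLogSobolevBound A B δ ρ := by
  obtain ⟨a, ha, haA⟩ := exists_mul_norm_sq_le_quad hA.inv
  obtain ⟨φ, q, C, hφc, hφC, hφq, hq1, hq2⟩ :=
    exists_bounded_convexifier d ha (norm_nonneg (Matrix.toEuclideanCLM (n := Fin d) (𝕜 := ℝ) B)) δ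
  refine ⟨8 * Real.exp (2 * C) / (a / 2), by positivity, fun V Φ Q hV hΦ hout hin hp => ?_⟩
  have hsc : StrongConvexOn univ (a / 2) fun x => Φ x + φ x := by
    rw [strongConvexOn_iff_convex]
    have h := (((hasLineSecondDeriv_of_contDiff hV).sub
      (hasLineSecondDeriv_quad ((1 / 2 : ℝ) • Q + (a / 4) • 1))).add hφq).convexOn fun x k => ?_
    · refine (hΦ.add h).congr fun y _ => ?_
      simp only [Pi.add_apply, quad_add, quad_smul, quad_one]
      ring
    · simp only [quad_add, quad_smul, quad_one]
      rcases lt_or_ge ‖x‖ δ with hx | hx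
      · have h1 := quad_nonneg (hin x hx) k
        have h2 := quad_le B k
        have h3 := hq2 x k hx
        rw [quad_add, quad_sub] at h1
        rw [specNorm] at h2
        nlinarith
      · have h1 := quad_nonneg (hout x hx) k
        have h2 := haA k
        have h3 := hq1 x k
        rw [quad_sub, quad_sub] at h1
        nlinarith
  have hΦc : Continuous Φ :=
    ((continuous_of_strongConvexOn hsc).sub hφc).congr fun x => add_sub_cancel_right _ _
  exact logSobolev_gibbs (by positivity) hΦc hφC hsc

/-- The inequality holds under the integral along every coupling, hence for the infima. -/
lemma localLogSobolev_of_logSobolev {K : Kernel (Eucl d) (Eucl d)} [IsMarkovKernel K] {ρ : ℝ}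
    (hρ : 0 < ρ) (h : ∀ x, LogSobolev (K x) ρ) : LocalLogSobolev K ρ := by
  refine ⟨hρ, fun ν μ _ _ => ?_⟩
  have hc0 : ENNReal.ofReal (ρ / 2) ≠ 0 := (ENNReal.ofReal_pos.2 (by positivity)).ne'
  rw [← ENNReal.div_le_iff' hc0 ENNReal.ofReal_ne_top]
  refine le_iInf fun Q => le_iInf fun hQ => ?_
  rw [ENNReal.div_le_iff' hc0 ENNReal.ofReal_ne_top, ← lintegral_const_mul' _ _
    ENNReal.ofReal_ne_top]
  exact (iInf₂_le Q hQ).trans (lintegral_mono fun p => (h p.2).2 (K p.1) inferInstance)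

lemma hasWeakGradient_of_contDiff {f : Eucl d → ℝ} (hf : ContDiff ℝ 1 f) :
    HasWeakGradient f (gradient f) := by
  have hgc : Continuous (gradient f) := (InnerProductSpace.toDual ℝ (Eucl d)).symm.continuous.comp
    (hf.continuous_fderiv one_ne_zero)
  refine ⟨hf.continuous.locallyIntegrable, hgc.locallyIntegrable, fun φ hφ hφs => ?_⟩
  have hφg : Continuous (gradient φ) := (InnerProductSpace.toDual ℝ (Eucl d)).symm.continuous.comp
    (hφ.continuous_fderiv (by simp))
  have hφgs : HasCompactSupport (gradient φ) := by
    refine (hφs.fderiv ℝ).mono fun x hx h0 => hx ?_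
    rw [gradient, h0, map_zero]
  have i1 : Integrable fun x => f x • gradient φ x :=
    hf.continuous.locallyIntegrable.integrable_smul_right_of_hasCompactSupport hφg hφgs
  have i2 : Integrable fun x => φ x • gradient f x :=
    hgc.locallyIntegrable.integrable_smul_left_of_hasCompactSupport hφ.continuous hφs
  refine ext_inner_right ℝ fun v => ?_
  have e : ∀ (g : Eucl d → ℝ) (x : Eucl d), inner ℝ v (gradient g x) = fderiv ℝ g x v :=
    fun g x => by rw [real_inner_comm, gradient, InnerProductSpace.toDual_symm_apply]
  have hfc := hf.continuous
  have hφc := hφ.continuous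
  have hfd : Continuous fun x => fderiv ℝ f x v := (hf.continuous_fderiv one_ne_zero).clm_apply
    continuous_const
  have hφd : Continuous fun x => fderiv ℝ φ x v := (hφ.continuous_fderiv (by simp)).clm_apply
    continuous_const
  have hφds : HasCompactSupport fun x => fderiv ℝ φ x v :=
    (hφs.fderiv ℝ).mono fun x hx h0 => hx (by simp only [h0, _root_.zero_apply])
  rw [inner_neg_left, real_inner_comm, ← integral_inner i1, real_inner_comm, ← integral_inner i2]
  simp only [inner_smul_right, e]
  have h := integral_mul_fderiv_eq_neg_fderiv_mul_of_integrable (μ := volume) (f := f) (g := φ)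
    (v := v) (Continuous.integrable_of_hasCompactSupport (by fun_prop)
      (hφs.mono fun x hx h0 => hx (by simp only [h0, mul_zero])))
    (Continuous.integrable_of_hasCompactSupport (by fun_prop)
      (hφds.mono fun x hx h0 => hx (by simp only [h0, mul_zero])))
    (Continuous.integrable_of_hasCompactSupport (by fun_prop)
      (hφs.mono fun x hx h0 => hx (by simp only [h0, mul_zero])))
    (fun x _ => hf.differentiable one_ne_zero x) (fun x _ => hφ.differentiable (by simp) x)
  rw [h]
  congr 2; ext x; ring

/-- The density `exp g` has weak gradient `exp g • ∇g`, which gives the value `∫ ‖∇g‖² exp g` of the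
Fisher information. -/
lemma fisherInfo_gibbs_le {Φ₁ Φ₂ g : Eucl d → ℝ} (hΦ₂ : Measurable Φ₂)
    (hg : ContDiff ℝ 1 g) (h : ∀ y, Φ₂ y - Φ₁ y = g y) [IsProbabilityMeasure (gibbs Φ₁)]
    [IsProbabilityMeasure (gibbs Φ₂)] {L : ℝ} (hL : ∀ y, ‖gradient g y‖ ≤ L) :
    fisherInfo (gibbs Φ₁) (gibbs Φ₂) ≤ ENNReal.ofReal (L ^ 2) := by
  have hgm : Measurable g := hg.continuous.measurable
  have hwd : gibbs Φ₁ = (gibbs Φ₂).withDensity fun y => ENNReal.ofReal (Real.exp (g y)) := by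
    rw [gibbs, gibbs, ← withDensity_mul _ (by fun_prop) (by fun_prop)]
    congr 1; ext y
    rw [Pi.mul_apply, ← ENNReal.ofReal_mul (Real.exp_pos _).le, ← Real.exp_add, ← h]
    congr 2; ring
  have hgrad : ∀ y, gradient (fun y => Real.exp (g y)) y = Real.exp (g y) • gradient g y := by
    intro y
    have h1 := (hg.differentiable one_ne_zero y).hasFDerivAt.exp
    rw [gradient, h1.fderiv, map_smul]; rfl
  have hac : gibbs Φ₁ ≪ gibbs Φ₂ := by
    rw [hwd]; exact withDensity_absolutelyContinuous _ _
  have hrn : (gibbs Φ₁).rnDeriv (gibbs Φ₂)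
      =ᵐ[gibbs Φ₂] fun y => ENNReal.ofReal (Real.exp (g y)) := by
    rw [hwd]; exact Measure.rnDeriv_withDensity _ (by fun_prop)
  refine (iInf₂_le (fun y => Real.exp (g y)) (gradient fun y => Real.exp (g y))).trans
    ((iInf_le _ ⟨hac, fun y => (Real.exp_pos _).le, hrn,
      hasWeakGradient_of_contDiff hg.exp⟩).trans ?_)
  · calc ∫⁻ y, ENNReal.ofReal (‖gradient (fun y => Real.exp (g y)) y‖ ^ 2 / Real.exp (g y)) ∂gibbs Φ₂
        ≤ ∫⁻ y, ENNReal.ofReal (L ^ 2) * ENNReal.ofReal (Real.exp (g y)) ∂gibbs Φ₂ := by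
          refine lintegral_mono fun y => ?_
          rw [← ENNReal.ofReal_mul (by positivity)]
          refine ENNReal.ofReal_le_ofReal ?_
          have he := Real.exp_pos (g y)
          rw [hgrad, norm_smul, Real.norm_eq_abs, abs_of_pos he, div_le_iff₀ he, mul_pow]
          have := pow_le_pow_left₀ (norm_nonneg _) (hL y) 2
          nlinarith [mul_le_mul_of_nonneg_left this (sq_nonneg (Real.exp (g y)))]
      _ = ENNReal.ofReal (L ^ 2) := by
          have h1 : ∫⁻ y, ENNReal.ofReal (Real.exp (g y)) ∂gibbs Φ₂ = 1 := by
            rw [← measure_univ (μ := gibbs Φ₁), hwd, withDensity_apply _ .univ, setLIntegral_univ]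
          rw [lintegral_const_mul' _ _ ENNReal.ofReal_ne_top, h1, mul_one]

/-- A transition of a Sinkhorn bridge, after one update of each potential, is Markov and satisfies
the log-Sobolev inequality and the Fisher-Lipschitz inequality. -/
lemma condA0_gibbsKernel_transPot {U V : Eucl d → ℝ} {W : Eucl d → Eucl d → ℝ} {u v : Eucl d → ℝ}
    {A B Q Q' : Matrix (Fin d) (Fin d) ℝ} {κ ρ δ : ℝ}
    (hU : ContDiff ℝ 2 U) (hV : ContDiff ℝ 2 V) (hW : ContDiff ℝ 2 (Function.uncurry W))
    (hu : Measurable u) (hv : v = newPot V (flat W) u)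
    (hfu : ∀ᵐ y, ∫⁻ x, ENNReal.ofReal (Real.exp (-(W x y + u x))) ≠ ⊤)
    (hfv : ∀ᵐ x, ∫⁻ y, ENNReal.ofReal (Real.exp (-(W x y + v y))) ≠ ⊤)
    (hQ' : HessOscBound W Q') (hQ : HessOscBound (flat W) Q) (hκ : 0 < κ) (hL : GradLipschitz W κ)
    (hρ : IsLogSobolevBound A B δ ρ) (hout : ∀ x, δ ≤ ‖x‖ → (hess V x - Q - A⁻¹).PosSemidef)
    (hin : ∀ x, ‖x‖ < δ → (hess V x - Q + B).PosSemidef) :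
    (∀ x, LogSobolev (gibbsKernel (transPot U W (newPot U W v) v) x) ρ) ∧
      CondA0 (gibbsKernel (transPot U W (newPot U W v) v)) κ ρ := by
  have hUm := hU.continuous.measurable
  have hVm := hV.continuous.measurable
  have hWm := hW.continuous.measurable
  have hvm : Measurable v := hv ▸ measurable_newPot hVm (measurable_flat hWm) hu
  have hTm := measurable_transPot hUm hWm (measurable_newPot hUm hWm hvm) hvm
  set T := transPot U W (newPot U W v) v with hT
  have hfu' := lintegral_exp_potential_ne_top hW hu hQ hfu
  have hfv' : ∀ x, ∫⁻ y, ENNReal.ofReal (Real.exp (-(W x y + v y))) ≠ ⊤ :=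
    lintegral_exp_potential_ne_top (W := flat W) (contDiff_flat hW) hvm hQ' hfv
  have hprob : ∀ x, IsProbabilityMeasure (gibbs (T x)) := by
    intro x
    refine ⟨?_⟩
    rw [gibbs, withDensity_apply _ .univ, setLIntegral_univ]
    have h := lintegral_exp_newPot (U := U) hWm hvm (hfv' x)
    calc ∫⁻ y, ENNReal.ofReal (Real.exp (-T x y))
        = ∫⁻ y, ENNReal.ofReal (Real.exp (U x)) *
            ENNReal.ofReal (Real.exp (-(newPot U W v x + W x y + v y))) := by
          refine lintegral_congr fun y => ?_
          rw [← ENNReal.ofReal_mul (Real.exp_pos _).le, ← Real.exp_add, hT]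
          simp only [transPot]; congr 2; ring
      _ = 1 := by
          rw [lintegral_const_mul' _ _ ENNReal.ofReal_ne_top, h,
            ← ENNReal.ofReal_mul (Real.exp_pos _).le, ← Real.exp_add, add_neg_cancel, Real.exp_zero,
            ENNReal.ofReal_one]
  have hK : ∀ x, gibbsKernel T x = gibbs (T x) := gibbsKernel_apply hTm
  have : IsMarkovKernel (gibbsKernel T) := ⟨fun x => by rw [hK]; exact hprob x⟩
  have hLS : ∀ x, LogSobolev (gibbsKernel T x) ρ := by
    intro x
    rw [hK]
    refine hρ.2 V (T x) Q hV ?_ hout hin (hprob x)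
    refine ((convexOn_add_log_gibbsOp hW hu hQ hfu' x).add
      (convexOn_const (newPot U W v x - U x) convex_univ)).congr fun y _ => ?_
    rw [Pi.add_apply, hT]
    simp only [transPot]
    have hvy : v y = V y + Real.log (gibbsOp (flat W) (fun x => Real.exp (-u x)) y) := congrFun hv y
    linarith
  refine ⟨hLS, this, localLogSobolev_of_logSobolev hρ.1 hLS, hκ, fun x₁ x₂ => ?_⟩
  rw [hK, hK, ← mul_pow]
  have := hprob x₁
  have := hprob x₂
  -- the update `v` cancels in the log-density of `K x₁` with respect to `K x₂`
  set c := newPot U W v x₂ - U x₂ - (newPot U W v x₁ - U x₁)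
  have h1 := contDiff_apply hW x₁
  have h2 := contDiff_apply hW x₂
  refine fisherInfo_gibbs_le (Φ₁ := T x₁) (Φ₂ := T x₂) (g := fun y => W x₂ y - W x₁ y + c)
    (hTm.comp measurable_prodMk_left) (((h2.sub h1).add contDiff_const).of_le one_le_two)
    (fun y => by simp only [hT, transPot, c]; ring) fun y => ?_
  have hd : HasFDerivAt (fun y => W x₂ y - W x₁ y + c) (fderiv ℝ (W x₂) y - fderiv ℝ (W x₁) y) y :=
    ((h2.differentiable two_ne_zero y).hasFDerivAt.sub
      (h1.differentiable two_ne_zero y).hasFDerivAt).add_const c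
  have hgr : gradient (fun y => W x₂ y - W x₁ y + c) y = gradient (W x₂) y - gradient (W x₁) y := by
    rw [gradient, hd.fderiv, map_sub]; rfl
  rw [hgr, norm_sub_rev]
  exact hL x₁ x₂ y

end GibbsKernel

/-! ### Sinkhorn transitions -/

section SinkhornTransitions

variable {U V : Eucl d → ℝ} {W : Eucl d → Eucl d → ℝ} {A B Q Q' : Matrix (Fin d) (Fin d) ℝ}
  {κ ρ δ : ℝ}

lemma condA0_sinkhornKernel_even (hU : ContDiff ℝ 2 U) (hV : ContDiff ℝ 2 V)
    (hW : ContDiff ℝ 2 (Function.uncurry W)) (hM : IsModel U V W)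
    (hQ' : HessOscBound W Q') (hQ : HessOscBound (flat W) Q) (hκ : 0 < κ) (hL : GradLipschitz W κ)
    (hρ : IsLogSobolevBound A B δ ρ) (hout : ∀ x, δ ≤ ‖x‖ → (hess V x - Q - A⁻¹).PosSemidef)
    (hin : ∀ x, ‖x‖ < δ → (hess V x - Q + B).PosSemidef) (n : ℕ) :
    (∀ x, LogSobolev (sinkhornKernel U V W (2 * n + 2) x) ρ) ∧
      CondA0 (sinkhornKernel U V W (2 * n + 2)) κ ρ := by
  have hUm := hU.continuous.measurable
  have hVm := hV.continuous.measurable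
  have hWm := hW.continuous.measurable
  obtain ⟨h1, h2⟩ := measurable_sinkhornPot hUm hVm hWm (2 * n)
  obtain ⟨h3, h4⟩ := measurable_sinkhornPot hUm hVm hWm (2 * n + 1)
  have hp := isProbabilityMeasure_bridge_sinkhornPot hUm hVm hWm hM (2 * n)
  have hp' := isProbabilityMeasure_bridge_sinkhornPot hUm hVm hWm hM (2 * n + 1)
  have hpf := isProbabilityMeasure_bridge_flat hWm h1 h2
  have e : sinkhornKernel U V W (2 * n + 2) = gibbsKernel (transPot U W
      (newPot U W (sinkhornPot U V W (2 * n + 1)).2) (sinkhornPot U V W (2 * n + 1)).2) := by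
    have := sinkhornKernel_even U V W (n + 1)
    rwa [show 2 * (n + 1) = 2 * n + 2 by ring, sinkhornPot_even] at this
  have hfu := ae_lintegral_exp_ne_top (measurable_flat hWm) h2 h1
  rw [e]
  exact condA0_gibbsKernel_transPot hU hV hW h1 (by rw [sinkhornPot_odd]) hfu
    (ae_lintegral_exp_ne_top hWm h3 h4) hQ' hQ hκ hL hρ hout hin

/-- The first potential of an even Sinkhorn bridge is obtained by an update, also at time `0`. -/
lemma exists_sinkhornPot_fst_eq (hU : Measurable U) (hV : Measurable V)
    (hW : Measurable (Function.uncurry W)) (hM : IsModel U V W) (n : ℕ) :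
    ∃ v : Eucl d → ℝ, Measurable v ∧ (sinkhornPot U V W (2 * n)).1 = newPot U W v ∧
      ∀ᵐ x, ∫⁻ y, ENNReal.ofReal (Real.exp (-(W x y + v y))) ≠ ⊤ := by
  rcases n with _ | n
  · refine ⟨fun _ => 0, measurable_const, rfl, .of_forall fun x => ?_⟩
    have := hM.markov_W.isProbabilityMeasure x
    have h := measure_ne_top (gibbsKernel W x) Set.univ
    rw [gibbsKernel_apply hW, gibbs, withDensity_apply _ .univ, setLIntegral_univ] at h
    simpa using h
  · obtain ⟨h1, h2⟩ := measurable_sinkhornPot hU hV hW (2 * n + 1)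
    have hp := isProbabilityMeasure_bridge_sinkhornPot hU hV hW hM (2 * n + 1)
    refine ⟨(sinkhornPot U V W (2 * n + 1)).2, h2, ?_, ae_lintegral_exp_ne_top hW h1 h2⟩
    rw [show 2 * (n + 1) = 2 * n + 2 by ring, sinkhornPot_even]

lemma condA0_sinkhornKernel_odd (hU : ContDiff ℝ 2 U) (hV : ContDiff ℝ 2 V)
    (hW : ContDiff ℝ 2 (Function.uncurry W)) (hM : IsModel U V W)
    (hQ' : HessOscBound (flat W) Q') (hQ : HessOscBound W Q) (hκ : 0 < κ)
    (hL : GradLipschitz (flat W) κ)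
    (hρ : IsLogSobolevBound A B δ ρ) (hout : ∀ x, δ ≤ ‖x‖ → (hess U x - Q - A⁻¹).PosSemidef)
    (hin : ∀ x, ‖x‖ < δ → (hess U x - Q + B).PosSemidef) (n : ℕ) :
    (∀ y, LogSobolev (sinkhornKernel U V W (2 * n + 1) y) ρ) ∧
      CondA0 (sinkhornKernel U V W (2 * n + 1)) κ ρ := by
  have hUm := hU.continuous.measurable
  have hVm := hV.continuous.measurable
  have hWm := hW.continuous.measurable
  obtain ⟨h1, h2⟩ := measurable_sinkhornPot hUm hVm hWm (2 * n)
  obtain ⟨v, hv, huv, hfin⟩ := exists_sinkhornPot_fst_eq hUm hVm hWm hM n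
  have hp := isProbabilityMeasure_bridge_sinkhornPot hUm hVm hWm hM (2 * n)
  have hpf := isProbabilityMeasure_bridge_flat hWm h1 h2
  rw [sinkhornKernel_odd, sinkhornPot_odd]
  exact condA0_gibbsKernel_transPot (W := flat W) hV hU (contDiff_flat hW) hv huv hfin
    (ae_lintegral_exp_ne_top (measurable_flat hWm) h2 h1) hQ' hQ hκ hL hρ hout hin

variable {R : Measure (Eucl d × Eucl d)}

lemma klDiv_gibbs_sinkhornPi_even_le (hU : Measurable U) (hV : Measurable V)
    (hW : Measurable (Function.uncurry W)) (hM : IsModel U V W)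
    (hR : IsCoupling R (gibbs U) (gibbs V)) (n : ℕ) :
    klDiv (gibbs V) (sinkhornPi U V W (2 * n)) ≤ klDiv R (sinkhornBridge U V W (2 * n)) := by
  have := hM.prob_U
  have := isProbabilityMeasure_of_fst hR.1
  have := isProbabilityMeasure_sinkhornBridge hU hV hW hM (2 * n)
  rw [sinkhornPi_even hM, ← hR.2]
  exact klDiv_snd_le _ _

lemma klDiv_gibbs_sinkhornPi_odd_le (hU : Measurable U) (hV : Measurable V)
    (hW : Measurable (Function.uncurry W)) (hM : IsModel U V W)
    (hR : IsCoupling R (gibbs U) (gibbs V)) (n : ℕ) :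
    klDiv (gibbs U) (sinkhornPi U V W (2 * n + 1)) ≤
      klDiv R (sinkhornBridge U V W (2 * n + 1)) := by
  have := hM.prob_U
  have := isProbabilityMeasure_of_fst hR.1
  have := isProbabilityMeasure_sinkhornBridge hU hV hW hM (2 * n + 1)
  rw [sinkhornPi_odd hM, ← hR.1]
  exact klDiv_fst_le _ _

/-- The Hessian bounds of `CondCMinus`, shifted by the loss of convexity `Ah⁻¹` of the Sinkhorn
potential. -/
lemma hess_sub_of_condCMinus {Ap Ah Abar : Matrix (Fin d) (Fin d) ℝ} {c : Matrix (Fin d) (Fin d) ℝ}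
    (hC : CondCMinus U V Ap Abar δ c) (hh : Ah.PosDef) (h : (Ah - Ap).PosDef) :
    (Ap⁻¹ - Ah⁻¹)⁻¹.PosDef ∧
      (∀ x, δ ≤ ‖x‖ → (hess U x - Ah⁻¹ - (Ap⁻¹ - Ah⁻¹)⁻¹⁻¹).PosSemidef) ∧
      ∀ x, ‖x‖ < δ → (hess U x - Ah⁻¹ + (Abar + Ah⁻¹)).PosSemidef := by
  obtain ⟨h1, h2, h3, h4, hout, hin, -⟩ := hC
  have hp := posDef_inv_sub_inv h1 hh h
  have hu := (Matrix.isUnit_iff_isUnit_det _).1 hp.isUnit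
  refine ⟨hp.inv, fun x hx => ?_, fun x hx => ?_⟩
  · rw [Matrix.nonsing_inv_nonsing_inv _ hu, sub_sub_sub_cancel_right]
    exact hout x hx
  · have e : hess U x - Ah⁻¹ + (Abar + Ah⁻¹) = hess U x + Abar := by abel
    rw [e]
    exact hin x hx

end SinkhornTransitions

end SinkhornBridge

end

open SinkhornBridge in
theorem mainTheorem3 (d : ℕ) (hd : 1 ≤ d) :
    -- general reference transitions
    (∀ (U V : Eucl d → ℝ) (W : Eucl d → Eucl d → ℝ),
      Measurable U → Measurable V → Measurable (Function.uncurry W) → IsModel U V W →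
      IsSinkhornSequence (refMeasure U W) (gibbs U) (gibbs V) (sinkhornBridge U V W) ∧
      (HasFiniteEntropyCoupling U V W →
        ∀ Q, IsSchrodingerBridge (refMeasure U W) (gibbs U) (gibbs V) Q →
          (∀ (κ ρ : ℕ → ℝ) (up : Matrix (Fin d) (Fin d) ℝ), CondAU U V W κ ρ up →
            ∀ n, 1 ≤ n →
              klDiv Q (sinkhornBridge U V W (2 * n)) ≤
                ENNReal.ofReal ((1 + (epsRate (κ (2 * n)) (ρ (2 * n)) (specNorm up))⁻¹)⁻¹) *
                  klDiv Q (sinkhornBridge U V W (2 * (n - 1)))) ∧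
          (∀ (κ ρ : ℕ → ℝ) (vp : Matrix (Fin d) (Fin d) ℝ), CondAV U V W κ ρ vp →
            ∀ n, 1 ≤ n →
              klDiv Q (sinkhornBridge U V W (2 * n + 1)) ≤
                ENNReal.ofReal
                    ((1 + (epsRate (κ (2 * n + 1)) (ρ (2 * n + 1)) (specNorm vp))⁻¹)⁻¹) *
                  klDiv Q (sinkhornBridge U V W (2 * n - 1))))) ∧
    -- explicit constants; `rho` depends only on the dimension and on its three arguments
    ∃ rho : Matrix (Fin d) (Fin d) ℝ → Matrix (Fin d) (Fin d) ℝ → ℝ → ℝ,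
      (∀ A B δ, A.PosDef → B.PosSemidef → 0 ≤ δ → 0 < rho A B δ) ∧
      ∀ (U V : Eucl d → ℝ) (W : Eucl d → Eucl d → ℝ),
        ContDiff ℝ 2 U → ContDiff ℝ 2 V → ContDiff ℝ 2 (Function.uncurry W) → IsModel U V W →
        ∀ (κ : ℝ) (uh vh : Matrix (Fin d) (Fin d) ℝ), 0 < κ → CondW W κ uh vh →
          (∀ (vp vbar : Matrix (Fin d) (Fin d) ℝ) (δ : ℝ) (up : Matrix (Fin d) (Fin d) ℝ),
            CondCMinus V U vp vbar δ up → (vh - vp).PosDef →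
            ∀ rv : ℝ, rv = rho (vp⁻¹ - vh⁻¹)⁻¹ (vbar + vh⁻¹) δ →
              (∀ n, 1 ≤ n → ∀ x, LogSobolev (sinkhornKernel U V W (2 * n) x) rv) ∧
              CondAU U V W (fun _ => κ) (fun _ => rv) up ∧
              (HasFiniteEntropyCoupling U V W →
                ∀ Q, IsSchrodingerBridge (refMeasure U W) (gibbs U) (gibbs V) Q →
                ∀ n, 1 ≤ n →
                  klDiv (gibbs V) (sinkhornPi U V W (2 * n)) ≤
                    klDiv Q (sinkhornBridge U V W (2 * n)) ∧
                  klDiv Q (sinkhornBridge U V W (2 * n)) ≤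
                    ENNReal.ofReal (epsRate κ rv (specNorm up)) *
                      klDiv (sinkhornPi U V W (2 * n - 1)) (gibbs U) ∧
                  klDiv Q (sinkhornBridge U V W (2 * n)) ≤
                    ENNReal.ofReal ((1 + (epsRate κ rv (specNorm up))⁻¹)⁻¹) *
                      klDiv Q (sinkhornBridge U V W (2 * (n - 1))))) ∧
          (∀ (up ubar : Matrix (Fin d) (Fin d) ℝ) (δ : ℝ) (vp : Matrix (Fin d) (Fin d) ℝ),
            CondCMinus U V up ubar δ vp → (uh - up).PosDef →
            ∀ ru : ℝ, ru = rho (up⁻¹ - uh⁻¹)⁻¹ (ubar + uh⁻¹) δ →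
              (∀ n, 1 ≤ n → ∀ y, LogSobolev (sinkhornKernel U V W (2 * n - 1) y) ru) ∧
              CondAV U V W (fun _ => κ) (fun _ => ru) vp ∧
              (HasFiniteEntropyCoupling U V W →
                ∀ Q, IsSchrodingerBridge (refMeasure U W) (gibbs U) (gibbs V) Q →
                (∀ n,
                  klDiv (gibbs U) (sinkhornPi U V W (2 * n + 1)) ≤
                    klDiv Q (sinkhornBridge U V W (2 * n + 1)) ∧
                  klDiv Q (sinkhornBridge U V W (2 * n + 1)) ≤
                    ENNReal.ofReal (epsRate κ ru (specNorm vp)) *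
                      klDiv (sinkhornPi U V W (2 * n)) (gibbs V)) ∧
                ∀ n, 1 ≤ n →
                  klDiv Q (sinkhornBridge U V W (2 * n + 1)) ≤
                    ENNReal.ofReal ((1 + (epsRate κ ru (specNorm vp))⁻¹)⁻¹) *
                      klDiv Q (sinkhornBridge U V W (2 * n - 1)))) := by
  refine ⟨fun U V W hU hV hW hM => ⟨isSinkhornSequence_sinkhornBridge hU hV hW hM,
    fun hfin Q hQ => ⟨fun κ ρ up hA n hn => ?_, fun κ ρ vp hA n hn => ?_⟩⟩, ?_⟩
  · obtain ⟨n, rfl⟩ := Nat.exists_eq_add_of_le' hn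
    exact klDiv_even_contraction hU hV hW hM hfin hQ n (hA.1 (n + 1) hn) hA.2.2
  · obtain ⟨n, rfl⟩ := Nat.exists_eq_add_of_le' hn
    exact klDiv_odd_contraction hU hV hW hM hfin hQ n (hA.1 (n + 2) (by omega)) hA.2.2
  -- a choice of log-Sobolev constants, with an arbitrary value where `A` is not positive definite
  have hex : ∀ (A B : Matrix (Fin d) (Fin d) ℝ) (δ : ℝ), ∃ ρ, A.PosDef →
      IsLogSobolevBound A B δ ρ := fun A B δ => by
    by_cases hA : A.PosDef
    · obtain ⟨ρ, hρ⟩ := exists_isLogSobolevBound B δ hA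
      exact ⟨ρ, fun _ => hρ⟩
    · exact ⟨0, fun h => (hA h).elim⟩
  choose rho hrho using hex
  refine ⟨rho, fun A B δ hA _ _ => (hrho A B δ hA).1,
    fun U V W hU hV hW hM κ uh vh hκ ⟨hL, hL', huh, hvh, hQu, hQv⟩ => ⟨?_, ?_⟩⟩
  · rintro vp vbar δ up hC hlt rv rfl
    have hUm := hU.continuous.measurable
    have hVm := hV.continuous.measurable
    have hWm := hW.continuous.measurable
    obtain ⟨hpd, hout, hin⟩ := hess_sub_of_condCMinus hC hvh hlt
    obtain ⟨-, -, -, hup, -, -, hT⟩ := hC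
    have hK := condA0_sinkhornKernel_even hU hV hW hM hQu hQv hκ hL (hrho _ (vbar + vh⁻¹) δ hpd)
      hout hin
    refine ⟨fun n hn => ?_, ⟨fun n hn => ?_, hup, hT⟩, fun hfin Q hQ n hn => ?_⟩
    all_goals obtain ⟨n, rfl⟩ := Nat.exists_eq_add_of_le' hn
    · exact (hK n).1
    · exact (hK n).2
    · exact ⟨klDiv_gibbs_sinkhornPi_even_le hUm hVm hWm hM hQ.1 (n + 1),
        klDiv_even_le hUm hVm hWm hM hfin hQ n (hK n).2 hT,
        klDiv_even_contraction hUm hVm hWm hM hfin hQ n (hK n).2 hT⟩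
  · rintro up ubar δ vp hC hlt ru rfl
    have hUm := hU.continuous.measurable
    have hVm := hV.continuous.measurable
    have hWm := hW.continuous.measurable
    obtain ⟨hpd, hout, hin⟩ := hess_sub_of_condCMinus hC huh hlt
    obtain ⟨-, -, -, hvp, -, -, hT⟩ := hC
    have hK := condA0_sinkhornKernel_odd hU hV hW hM hQv hQu hκ hL' (hrho _ (ubar + uh⁻¹) δ hpd)
      hout hin
    refine ⟨fun n hn => ?_, ⟨fun n hn => ?_, hvp, hT⟩, fun hfin Q hQ => ⟨fun n => ?_, fun n hn => ?_⟩⟩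
    · obtain ⟨n, rfl⟩ := Nat.exists_eq_add_of_le' hn
      exact (hK n).1
    · obtain ⟨n, rfl⟩ := Nat.exists_eq_add_of_le' hn
      exact (hK n).2
    · exact ⟨klDiv_gibbs_sinkhornPi_odd_le hUm hVm hWm hM hQ.1 n,
        klDiv_odd_le hUm hVm hWm hM hfin hQ n (hK n).2 hT⟩
    · obtain ⟨n, rfl⟩ := Nat.exists_eq_add_of_le' hn
      exact klDiv_odd_contraction hUm hVm hWm hM hfin hQ n (hK (n + 1)).2 hT
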